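/- **Setting.** Fix $1<r_\star<\bar r\le\infty$ and $b_p\ge 0$ ($p\ge 2$) with $\limsup_{p\to\infty}\frac1p\log b_p\le-\log\bar r$, at least two of them non-zero, and let $\nu(r)=\sum_{p\ge2}b_p^2r^p$. For $N\ge1$ let $H(\mathbf x)=\sum_{p\ge 2}b_p\sum_{1\le i_1,\dots,i_p\le N}J_{i_1\dots i_p}x^{i_1}\cdots x^{i_p}$ on the open ball $\mathbb B^N$ of radius $\bar r\sqrt N$ in $\mathbb R^N$, with independent $J_{i_1\dots i_p}\sim\mathcal N(0,N^{-(p-1)})$, and let $H^{[m]}$ be the same sum over $p\le m$ only. For a function $\varphi$ that is $C^2$ on $\mathbb B^N_\star=\{\|\mathbf x\|<r_\star\sqrt N\}$ let $\|\mathrm{Hess}(\varphi)\|_\infty$ be the supremum over $\mathbb B^N_\star$ of the spectral norm of its Hessian (the bounds below include that the fields are $C^2$ there, up to the probabilities that are stated). Fix $q_\star\in[0,1]$. For $\|\mathbf x_0\|=\sqrt N$ and $\|\mathbf x_\star\|=q_\star\sqrt N$ call $\frac1N\langle\mathbf x_0,\mathbf x_\star\rangle$ their overlap, and let $\mathcal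 H=-\big(\frac1NH(\mathbf x_0),\frac1NH(\mathbf x_\star),\nabla H(\mathbf x_\star)\big)$. Given $\mathcal H=v$, Gaussian regression represents the pair $(H,H^{[m]})$ as the sum of a centered Gaussian pair $(H^{\mathbf 0},\hat H^{\mathbf 0,[m]})$, whose law does not depend on $v$, and the non-random pair of conditional means. The latter are denoted $(\bar H_{\vec V},\hat H^{[m]}_{\vec V})$ for $\vec V=(E,E_\star,G_\star,q_o)$, when $v=(E,E_\star,G_\star\mathbf x_\star)$ and the overlap is $q_o$. Let $H^o$ be the centered field $H$ conditioned on the vanishing of the component of $\nabla H(\mathbf x_\star)$ orthogonal to $\mathbf x_\star$. (If $q_\star=0$ then $\mathbf x_\star=\mathbf 0$, one conditions in $\mathcal H$ on $H(\mathbf x_0)$ only, and $H^o=H$.) Call $s\in[-q_\star,q_\star]$ *regular* if $|s|<1$ and, in case $|s|=q_\star>0$, the functions $p\mapsto(s/q_\star)^p$, $p\mapsto q_\star^p$, $p\mapsto p\,q_\star^p$ are linearly independent on $\{p:b_p\ne0\}$ (equivalently, for collinear $\mathbf x_0,\mathbf x_\star$ of overlap $s$, the variables $H(\mathbf x_0)$,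 $H(\mathbf x_\star)$, $\langle\nabla H(\mathbf x_\star),\mathbf x_\star\rangle$ are linearly independent; this holds if at least four $b_p$ are non-zero). Call $\vec V$ *allowed* if $q_o\in[-q_\star,q_\star]$ is regular and, in case $q_\star=0$, $E_\star=G_\star=0$. Fix an allowed $\vec V=(E,E_\star,G_\star,q_o)$. For $\delta>0$ let $\vec B_\delta(\vec V)$ be the set of all $(\mathbf x_0,\mathbf x_\star,\vec V')$ with $\|\vec V'-\vec V\|_\infty<\delta$, overlap $q'_o$ and, if $q_\star=0$, $E'_\star=G'_\star=0$. **Lemma.** (a) Let $\delta>0$ be such that every $s\in[-q_\star,q_\star]\cap[q_o-\delta,q_o+\delta]$ is regular; every small enough $\delta>0$ has this property. There exists $\kappa<\infty$ such that $$\limsup_{N\to\infty}\ \sup_{\mathbf x_0,\mathbf x_\star}\frac1N\log\mathbb P\big(\|\mathrm{Hess}(H^{\mathbf 0})\|_\infty\ge\kappa\big)<0,\qquad \sup_{N\ge1}\ \sup_{\vec B_\delta(\vec V)}\|\mathrm{Hess}(\bar H_{\vec V'})\|_\infty\le\kappa,$$ where the first supremum is over all $\|\mathbf x_0\|=\sqrt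 N$, $\|\mathbf x_\star\|=q_\star\sqrt N$ (hence over all overlaps in $[-q_\star,q_\star]$). Likewise there exist finite $\kappa_m\to0$ as $m\to\infty$ such that for every $m$ both bounds hold with $\kappa_m$ in place of $\kappa$, $H^{\mathbf 0}-\hat H^{\mathbf 0,[m]}$ in place of $H^{\mathbf 0}$, and $\bar H_{\vec V'}-\hat H^{[m]}_{\vec V'}$ in place of $\bar H_{\vec V'}$. (b) For every $\eta>0$ there is $\epsilon>0$ such that $\|\mathrm{Hess}(\bar H_{\vec V'_{\rm e}}-\bar H_{\vec V})\|_\infty\le\eta$ in the following situation, for every $N\ge1$. Let $\|\mathbf x_\star\|=q_\star\sqrt N$ and let $\mathbf z\perp\mathbf x_\star$ be a unit vector. Let $\mathbf x_0,\mathbf x_0'$, both of norm $\sqrt N$, lie in $\mathrm{span}\{\mathbf z,\mathbf x_\star\}$, have non-negative inner products with $\mathbf z$, and have overlaps $q_o$ and $q'_o$ with $\mathbf x_\star$, where $|q_o'-q_o|<\epsilon$. Let $|E'-E|,|E'_\star-E_\star|,|G_\star'-G_\star|,|G'|<\epsilon$, and let $\mathbf w\perp\mathbf x_\star,\mathbf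 z$ with $\|\mathbf w\|<\epsilon\sqrt N$; if $q_\star=0$, let $E'_\star=G'_\star=G'=0$ and $\mathbf w=\mathbf 0$. Then $\bar H_{\vec V}$ is the conditional mean for the pair $(\mathbf x_0,\mathbf x_\star)$, and $\bar H_{\vec V_{\rm e}'}$ is the conditional mean of $H$ given that, for the pair $(\mathbf x_0',\mathbf x_\star)$, $\mathcal H=\big(E',\,E_\star',\,G'_\star\mathbf x_\star+G'\|\mathbf x_\star\|\mathbf z+\mathbf w\big)$. (c) For all $N$, $\mathbf x_0$, $\mathbf x_\star$ as above there is a coupling of $H^{\mathbf 0}$ and $H^o$, with sample paths in $C^2(\mathbb B^N)$, such that for every $\delta>0$ $$\limsup_{N\to\infty}\ \sup\frac1N\log\mathbb P\big(\|\mathrm{Hess}(H^{\mathbf 0}-H^o)\|_\infty\ge2\delta\big)<0,$$ where the supremum is over all $\mathbf x_0,\mathbf x_\star$ with overlap at most $\min(q_\star,1-\delta)$ in absolute value. -/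

import Mathlib

open MeasureTheory ProbabilityTheory Filter Topology
open scoped ENNReal NNReal RealInnerProductSpace

universe u

noncomputable section

/-! ### The mixed `p`-spin Hamiltonian -/

/-- `ℝᴺ` with its Euclidean norm. -/
abbrev Eu (N : ℕ) : Type := EuclideanSpace ℝ (Fin N)

/-- The indices `(i₁, …, i_p)`, for all degrees `p`, of the coupling constants. -/
abbrev DisorderIdx (N : ℕ) : Type := Σ p : ℕ, (Fin p → Fin N)

/-- The coupling constants are independent centered Gaussians, with `Var J_{i₁…i_p} = N^{-(p-1)}`. -/
structure IsDisorder {N : ℕ} {Ω : Type u} [MeasurableSpace Ω] (P : Measure Ω)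
    (J : DisorderIdx N → Ω → ℝ) : Prop where
  indep : iIndepFun J P
  law : ∀ a : DisorderIdx N, HasLaw (J a) (gaussianReal 0 (((N : ℝ≥0) ^ (a.1 - 1))⁻¹)) P

/-- The pure `p`-spin Hamiltonian `∑ J_{i₁…i_p} x^{i₁} ⋯ x^{i_p}`. -/
def pSpin {N : ℕ} (J : DisorderIdx N → ℝ) (p : ℕ) (x : Eu N) : ℝ :=
  ∑ i : Fin p → Fin N, J ⟨p, i⟩ * ∏ k, x (i k)

/-- The Hamiltonian `∑_p b_p H^{(p)}_J` of the mixture `ν(r) = ∑_p b_p² r^p`. -/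
def hamiltonian {N : ℕ} (b : ℕ → ℝ) (J : DisorderIdx N → ℝ) (x : Eu N) : ℝ :=
  ∑' p : ℕ, b p * pSpin J p x

/-- The coefficients of the truncated mixture `ν^{[m]}`. -/
def truncate (m : ℕ) (b : ℕ → ℝ) : ℕ → ℝ := fun p => if p ≤ m then b p else 0

/-- The coefficients `b_p ≥ 0` of a mixture that starts at degree two and decays fast enough, namely
`limsup (1/p) log b_p ≤ - log r̄` (where `log 0 = -∞` and `r̄ = ∞` is allowed). -/
structure IsMixture (rbar : ℝ≥0∞) (b : ℕ → ℝ) : Prop where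
  nonneg : ∀ p, 0 ≤ b p
  zero : b 0 = 0
  one : b 1 = 0
  decay : limsup (fun p : ℕ => ENNReal.log (ENNReal.ofReal (b p)) / (p : EReal)) atTop
    ≤ -ENNReal.log rbar

/-- At least two of the `b_p` are non-zero. -/
def NotPure (b : ℕ → ℝ) : Prop := ∃ p p' : ℕ, p ≠ p' ∧ b p ≠ 0 ∧ b p' ≠ 0

/-! ### Sup-norm of the Hessian and exponential rates -/

/-- The supremum over the open ball of radius `r √N` of the spectral norm of the Hessian of `φ`,
set to `∞` when `φ` is not twice continuously differentiable there. (The spectral norm is the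
operator norm of the second Fréchet derivative.) -/
def hessSup {N : ℕ} (r : ℝ) (φ : Eu N → ℝ) : ℝ≥0∞ :=
  open scoped Classical in
  if ContDiffOn ℝ 2 φ (Metric.ball 0 (r * √N)) then
    ⨆ x ∈ Metric.ball (0 : Eu N) (r * √N), ‖fderiv ℝ (fderiv ℝ φ) x‖ₑ
  else ∞

/-! ### Conditioning of centered Gaussian variables

If `(X, Y)` is centered and jointly Gaussian, with `Γ = E[Y Yᵀ]` and `c = Γ⁺ E[Y X]`, then
`X = (X - ⟨c, Y⟩) + ⟨c, Y⟩` where `X - ⟨c, Y⟩` is independent of `Y`. Hence, given `Y = v`,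
the variable `X` is the sum of the centered variable `X - ⟨c, Y⟩` (whose law does not depend on `v`)
and of the conditional mean `⟨c, v⟩`. -/

/-- The Moore–Penrose inverse `Γ⁺` of a symmetric matrix: the function `t ↦ t⁻¹` (with `0⁻¹ = 0`)
applied to its eigenvalues. It is the inverse if the matrix is invertible. -/
def symmPinv {ι : Type} [Fintype ι] [DecidableEq ι] (A : Matrix ι ι ℝ) : Matrix ι ι ℝ :=
  cfc (fun t : ℝ => t⁻¹) A

/-- The regression coefficients `Γ⁺ E[Y X]` of `X` on the vector `Y`. -/
def regCoeff {ι : Type} [Fintype ι] [DecidableEq ι] {Ω : Type u} [MeasurableSpace Ω]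
    (P : Measure Ω) (Y : ι → Ω → ℝ) (X : Ω → ℝ) : ι → ℝ :=
  (symmPinv (Matrix.of fun i j => cov[Y i, Y j; P])).mulVec fun i => cov[Y i, X; P]

/-- The conditional mean `E[X | Y = v]` for centered jointly Gaussian `(X, Y)`. -/
def condMean {ι : Type} [Fintype ι] [DecidableEq ι] {Ω : Type u} [MeasurableSpace Ω]
    (P : Measure Ω) (Y : ι → Ω → ℝ) (v : ι → ℝ) (X : Ω → ℝ) : ℝ :=
  regCoeff P Y X ⬝ᵥ v

/-- The centered part `X - E[X | Y]` of `X` given `Y`, for centered jointly Gaussian `(X, Y)`. -/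
def condCentered {ι : Type} [Fintype ι] [DecidableEq ι] {Ω : Type u} [MeasurableSpace Ω]
    (P : Measure Ω) (Y : ι → Ω → ℝ) (X : Ω → ℝ) : Ω → ℝ :=
  fun ω => X ω - condMean P Y (fun i => Y i ω) X

/-! ### The points `x₀`, `x⋆` and the conditioned fields -/

/-- Points `x₀` and `x⋆` of the spheres of radius `√N` and `q⋆ √N` around the origin. -/
structure Config (N : ℕ) (q : ℝ) where
  x0 : Eu N
  xs : Eu N
  norm_x0 : ‖x0‖ = √N
  norm_xs : ‖xs‖ = q * √N

/-- The overlap `⟨x₀, x⋆⟩ / N`. -/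
def Config.overlap {N : ℕ} {q : ℝ} (c : Config N q) : ℝ := ⟪c.x0, c.xs⟫ / N

/-- The vector `(-H(x₀)/N, -H(x⋆)/N, -∇H(x⋆))`. For `x⋆ = 0` all of its coordinates but the first
vanish, so that only `H(x₀)` is conditioned upon. -/
def condVec {N : ℕ} {q : ℝ} {Ω : Type u} (b : ℕ → ℝ) (J : DisorderIdx N → Ω → ℝ)
    (c : Config N q) : Fin 2 ⊕ Fin N → Ω → ℝ
  | .inl 0 => fun ω => -(hamiltonian b (fun a => J a ω) c.x0) / N
  | .inl 1 => fun ω => -(hamiltonian b (fun a => J a ω) c.xs) / N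
  | .inr i => fun ω => -(gradient (hamiltonian b (fun a => J a ω)) c.xs) i

/-- The spherical gradient `∇_sp H(x⋆)`, the projection of `∇H(x⋆)` on the complement of `x⋆`. -/
def sphGradVec {N : ℕ} {q : ℝ} {Ω : Type u} (b : ℕ → ℝ) (J : DisorderIdx N → Ω → ℝ)
    (c : Config N q) (i : Fin N) (ω : Ω) : ℝ :=
  ((Submodule.span ℝ {c.xs})ᗮ.starProjection (gradient (hamiltonian b (fun a => J a ω)) c.xs)) i

/-- The centered part of the Hamiltonian with coefficients `b'`, given `H(x₀)`, `H(x⋆)`, `∇H(x⋆)` for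
the Hamiltonian `H` with coefficients `b`: this is `H⁰` if `b' = b`, and `Ĥ^{0,[m]}` if
`b' = truncate m b`. -/
def fieldZero {N : ℕ} {q : ℝ} {Ω : Type u} [MeasurableSpace Ω] (P : Measure Ω)
    (J : DisorderIdx N → Ω → ℝ) (b b' : ℕ → ℝ) (c : Config N q) (x : Eu N) : Ω → ℝ :=
  condCentered P (condVec b J c) (fun ω => hamiltonian b' (fun a => J a ω) x)

/-- The centered part `H^o` of the Hamiltonian, given its spherical gradient at `x⋆`. -/
def fieldO {N : ℕ} {q : ℝ} {Ω : Type u} [MeasurableSpace Ω] (P : Measure Ω)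
    (J : DisorderIdx N → Ω → ℝ) (b : ℕ → ℝ) (c : Config N q) (x : Eu N) : Ω → ℝ :=
  condCentered P (sphGradVec b J c) (fun ω => hamiltonian b (fun a => J a ω) x)

/-- The parameters `E, E⋆, G⋆, q_o`. -/
structure Params where
  E : ℝ
  Es : ℝ
  Gs : ℝ
  qo : ℝ

/-- The conditional mean at `x` of the Hamiltonian with coefficients `b'`, given that
`H(x₀) = -N E`, `H(x⋆) = -N E⋆` and `∇H(x⋆) = -(G⋆ x⋆ + h)` for the Hamiltonian `H` with
coefficients `b`: for `h = 0` this is `H̄_V` if `b' = b`, and `Ĥ^{[m]}_V` if `b' = truncate m b`. -/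
def fieldMean {N : ℕ} {q : ℝ} {Ω : Type u} [MeasurableSpace Ω] (P : Measure Ω)
    (J : DisorderIdx N → Ω → ℝ) (b b' : ℕ → ℝ) (c : Config N q) (V : Params) (h : Eu N)
    (x : Eu N) : ℝ :=
  condMean P (condVec b J c) (Sum.elim ![V.E, V.Es] fun i => (V.Gs • c.xs + h) i)
    (fun ω => hamiltonian b' (fun a => J a ω) x)

/-- The overlap `s` is below one in absolute value and, if it is `± q⋆ ≠ 0` (so that `x₀` and `x⋆` are
collinear), the variables `H(x₀)`, `H(x⋆)` and `⟨∇H(x⋆), x⋆⟩` are linearly independent. -/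
def Regular (b : ℕ → ℝ) (q s : ℝ) : Prop :=
  |s| < 1 ∧ (0 < q → |s| = q → ∀ a₁ a₂ a₃ : ℝ,
    (∀ p : ℕ, b p ≠ 0 → a₁ * (s / q) ^ p + a₂ * q ^ p + a₃ * (p * q ^ p) = 0) →
      a₁ = 0 ∧ a₂ = 0 ∧ a₃ = 0)

/-- Only `E` matters if `q⋆ = 0`, and then the two other values are zero. -/
def HardConstraint (q : ℝ) (V : Params) : Prop := q = 0 → V.Es = 0 ∧ V.Gs = 0

/-- The vectors of parameters that one may condition upon. -/
structure Allowed (b : ℕ → ℝ) (q : ℝ) (V : Params) : Prop where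
  abs_qo_le : |V.qo| ≤ q
  regular : Regular b q V.qo
  hard : HardConstraint q V

/-- `V'` is within sup-distance less than `ε` of `V`, and satisfies the same constraint. -/
structure Near (q ε : ℝ) (V V' : Params) : Prop where
  E : |V'.E - V.E| < ε
  Es : |V'.Es - V.Es| < ε
  Gs : |V'.Gs - V.Gs| < ε
  qo : |V'.qo - V.qo| < ε
  hard : HardConstraint q V'

/-- The unit vector `z` is orthogonal to `x⋆`, and `x₀` is in the half plane spanned by `x⋆` and `z`
(that is, `x₀ = s x⋆ + t z` with `t ≥ 0`). -/
structure IsSecondAxis {N : ℕ} {q : ℝ} (c : Config N q) (z : Eu N) : Prop where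
  norm : ‖z‖ = 1
  orth : ⟪z, c.xs⟫ = 0
  mem_span : c.x0 ∈ Submodule.span ℝ {z, c.xs}
  nonneg : 0 ≤ ⟪c.x0, z⟫

/-- The exponential rate `limsup_N sup (1/N) log f_N`, with the supremum over all `x₀`, `x⋆` whose
overlap is at most `t` in absolute value. -/
def expRate (q t : ℝ) (f : ∀ N : ℕ, Config N q → ℝ≥0∞) : EReal :=
  limsup (fun N : ℕ => ⨆ c : Config N q, ⨆ _ : |c.overlap| ≤ t,
    ENNReal.log (f N c) / (N : EReal)) atTop

/-- A coupling of two random fields on `U`: a probability space that carries two fields with twice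
continuously differentiable sample paths and the same finite dimensional laws on `U`. -/
structure FieldCoupling {N : ℕ} (U : Set (Eu N)) {Ω : Type u} [MeasurableSpace Ω] (P : Measure Ω)
    (X Y : Eu N → Ω → ℝ) where
  Ω' : Type u
  mΩ' : MeasurableSpace Ω'
  P' : Measure Ω'
  isProb : IsProbabilityMeasure P'
  X' : Eu N → Ω' → ℝ
  Y' : Eu N → Ω' → ℝ
  law_X' : ∀ s : Finset (Eu N), (s : Set (Eu N)) ⊆ U →
    IdentDistrib (fun ω (x : s) => X' x ω) (fun ω (x : s) => X x ω) P' P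
  law_Y' : ∀ s : Finset (Eu N), (s : Set (Eu N)) ⊆ U →
    IdentDistrib (fun ω (x : s) => Y' x ω) (fun ω (x : s) => Y x ω) P' P
  smooth_X' : ∀ᵐ ω ∂P', ContDiffOn ℝ 2 (fun x => X' x ω) U
  smooth_Y' : ∀ᵐ ω ∂P', ContDiffOn ℝ 2 (fun x => Y' x ω) U

/-- The open ball of radius `r̄ √N`, which is all of `ℝᴺ` if `r̄ = ∞`. -/
def domainBall (rbar : ℝ≥0∞) (N : ℕ) : Set (Eu N) := {x | ‖x‖ₑ < rbar * ENNReal.ofReal √N}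

end

/-! The Hamiltonian is linear in the array of coupling constants, and every claim reduces to a size
bound on an array. If the degree `p` tensors of an array satisfy `tensorSize j p ≤ C * (p + 1)` for
`p ≥ 2`, then differentiating the series termwise (`hamiltonian_smooth_spec`) bounds the Hessian on
the ball by `C * coeffSum b r`, with no dependence on `N`. A truncation error is the Hamiltonian of
the same array with coefficients `b - truncate m b`, and `coeffSum` of these tends to zero; so each
bound comes with its truncated version.

Centered parts. Regression is orthogonal projection in the closed `L²` span of the couplings
(`sum_projCoeff_smul`). Almost surely, the centered field is the Hamiltonian of the residual array,
in which each coupling is replaced by its component orthogonal to the conditioned variables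
(`condCentered_hamiltonian`). A contraction does not increase variances, so a net argument treats
the residual tensors exactly like the disorder: outside an event of probability `O(exp (-N))`, all
of them satisfy `tensorSize ≤ 7 p` (`measure_exists_tensorSize_gt_le`). The position of `x₀` and
`x⋆` plays no role here.

Conditional means. The mean is the Hamiltonian of the covariances with the disorder of an element
`g` in the span of the conditioned variables, namely one with the prescribed inner products with
them (`condMean_hamiltonian`). By Cauchy–Schwarz the tensors of that array have size at most `‖g‖ /
√N`, so it suffices that `‖g‖ = O(√N)`. By isotropy, finding `g` is a 4 × 4 linear system in
`H(x₀)`, `H(x⋆)` and the derivatives at `x⋆` along `x⋆` and a second axis, while a remaining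
gradient component `w` decouples (`inner_condVec_meanClass`). Divided by `N`, the matrix depends on
the overlap only, and it is invertible at regular overlaps if `q > 0` (`det_covMatrix_ne_zero`); if
`q = 0`, only the first equation survives. Continuity and compactness bound the coefficients, which
gives the second half of (a). For (b), the two representing elements are close because the
coefficients and the variance of `H(x₀') - H(x₀)` are continuous.

Coupling. Both fields are built from the same disorder. The spans of the two sets of conditioned
variables differ by at most three dimensions, so the difference of the fields is the Hamiltonian of
a combination of at most three fixed covariance arrays, with sub-Gaussian coefficients of variance
proxy one. Each array has tensors of size at most `1 / √N`, so a Hessian of order one requires a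
coefficient of order `√N`. -/

noncomputable section

/-! ### The coupling constants of degree `p` as a multilinear form -/

/-- The monomial `x^{i₁} ⋯ x^{i_p}`. -/
def monomialFun {N p : ℕ} (i : Fin p → Fin N) (x : Eu N) : ℝ := ∏ k, x (i k)

/-- The `p`-linear form `∑ j_{i₁…i_p} u₁^{i₁} ⋯ u_p^{i_p}`. -/
def tensor {N : ℕ} (j : DisorderIdx N → ℝ) (p : ℕ) :
    ContinuousMultilinearMap ℝ (fun _ : Fin p => Eu N) ℝ :=
  ∑ i : Fin p → Fin N, j ⟨p, i⟩ •
    (ContinuousMultilinearMap.mkPiAlgebra ℝ (Fin p) ℝ).compContinuousLinearMap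
      (fun k => (EuclideanSpace.proj (i k) : Eu N →L[ℝ] ℝ))

theorem tensor_apply {N : ℕ} (j : DisorderIdx N → ℝ) (p : ℕ) (u : Fin p → Eu N) :
    tensor j p u = ∑ i : Fin p → Fin N, j ⟨p, i⟩ * ∏ k, u k (i k) := by
  simp [tensor]

theorem pSpin_eq_tensor {N : ℕ} (j : DisorderIdx N → ℝ) (p : ℕ) :
    pSpin j p = (tensor j p) ∘ (ContinuousLinearMap.pi
      (fun _ : Fin p => ContinuousLinearMap.id ℝ (Eu N))) := by
  ext x
  simp [tensor_apply, pSpin]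

theorem pSpin_eq_sum {N : ℕ} (j : DisorderIdx N → ℝ) (p : ℕ) :
    pSpin j p = fun x => ∑ i : Fin p → Fin N, j ⟨p, i⟩ * monomialFun i x := rfl

theorem tensor_add {N : ℕ} (j j' : DisorderIdx N → ℝ) (p : ℕ) :
    tensor (fun a => j a + j' a) p = tensor j p + tensor j' p := by
  ext u; simp [tensor_apply, add_mul, Finset.sum_add_distrib]

theorem tensor_smul {N : ℕ} (r : ℝ) (j : DisorderIdx N → ℝ) (p : ℕ) :
    tensor (fun a => r * j a) p = r • tensor j p := by
  ext u; simp [tensor_apply, Finset.mul_sum, mul_assoc]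

theorem pSpin_add {N : ℕ} (j j' : DisorderIdx N → ℝ) (p : ℕ) (x : Eu N) :
    pSpin (fun a => j a + j' a) p x = pSpin j p x + pSpin j' p x := by
  simp [pSpin, add_mul, Finset.sum_add_distrib]

theorem pSpin_smul {N : ℕ} (r : ℝ) (j : DisorderIdx N → ℝ) (p : ℕ) (x : Eu N) :
    pSpin (fun a => r * j a) p x = r * pSpin j p x := by
  simp [pSpin, Finset.mul_sum, mul_assoc]

theorem contDiff_pSpin {N : ℕ} (j : DisorderIdx N → ℝ) (p : ℕ) {n : WithTop ℕ∞} :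
    ContDiff ℝ n (pSpin j p) := by
  rw [pSpin_eq_tensor]
  exact (tensor j p).contDiff.comp (ContinuousLinearMap.contDiff _)

theorem contDiff_monomialFun {N p : ℕ} (i : Fin p → Fin N) {n : WithTop ℕ∞} :
    ContDiff ℝ n (monomialFun i : Eu N → ℝ) := by
  unfold monomialFun
  fun_prop

/-- The diagonal embedding has norm at most one, because `Fin p → Eu N` carries the sup norm. Hence
the bound for derivatives of a multilinear map passes to its diagonal without loss. -/
theorem norm_iteratedFDeriv_pSpin_le {N : ℕ} (j : DisorderIdx N → ℝ) (p k : ℕ) (x : Eu N) :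
    ‖iteratedFDeriv ℝ k (pSpin j p) x‖ ≤ p.descFactorial k * ‖tensor j p‖ * ‖x‖ ^ (p - k) := by
  set D : Eu N →L[ℝ] (Fin p → Eu N) :=
    ContinuousLinearMap.pi (fun _ : Fin p => ContinuousLinearMap.id ℝ (Eu N))
  have hD : ∀ y, ‖D y‖ ≤ ‖y‖ := fun y => by
    refine (pi_norm_le_iff_of_nonneg (norm_nonneg y)).2 fun k => ?_
    simp [D]
  have hD1 : ‖D‖ ≤ 1 := D.opNorm_le_bound zero_le_one fun y => by simpa using hD y
  rw [pSpin_eq_tensor, D.iteratedFDeriv_comp_right (n := ⊤) (tensor j p).contDiff x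
    (by exact_mod_cast le_top)]
  calc _ ≤ ‖iteratedFDeriv ℝ k (tensor j p) (D x)‖ * ∏ _ : Fin k, ‖D‖ :=
        ContinuousMultilinearMap.norm_compContinuousLinearMap_le _ _
    _ ≤ ‖iteratedFDeriv ℝ k (tensor j p) (D x)‖ * 1 := by
        gcongr
        exact Finset.prod_le_one (fun _ _ => norm_nonneg _) (fun _ _ => hD1)
    _ ≤ p.descFactorial k * ‖tensor j p‖ * ‖D x‖ ^ (p - k) := by
        simpa using (tensor j p).norm_iteratedFDeriv_le k (D x)
    _ ≤ _ := by
        gcongr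
        exact hD x

theorem abs_pSpin_le {N : ℕ} (j : DisorderIdx N → ℝ) (p : ℕ) (x : Eu N) :
    |pSpin j p x| ≤ ‖tensor j p‖ * ‖x‖ ^ p := by
  simpa using norm_iteratedFDeriv_pSpin_le j p 0 x

theorem norm_fderiv_pSpin_le {N : ℕ} (j : DisorderIdx N → ℝ) (p : ℕ) (x : Eu N) :
    ‖fderiv ℝ (pSpin j p) x‖ ≤ p * ‖tensor j p‖ * ‖x‖ ^ (p - 1) := by
  simpa [norm_iteratedFDeriv_one] using norm_iteratedFDeriv_pSpin_le j p 1 x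

theorem norm_fderiv_fderiv_pSpin_le {N : ℕ} (j : DisorderIdx N → ℝ) (p : ℕ) (x : Eu N) :
    ‖fderiv ℝ (fderiv ℝ (pSpin j p)) x‖ ≤ p.descFactorial 2 * ‖tensor j p‖ * ‖x‖ ^ (p - 2) := by
  rw [← norm_iteratedFDeriv_one, norm_iteratedFDeriv_fderiv]
  exact norm_iteratedFDeriv_pSpin_le j p 2 x

theorem fderiv_pSpin_apply {N : ℕ} (j : DisorderIdx N → ℝ) (p : ℕ) (x u : Eu N) :
    fderiv ℝ (pSpin j p) x u
      = ∑ i : Fin p → Fin N, j ⟨p, i⟩ * fderiv ℝ (monomialFun i) x u := by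
  rw [pSpin_eq_sum, fderiv_fun_sum
    (fun i _ => ((contDiff_monomialFun i (n := 1)).differentiable one_ne_zero x).const_mul _)]
  simp only [_root_.sum_apply]
  refine Finset.sum_congr rfl fun i _ => ?_
  rw [fderiv_const_mul ((contDiff_monomialFun i (n := 1)).differentiable one_ne_zero x)]
  simp

/-! ### The Hamiltonian of an array of coefficients as a smooth function -/

/-- The size of the tensor of degree `p`, normalised so as to be of order one for the disorder. -/
def tensorSize {N : ℕ} (j : DisorderIdx N → ℝ) (p : ℕ) : ℝ := √N ^ p * ‖tensor j p‖ / N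

/-- The tensors grow at most linearly in the degree. -/
def TameArray {N : ℕ} (j : DisorderIdx N → ℝ) : Prop :=
  ∃ C : ℝ, ∀ p, 2 ≤ p → tensorSize j p ≤ C * (p + 1)

/-- The coefficients start at degree two, and `∑ |b_p| (p + 1)³ r^p` converges. -/
structure SmoothCoeff (b : ℕ → ℝ) (r : ℝ) : Prop where
  zero : b 0 = 0
  one : b 1 = 0
  summable : Summable fun p : ℕ => |b p| * (p + 1) ^ 3 * r ^ p

/-- The sum `∑ |b_p| (p + 1)³ r^p`. -/
def coeffSum (b : ℕ → ℝ) (r : ℝ) : ℝ := ∑' p : ℕ, |b p| * (p + 1) ^ 3 * r ^ p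

theorem tensorSize_nonneg {N : ℕ} (j : DisorderIdx N → ℝ) (p : ℕ) : 0 ≤ tensorSize j p := by
  unfold tensorSize; positivity

theorem TameArray.add {N : ℕ} {j j' : DisorderIdx N → ℝ} (h : TameArray j) (h' : TameArray j') :
    TameArray fun a => j a + j' a := by
  obtain ⟨C, hC⟩ := h
  obtain ⟨C', hC'⟩ := h'
  refine ⟨C + C', fun p hp => ?_⟩
  calc tensorSize (fun a => j a + j' a) p ≤ tensorSize j p + tensorSize j' p := by
        unfold tensorSize
        rw [← add_div, ← mul_add, tensor_add]
        gcongr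
        exact norm_add_le _ _
    _ ≤ _ := by linarith [hC p hp, hC' p hp]

theorem TameArray.smul {N : ℕ} {j : DisorderIdx N → ℝ} (h : TameArray j) (r : ℝ) :
    TameArray fun a => r * j a := by
  obtain ⟨C, hC⟩ := h
  refine ⟨|r| * C, fun p hp => ?_⟩
  have : tensorSize (fun a => r * j a) p = |r| * tensorSize j p := by
    unfold tensorSize
    rw [tensor_smul, norm_smul, Real.norm_eq_abs]; ring
  rw [this, mul_assoc]
  exact mul_le_mul_of_nonneg_left (hC p hp) (abs_nonneg r)

theorem TameArray.zero {N : ℕ} : TameArray (fun _ : DisorderIdx N => (0 : ℝ)) := by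
  refine ⟨0, fun p _ => ?_⟩
  have : tensor (fun _ : DisorderIdx N => (0 : ℝ)) p = 0 := by
    ext u; simp [tensor_apply]
  simp [tensorSize, this]

theorem TameArray.sum {N : ℕ} {ι : Type*} (s : Finset ι) {j : ι → DisorderIdx N → ℝ}
    (h : ∀ i ∈ s, TameArray (j i)) : TameArray fun a => ∑ i ∈ s, j i a := by
  classical
  induction s using Finset.induction_on with
  | empty => simpa using TameArray.zero
  | insert i s hi ih =>
    simp only [Finset.sum_insert hi]
    exact (h i (by simp)).add (ih fun k hk => h k (by simp [hk]))

theorem TameArray.sub {N : ℕ} {j j' : DisorderIdx N → ℝ} (h : TameArray j) (h' : TameArray j') :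
    TameArray fun a => j a - j' a := by
  simpa [sub_eq_add_neg] using h.add (h'.smul (-1))

theorem SmoothCoeff.mono {b b' : ℕ → ℝ} {r : ℝ} (hr : 0 ≤ r) (h : SmoothCoeff b r)
    (hb : ∀ p, |b' p| ≤ |b p|) : SmoothCoeff b' r where
  zero := abs_nonpos_iff.1 ((hb 0).trans (by simp [h.zero]))
  one := abs_nonpos_iff.1 ((hb 1).trans (by simp [h.one]))
  summable := h.summable.of_nonneg_of_le (fun p => by positivity)
    fun p => mul_le_mul_of_nonneg_right (mul_le_mul_of_nonneg_right (hb p) (by positivity))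
      (by positivity)

theorem coeffSum_nonneg (b : ℕ → ℝ) {r : ℝ} (hr : 0 ≤ r) : 0 ≤ coeffSum b r :=
  tsum_nonneg fun p => by positivity

/-- The bounds on the terms of the Hamiltonian, for an array with tensors of size `C (p + 1)`. -/
theorem term_bound {N : ℕ} (hN : 1 ≤ N) {b : ℕ → ℝ} {r C : ℝ} (hb : SmoothCoeff b r)
    {j : DisorderIdx N → ℝ} (hj : ∀ p, 2 ≤ p → tensorSize j p ≤ C * (p + 1)) (p k : ℕ)
    (hk : k ≤ 2) (hr : 1 ≤ r) :
    |b p| * (p.descFactorial k * ‖tensor j p‖ * (r * √N) ^ (p - k))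
      ≤ C * N / √N ^ k * (|b p| * (p + 1) ^ 3 * r ^ p) := by
  have hN' : (0 : ℝ) < N := by exact_mod_cast hN
  have hs : 0 < √(N : ℝ) := Real.sqrt_pos.2 hN'
  -- Below degree two the coefficient vanishes. From degree two on, `p - k` is a genuine subtraction
  -- because `k ≤ 2`.
  rcases lt_or_ge p 2 with hp | hp
  · have : b p = 0 := by
      interval_cases p
      · exact hb.zero
      · exact hb.one
    simp [this]
  have h1 : √(N : ℝ) ^ p * ‖tensor j p‖ ≤ C * (p + 1) * N := by
    have := hj p hp
    rwa [tensorSize, div_le_iff₀ hN'] at this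
  have h2 : (p.descFactorial k : ℝ) ≤ (p + 1) ^ 2 := by
    calc (p.descFactorial k : ℝ) ≤ (p : ℝ) ^ k := by exact_mod_cast Nat.descFactorial_le_pow p k
      _ ≤ ((p : ℝ) + 1) ^ k := by gcongr; linarith
      _ ≤ _ := by
        apply pow_le_pow_right₀ _ hk
        have : (0 : ℝ) ≤ p := by positivity
        linarith
  have h3 : r ^ (p - k) ≤ r ^ p := pow_le_pow_right₀ hr (Nat.sub_le _ _)
  have h4 : √(N : ℝ) ^ (p - k) = √N ^ p / √N ^ k := by
    rw [eq_div_iff (by positivity), ← pow_add, Nat.sub_add_cancel (hk.trans hp)]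
  calc |b p| * (p.descFactorial k * ‖tensor j p‖ * (r * √N) ^ (p - k))
      = |b p| * p.descFactorial k * r ^ (p - k) * (√N ^ p * ‖tensor j p‖) / √N ^ k := by
        rw [mul_pow, h4]; ring
    _ ≤ |b p| * (p + 1) ^ 2 * r ^ p * (C * (p + 1) * N) / √N ^ k := by
        gcongr
    _ = _ := by ring

/-! ### Termwise differentiation of the Hamiltonian -/

section Smooth

variable {N : ℕ} {b : ℕ → ℝ} {r C : ℝ} {j : DisorderIdx N → ℝ}

/-- `term_bound` supplies summable majorants on the ball for the series and for its first two
derivative series. In the Hessian bound the factor `N / √N ^ 2` equals one, hence a constant free of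
`N`. -/
theorem hamiltonian_smooth_spec (hN : 1 ≤ N) (hr : 1 ≤ r) (hb : SmoothCoeff b r)
    (hj : ∀ p, 2 ≤ p → tensorSize j p ≤ C * (p + 1)) :
    (∀ x ∈ Metric.ball (0 : Eu N) (r * √N), HasSum (fun p => b p * pSpin j p x) (hamiltonian b j x))
    ∧ (∀ x ∈ Metric.ball (0 : Eu N) (r * √N),
        HasFDerivAt (hamiltonian b j) (∑' p, b p • fderiv ℝ (pSpin j p) x) x)
    ∧ (∀ x ∈ Metric.ball (0 : Eu N) (r * √N), Summable fun p => b p • fderiv ℝ (pSpin j p) x)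
    ∧ (∀ x ∈ Metric.ball (0 : Eu N) (r * √N),
        ‖fderiv ℝ (fderiv ℝ (hamiltonian b j)) x‖ ≤ C * coeffSum b r)
    ∧ ContDiffOn ℝ 2 (hamiltonian b j) (Metric.ball (0 : Eu N) (r * √N)) := by
  have hN' : (0 : ℝ) < N := by exact_mod_cast hN
  have hs : 0 < √(N : ℝ) := Real.sqrt_pos.2 hN'
  set U := Metric.ball (0 : Eu N) (r * √N) with hU
  have hUo : IsOpen U := Metric.isOpen_ball
  have hUc : IsPreconnected U := (convex_ball _ _).isPreconnected
  have h0 : (0 : Eu N) ∈ U := Metric.mem_ball_self (by positivity)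
  have hsum : ∀ k : ℕ, Summable fun p : ℕ =>
      C * N / √N ^ k * (|b p| * ((p : ℝ) + 1) ^ 3 * r ^ p) := fun k => hb.summable.mul_left _
  have hxU : ∀ x ∈ U, ‖x‖ ≤ r * √N := fun x hx => by
    rw [hU, mem_ball_zero_iff] at hx; exact hx.le
  have B0 : ∀ p, ∀ x ∈ U, ‖b p * pSpin j p x‖ ≤
      C * N / √N ^ 0 * (|b p| * ((p : ℝ) + 1) ^ 3 * r ^ p) := fun p x hx => by
    refine le_trans ?_ (term_bound hN hb hj p 0 (by norm_num) hr)
    rw [norm_mul, Real.norm_eq_abs, Real.norm_eq_abs]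
    gcongr
    refine (abs_pSpin_le j p x).trans ?_
    simp only [Nat.descFactorial_zero, Nat.cast_one, one_mul, Nat.sub_zero]
    gcongr
    exact hxU x hx
  have B1 : ∀ p, ∀ x ∈ U, ‖b p • fderiv ℝ (pSpin j p) x‖ ≤
      C * N / √N ^ 1 * (|b p| * ((p : ℝ) + 1) ^ 3 * r ^ p) := fun p x hx => by
    refine le_trans ?_ (term_bound hN hb hj p 1 (by norm_num) hr)
    rw [norm_smul, Real.norm_eq_abs]
    gcongr
    refine (norm_fderiv_pSpin_le j p x).trans ?_
    simp only [Nat.descFactorial_one]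
    gcongr
    exact hxU x hx
  have B2 : ∀ p, ∀ x ∈ U, ‖b p • fderiv ℝ (fderiv ℝ (pSpin j p)) x‖ ≤
      C * N / √N ^ 2 * (|b p| * ((p : ℝ) + 1) ^ 3 * r ^ p) := fun p x hx => by
    refine le_trans ?_ (term_bound hN hb hj p 2 (by norm_num) hr)
    refine (ContinuousLinearMap.opNorm_smul_le (b p) (fderiv ℝ (fderiv ℝ (pSpin j p)) x)).trans ?_
    rw [Real.norm_eq_abs]
    gcongr
    refine (norm_fderiv_fderiv_pSpin_le j p x).trans ?_
    gcongr
    exact hxU x hx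
  have S0 : ∀ x ∈ U, Summable fun p => b p * pSpin j p x := fun x hx =>
    Summable.of_norm_bounded (hsum 0) fun p => B0 p x hx
  have S1 : ∀ x ∈ U, Summable fun p => b p • fderiv ℝ (pSpin j p) x := fun x hx =>
    Summable.of_norm_bounded (hsum 1) fun p => B1 p x hx
  have D1 : ∀ p, ∀ x ∈ U, HasFDerivAt (fun y => b p * pSpin j p y)
      (b p • fderiv ℝ (pSpin j p) x) x := fun p x _ =>
    (((contDiff_pSpin j p (n := 1)).differentiable one_ne_zero) x).hasFDerivAt.const_mul (b p)
  have D2 : ∀ p, ∀ x ∈ U, HasFDerivAt (fun y => b p • fderiv ℝ (pSpin j p) y)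
      (b p • fderiv ℝ (fderiv ℝ (pSpin j p)) x) x := fun p x _ =>
    (((contDiff_pSpin j p (n := 2)).fderiv_right (m := 1) (by norm_num)).differentiable
      one_ne_zero x).hasFDerivAt.const_smul (b p)
  have E1 : ∀ x ∈ U, HasFDerivAt (hamiltonian b j) (∑' p, b p • fderiv ℝ (pSpin j p) x) x :=
    fun x hx => hasFDerivAt_tsum_of_isPreconnected (hsum 1) hUo hUc D1 B1 h0 (S0 0 h0) hx
  have F1 : ∀ x ∈ U, fderiv ℝ (hamiltonian b j) x = ∑' p, b p • fderiv ℝ (pSpin j p) x :=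
    fun x hx => (E1 x hx).fderiv
  have E2 : ∀ x ∈ U, HasFDerivAt (fun y => ∑' p, b p • fderiv ℝ (pSpin j p) y)
      (∑' p, b p • fderiv ℝ (fderiv ℝ (pSpin j p)) x) x :=
    fun x hx => hasFDerivAt_tsum_of_isPreconnected (hsum 2) hUo hUc D2 B2 h0 (S1 0 h0) hx
  have E2' : ∀ x ∈ U, HasFDerivAt (fderiv ℝ (hamiltonian b j))
      (∑' p, b p • fderiv ℝ (fderiv ℝ (pSpin j p)) x) x := fun x hx =>
    (E2 x hx).congr_of_eventuallyEq (eventually_of_mem (hUo.mem_nhds hx) F1)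
  have F2 : ∀ x ∈ U, fderiv ℝ (fderiv ℝ (hamiltonian b j)) x
      = ∑' p, b p • fderiv ℝ (fderiv ℝ (pSpin j p)) x := fun x hx => (E2' x hx).fderiv
  have C2 : ContinuousOn (fun x => ∑' p, b p • fderiv ℝ (fderiv ℝ (pSpin j p)) x) U := by
    refine continuousOn_tsum (F := Eu N →L[ℝ] Eu N →L[ℝ] ℝ) (fun p => ?_) (hsum 2) B2
    have : ContDiff ℝ 0 (fderiv ℝ (fderiv ℝ (pSpin j p))) :=
      ((contDiff_pSpin j p (n := 2)).fderiv_right (m := 1) (by norm_num)).fderiv_right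
        (m := 0) (by norm_num)
    exact (this.continuous.const_smul (b p)).continuousOn
  refine ⟨fun x hx => (S0 x hx).hasSum, E1, S1, fun x hx => ?_, ?_⟩
  · rw [F2 x hx]
    have := tsum_of_norm_bounded (E := Eu N →L[ℝ] Eu N →L[ℝ] ℝ) (hsum 2).hasSum fun p => B2 p x hx
    refine this.trans_eq ?_
    rw [tsum_mul_left, Real.sq_sqrt hN'.le, mul_div_assoc, div_self hN'.ne', mul_one, coeffSum]
  · have e2 : (2 : WithTop ℕ∞) = 0 + 1 + 1 := by norm_num
    rw [e2, contDiffOn_succ_iff_fderiv_of_isOpen hUo]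
    refine ⟨fun x hx => (E1 x hx).differentiableAt.differentiableWithinAt, by simp, ?_⟩
    rw [contDiffOn_succ_iff_fderiv_of_isOpen hUo]
    refine ⟨fun x hx => (E2' x hx).differentiableAt.differentiableWithinAt, by simp, ?_⟩
    rw [contDiffOn_zero]
    exact C2.congr F2

theorem hasSum_hamiltonian (hN : 1 ≤ N) (hr : 1 ≤ r) (hb : SmoothCoeff b r) (hj : TameArray j)
    {x : Eu N} (hx : x ∈ Metric.ball (0 : Eu N) (r * √N)) :
    HasSum (fun p => b p * pSpin j p x) (hamiltonian b j x) :=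
  let ⟨_, hC⟩ := hj
  (hamiltonian_smooth_spec hN hr hb hC).1 x hx

theorem hasSum_fderiv_hamiltonian (hN : 1 ≤ N) (hr : 1 ≤ r) (hb : SmoothCoeff b r)
    (hj : TameArray j) {x : Eu N} (hx : x ∈ Metric.ball (0 : Eu N) (r * √N)) (u : Eu N) :
    HasSum (fun p => b p * fderiv ℝ (pSpin j p) x u) (fderiv ℝ (hamiltonian b j) x u) := by
  obtain ⟨_, hC⟩ := hj
  obtain ⟨-, h1, h2, -⟩ := hamiltonian_smooth_spec hN hr hb hC
  rw [(h1 x hx).fderiv]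
  exact (h2 x hx).hasSum.mapL (ContinuousLinearMap.apply ℝ ℝ u)

theorem contDiffOn_hamiltonian (hN : 1 ≤ N) (hr : 1 ≤ r) (hb : SmoothCoeff b r)
    (hj : TameArray j) : ContDiffOn ℝ 2 (hamiltonian b j) (Metric.ball (0 : Eu N) (r * √N)) :=
  let ⟨_, hC⟩ := hj
  (hamiltonian_smooth_spec hN hr hb hC).2.2.2.2

/-- The fields are identified with Hamiltonians of arrays only inside the ball, where the series
converge. The ball is open, so this determines the derivatives there, and smoothness of `g` rules
out the default value `∞`. -/
theorem hessSup_le_of_eqOn {f g : Eu N → ℝ} {K : ℝ}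
    (hfg : ∀ x ∈ Metric.ball (0 : Eu N) (r * √N), f x = g x)
    (hg : ContDiffOn ℝ 2 g (Metric.ball (0 : Eu N) (r * √N)))
    (hK : ∀ x ∈ Metric.ball (0 : Eu N) (r * √N), ‖fderiv ℝ (fderiv ℝ g) x‖ ≤ K) :
    hessSup r f ≤ ENNReal.ofReal K := by
  have hf : ContDiffOn ℝ 2 f (Metric.ball (0 : Eu N) (r * √N)) := hg.congr hfg
  rw [hessSup, if_pos hf]
  refine iSup₂_le fun x hx => ?_
  have h1 : f =ᶠ[𝓝 x] g := eventually_of_mem (Metric.isOpen_ball.mem_nhds hx) hfg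
  rw [h1.fderiv.fderiv_eq, ← ofReal_norm]
  exact ENNReal.ofReal_le_ofReal (hK x hx)

theorem hessSup_le_of_eqOn_hamiltonian (hN : 1 ≤ N) (hr : 1 ≤ r) (hb : SmoothCoeff b r)
    (hj : ∀ p, 2 ≤ p → tensorSize j p ≤ C * (p + 1)) {f : Eu N → ℝ}
    (hfg : ∀ x ∈ Metric.ball (0 : Eu N) (r * √N), f x = hamiltonian b j x) :
    hessSup r f ≤ ENNReal.ofReal (C * coeffSum b r) :=
  let h := hamiltonian_smooth_spec hN hr hb hj
  hessSup_le_of_eqOn hfg h.2.2.2.2 h.2.2.2.1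

end Smooth

theorem hamiltonian_array_add {N : ℕ} {b : ℕ → ℝ} {r : ℝ} {j j' : DisorderIdx N → ℝ}
    (hN : 1 ≤ N) (hr : 1 ≤ r) (hb : SmoothCoeff b r) (hj : TameArray j) (hj' : TameArray j')
    {x : Eu N} (hx : x ∈ Metric.ball (0 : Eu N) (r * √N)) :
    hamiltonian b (fun a => j a + j' a) x = hamiltonian b j x + hamiltonian b j' x := by
  refine HasSum.unique (hasSum_hamiltonian hN hr hb (hj.add hj') hx) ?_
  simpa only [pSpin_add, mul_add] using
    (hasSum_hamiltonian hN hr hb hj hx).add (hasSum_hamiltonian hN hr hb hj' hx)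

/-- Unlike additivity, this needs no convergence: `tsum_mul_left` holds over a field for divergent
series as well. -/
theorem hamiltonian_array_smul {N : ℕ} (b : ℕ → ℝ) (c : ℝ) (j : DisorderIdx N → ℝ) (x : Eu N) :
    hamiltonian b (fun a => c * j a) x = c * hamiltonian b j x := by
  simp only [hamiltonian, pSpin_smul, ← tsum_mul_left]
  exact tsum_congr fun p => by ring

theorem hamiltonian_array_sub {N : ℕ} {b : ℕ → ℝ} {r : ℝ} {j j' : DisorderIdx N → ℝ}
    (hN : 1 ≤ N) (hr : 1 ≤ r) (hb : SmoothCoeff b r) (hj : TameArray j) (hj' : TameArray j')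
    {x : Eu N} (hx : x ∈ Metric.ball (0 : Eu N) (r * √N)) :
    hamiltonian b (fun a => j a - j' a) x = hamiltonian b j x - hamiltonian b j' x := by
  have := hamiltonian_array_add hN hr hb hj (hj'.smul (-1)) hx
  rw [hamiltonian_array_smul] at this
  simpa [sub_eq_add_neg] using this

theorem hamiltonian_array_sum {N : ℕ} {b : ℕ → ℝ} {r : ℝ} {ι : Type*} (s : Finset ι)
    {j : ι → DisorderIdx N → ℝ}
    (hN : 1 ≤ N) (hr : 1 ≤ r) (hb : SmoothCoeff b r) (hj : ∀ i, TameArray (j i))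
    {x : Eu N} (hx : x ∈ Metric.ball (0 : Eu N) (r * √N)) :
    hamiltonian b (fun a => ∑ i ∈ s, j i a) x = ∑ i ∈ s, hamiltonian b (j i) x := by
  classical
  induction s using Finset.induction_on with
  | empty => simp [hamiltonian, pSpin]
  | insert i s hi ih =>
    simp only [Finset.sum_insert hi]
    rw [hamiltonian_array_add hN hr hb (hj i) (TameArray.sum s fun k _ => hj k) hx, ih]

theorem hamiltonian_coeff_sub {N : ℕ} {b b' : ℕ → ℝ} {r : ℝ} {j : DisorderIdx N → ℝ}
    (hN : 1 ≤ N) (hr : 1 ≤ r) (hb : SmoothCoeff b r) (hb' : SmoothCoeff b' r) (hj : TameArray j)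
    {x : Eu N} (hx : x ∈ Metric.ball (0 : Eu N) (r * √N)) :
    hamiltonian (fun p => b p - b' p) j x = hamiltonian b j x - hamiltonian b' j x := by
  have := (hasSum_hamiltonian hN hr hb hj hx).sub (hasSum_hamiltonian hN hr hb' hj hx)
  simp only [← sub_mul] at this
  exact this.tsum_eq

/-! ### The mixture -/

theorem IsMixture.eventually_le {rbar : ℝ≥0∞} {b : ℕ → ℝ} (hb : IsMixture rbar b) {r : ℝ}
    (hr : 0 < r) (h : ENNReal.ofReal r < rbar) : ∀ᶠ p : ℕ in atTop, b p ≤ (r⁻¹) ^ p := by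
  have h1 : -ENNReal.log rbar < -ENNReal.log (ENNReal.ofReal r) :=
    EReal.neg_lt_neg_iff.2 (ENNReal.log_strictMono h)
  have h2 := eventually_lt_of_limsup_lt (hb.decay.trans_lt h1)
  filter_upwards [h2, eventually_gt_atTop 0] with p hp hp0
  rcases (hb.nonneg p).eq_or_lt with h0 | h0
  · rw [← h0]; positivity
  rw [ENNReal.log_ofReal_of_pos h0, ENNReal.log_ofReal_of_pos hr] at hp
  have hp' : Real.log (b p) / p < -Real.log r := by
    have : ((Real.log (b p) / (p : ℝ) : ℝ) : EReal) < ((-Real.log r : ℝ) : EReal) := by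
      rw [EReal.coe_div]
      exact_mod_cast hp
    exact_mod_cast this
  have hp0' : (0 : ℝ) < p := by exact_mod_cast hp0
  rw [div_lt_iff₀ hp0'] at hp'
  rw [← Real.log_le_log_iff h0 (by positivity), Real.log_pow, Real.log_inv]
  linarith

theorem IsMixture.smoothCoeff {rbar : ℝ≥0∞} {b : ℕ → ℝ} (hb : IsMixture rbar b) {r : ℝ}
    (hr : 0 < r) (h : ENNReal.ofReal r < rbar) : SmoothCoeff b r where
  zero := hb.zero
  one := hb.one
  summable := by
    -- A radius strictly in between leaves a geometric factor `(r / r') ^ p`, which absorbs the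
    -- polynomial weight.
    obtain ⟨r', hr', h'⟩ : ∃ r' : ℝ, r < r' ∧ ENNReal.ofReal r' < rbar := by
      obtain ⟨s, hs1, hs2⟩ := ENNReal.lt_iff_exists_nnreal_btwn.1 h
      refine ⟨s, ?_, by simpa using hs2⟩
      rw [← ENNReal.ofReal_coe_nnreal] at hs1
      exact (ENNReal.ofReal_lt_ofReal_iff_of_nonneg hr.le).1 hs1
    have hr'0 : 0 < r' := hr.trans hr'
    have hq : ‖r / r'‖ < 1 := by
      rw [Real.norm_eq_abs, abs_of_pos (by positivity), div_lt_one hr'0]; exact hr'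
    have h1 : Summable fun p : ℕ => ((p : ℝ) + 1) ^ 3 * (r / r') ^ (p + 1) := by
      have h0 : Summable fun p : ℕ => (p : ℝ) ^ 3 * (r / r') ^ p :=
        summable_pow_mul_geometric_of_norm_lt_one 3 hq
      refine ((summable_nat_add_iff 1).2 h0).congr fun p => ?_
      rw [Nat.cast_add, Nat.cast_one]
    have h2 : Summable fun p : ℕ => ((p : ℝ) + 1) ^ 3 * (r / r') ^ p := by
      refine (h1.mul_left (r / r')⁻¹).congr fun p => ?_
      have : r / r' ≠ 0 := by positivity
      generalize r / r' = q at this ⊢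
      field_simp
      exact pow_succ' q p
    refine h2.of_norm_bounded_eventually_nat ?_
    filter_upwards [hb.eventually_le hr'0 h'] with p hp
    rw [Real.norm_eq_abs, abs_of_nonneg (by positivity), abs_of_nonneg (hb.nonneg p)]
    calc b p * ((p : ℝ) + 1) ^ 3 * r ^ p ≤ r'⁻¹ ^ p * ((p : ℝ) + 1) ^ 3 * r ^ p := by gcongr
      _ = _ := by rw [div_pow, inv_pow]; field_simp

theorem abs_truncate_le (m : ℕ) (b : ℕ → ℝ) (p : ℕ) : |truncate m b p| ≤ |b p| := by
  unfold truncate; split_ifs <;> simp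

theorem abs_sub_truncate_le (m : ℕ) (b : ℕ → ℝ) (p : ℕ) : |b p - truncate m b p| ≤ |b p| := by
  unfold truncate; split_ifs <;> simp

theorem tendsto_coeffSum_sub_truncate {b : ℕ → ℝ} {r : ℝ} (hr : 0 ≤ r) (hb : SmoothCoeff b r) :
    Tendsto (fun m => coeffSum (fun p => b p - truncate m b p) r) atTop (𝓝 0) := by
  have h := tendsto_tsum_of_dominated_convergence (𝓕 := atTop)
    (f := fun m p => |b p - truncate m b p| * ((p : ℝ) + 1) ^ 3 * r ^ p) (g := fun _ => 0)
    hb.summable (fun p => ?_) (Eventually.of_forall fun m p => ?_)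
  · simpa [coeffSum] using h
  · refine tendsto_const_nhds.congr' ?_
    filter_upwards [eventually_ge_atTop p] with m hm
    simp [truncate, hm]
  · rw [Real.norm_eq_abs, abs_of_nonneg (by positivity)]
    exact mul_le_mul_of_nonneg_right (mul_le_mul_of_nonneg_right (abs_sub_truncate_le m b p)
      (by positivity)) (by positivity)

/-- The mixture function `ν`. -/
def mixture (b : ℕ → ℝ) (s : ℝ) : ℝ := ∑' p : ℕ, b p ^ 2 * s ^ p

/-- The derivative of the mixture function. -/
def mixture' (b : ℕ → ℝ) (s : ℝ) : ℝ := ∑' p : ℕ, b p ^ 2 * (p * s ^ (p - 1))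

/-- The second derivative of the mixture function. -/
def mixture'' (b : ℕ → ℝ) (s : ℝ) : ℝ :=
  ∑' p : ℕ, b p ^ 2 * (p * ((p - 1 : ℕ) * s ^ (p - 1 - 1)))

/-! ### The mixture function and its first two derivatives -/

section Mixture

variable {b : ℕ → ℝ} {r s : ℝ}

/-- The coefficients are eventually at most one in absolute value, and then `b p ^ 2 ≤ |b p|`. The
series is a common majorant for those of `ν`, `ν'` and `ν''`. -/
theorem summable_mixture_bound (hr : 1 < r) (hb : SmoothCoeff b r) :
    Summable fun p : ℕ => b p ^ 2 * ((p + 1) ^ 2 * r ^ p) := by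
  have h1 : ∀ᶠ p : ℕ in atTop, |b p| ≤ 1 := by
    have := hb.summable.tendsto_atTop_zero
    filter_upwards [this.eventually (ge_mem_nhds (zero_lt_one))] with p hp
    have e1 : (1 : ℝ) ≤ ((p : ℝ) + 1) ^ 3 := one_le_pow₀ (by linarith [p.cast_nonneg (α := ℝ)])
    have e2 : 1 ≤ r ^ p := one_le_pow₀ hr.le
    calc |b p| = |b p| * 1 * 1 := by ring
      _ ≤ |b p| * ((p : ℝ) + 1) ^ 3 * r ^ p := by gcongr
      _ ≤ 1 := hp
  refine hb.summable.of_norm_bounded_eventually_nat ?_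
  filter_upwards [h1] with p hp
  have hr0 : 0 < r := by linarith
  have e1 : (1 : ℝ) ≤ (p : ℝ) + 1 := by linarith [p.cast_nonneg (α := ℝ)]
  rw [Real.norm_eq_abs, abs_of_nonneg (by positivity), ← sq_abs]
  calc |b p| ^ 2 * (((p : ℝ) + 1) ^ 2 * r ^ p)
      = |b p| * |b p| * (((p : ℝ) + 1) ^ 2 * r ^ p) := by ring
    _ ≤ 1 * |b p| * (((p : ℝ) + 1) ^ 3 * r ^ p) := by gcongr; norm_num
    _ = _ := by ring

theorem mixture_term_bounds (hr : 1 < r) (hs : |s| ≤ r) (p : ℕ) :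
    ‖b p ^ 2 * s ^ p‖ ≤ b p ^ 2 * ((p + 1) ^ 2 * r ^ p) ∧
    ‖b p ^ 2 * (p * s ^ (p - 1))‖ ≤ b p ^ 2 * ((p + 1) ^ 2 * r ^ p) ∧
    ‖b p ^ 2 * (p * ((p - 1 : ℕ) * s ^ (p - 1 - 1)))‖ ≤ b p ^ 2 * ((p + 1) ^ 2 * r ^ p) := by
  have hp : (0 : ℝ) ≤ p := p.cast_nonneg
  have hp1 : ((p - 1 : ℕ) : ℝ) ≤ p := by exact_mod_cast Nat.sub_le _ _
  have key : ∀ k, k ≤ p → |s| ^ k ≤ r ^ p := fun k hk =>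
    (pow_le_pow_left₀ (abs_nonneg s) hs k).trans (pow_le_pow_right₀ hr.le hk)
  refine ⟨?_, ?_, ?_⟩
  · rw [norm_mul, Real.norm_of_nonneg (sq_nonneg _), norm_pow, Real.norm_eq_abs]
    gcongr
    calc |s| ^ p ≤ 1 * r ^ p := by rw [one_mul]; exact key p le_rfl
      _ ≤ _ := by gcongr; nlinarith
  · rw [norm_mul, Real.norm_of_nonneg (sq_nonneg _), norm_mul, norm_pow, Real.norm_eq_abs s,
      Real.norm_of_nonneg hp]
    gcongr
    · nlinarith
    · exact key _ (Nat.sub_le _ _)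
  · rw [norm_mul, Real.norm_of_nonneg (sq_nonneg _), norm_mul, norm_mul, norm_pow,
      Real.norm_eq_abs s, Real.norm_of_nonneg hp, Real.norm_of_nonneg (Nat.cast_nonneg _),
      ← mul_assoc (p : ℝ)]
    have h2 : (p : ℝ) * ((p - 1 : ℕ) : ℝ) ≤ ((p : ℝ) + 1) ^ 2 := by
      calc (p : ℝ) * ((p - 1 : ℕ) : ℝ) ≤ p * p := by gcongr
        _ ≤ _ := by nlinarith
    gcongr
    exact key _ ((Nat.sub_le _ _).trans (Nat.sub_le _ _))

theorem hasSum_mixture (hr : 1 < r) (hb : SmoothCoeff b r) (hs : |s| ≤ r) :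
    HasSum (fun p : ℕ => b p ^ 2 * s ^ p) (mixture b s) :=
  (Summable.of_norm_bounded (summable_mixture_bound hr hb)
    fun p => (mixture_term_bounds hr hs p).1).hasSum

theorem hasSum_mixture' (hr : 1 < r) (hb : SmoothCoeff b r) (hs : |s| ≤ r) :
    HasSum (fun p : ℕ => b p ^ 2 * (p * s ^ (p - 1))) (mixture' b s) :=
  (Summable.of_norm_bounded (summable_mixture_bound hr hb)
    fun p => (mixture_term_bounds hr hs p).2.1).hasSum

theorem hasSum_mixture'' (hr : 1 < r) (hb : SmoothCoeff b r) (hs : |s| ≤ r) :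
    HasSum (fun p : ℕ => b p ^ 2 * (p * ((p - 1 : ℕ) * s ^ (p - 1 - 1)))) (mixture'' b s) :=
  (Summable.of_norm_bounded (summable_mixture_bound hr hb)
    fun p => (mixture_term_bounds hr hs p).2.2).hasSum

theorem hasDerivAt_mixture (hr : 1 < r) (hb : SmoothCoeff b r) (hs : |s| < r) :
    HasDerivAt (mixture b) (mixture' b s) s := by
  have hU : ∀ y, y ∈ Metric.ball (0 : ℝ) r → |y| ≤ r := fun y hy => by
    rw [mem_ball_zero_iff] at hy; exact hy.le
  exact hasDerivAt_tsum_of_isPreconnected (summable_mixture_bound hr hb) Metric.isOpen_ball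
    (convex_ball (0 : ℝ) r).isPreconnected
    (fun p y _ => (hasDerivAt_pow p y).const_mul (b p ^ 2))
    (fun p y hy => (mixture_term_bounds hr (hU y hy) p).2.1)
    (Metric.mem_ball_self (by linarith))
    (hasSum_mixture hr hb (by simp; linarith)).summable (by simpa using hs)

theorem hasDerivAt_mixture' (hr : 1 < r) (hb : SmoothCoeff b r) (hs : |s| < r) :
    HasDerivAt (mixture' b) (mixture'' b s) s := by
  have hU : ∀ y, y ∈ Metric.ball (0 : ℝ) r → |y| ≤ r := fun y hy => by
    rw [mem_ball_zero_iff] at hy; exact hy.le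
  exact hasDerivAt_tsum_of_isPreconnected (summable_mixture_bound hr hb) Metric.isOpen_ball
    (convex_ball (0 : ℝ) r).isPreconnected
    (fun p y _ => ((hasDerivAt_pow (p - 1) y).const_mul (p : ℝ)).const_mul (b p ^ 2))
    (fun p y hy => (mixture_term_bounds hr (hU y hy) p).2.2)
    (Metric.mem_ball_self (by linarith))
    (hasSum_mixture' hr hb (by simp; linarith)).summable (by simpa using hs)

theorem mixture'_pos (hr : 1 < r) (hb : SmoothCoeff b r) (hpure : NotPure b) (hs0 : 0 < s)
    (hs : s ≤ r) : 0 < mixture' b s := by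
  obtain ⟨p, -, -, hp, -⟩ := hpure
  have hp0 : p ≠ 0 := fun h => hp (h ▸ hb.zero)
  have h := hasSum_mixture' hr hb (s := s) (by rwa [abs_of_pos hs0])
  have : 0 < b p ^ 2 * (p * s ^ (p - 1)) := by positivity
  exact this.trans_le (h.tsum_eq ▸ h.summable.le_tsum p fun k _ => by positivity)

theorem mixture_pos (hr : 1 < r) (hb : SmoothCoeff b r) (hpure : NotPure b) (hs0 : 0 < s)
    (hs : s ≤ r) : 0 < mixture b s := by
  obtain ⟨p, -, -, hp, -⟩ := hpure
  have h := hasSum_mixture hr hb (s := s) (by rwa [abs_of_pos hs0])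
  have : 0 < b p ^ 2 * s ^ p := by positivity
  exact this.trans_le (h.tsum_eq ▸ h.summable.le_tsum p fun k _ => by positivity)

end Mixture

/-! ### Regression coefficients and orthogonal projections -/

/-- This Penrose identity is the only property of the pseudoinverse that is needed. The functional
calculus accepts the discontinuous function `t⁻¹` because the spectrum is finite, so that every
function is continuous on it. -/
theorem mul_symmPinv_mul {ι : Type} [Fintype ι] [DecidableEq ι] {A : Matrix ι ι ℝ}
    (hA : IsSelfAdjoint A) : A * symmPinv A * A = A := by
  have hc : ∀ f : ℝ → ℝ, ContinuousOn f (spectrum ℝ A) := fun f =>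
    (Matrix.finite_real_spectrum (A := A)).continuousOn f
  have hid : cfc (fun t : ℝ => t) A = A := cfc_id' ℝ A
  calc A * symmPinv A * A = cfc (fun t : ℝ => t * t⁻¹ * t) A := by
        rw [cfc_mul (fun t : ℝ => t * t⁻¹) (fun t => t) A (hc _) (hc _),
          cfc_mul (fun t : ℝ => t) (fun t => t⁻¹) A (hc _) (hc _), hid, symmPinv]
    _ = cfc (fun t : ℝ => t) A := by
        congr 1; ext t
        rcases eq_or_ne t 0 with h | h
        · simp [h]
        · field_simp
    _ = A := hid

section Regression

variable {ι : Type} {E : Type*} [NormedAddCommGroup E] [InnerProductSpace ℝ E]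

/-- The span of the vectors `y i`. -/
def regSpan (y : ι → E) : Submodule ℝ E := Submodule.span ℝ (Set.range y)

instance [Finite ι] (y : ι → E) : FiniteDimensional ℝ (regSpan y) :=
  FiniteDimensional.span_of_finite ℝ (Set.finite_range y)

theorem mem_regSpan (y : ι → E) (i : ι) : y i ∈ regSpan y := Submodule.subset_span ⟨i, rfl⟩

variable [Fintype ι] [DecidableEq ι]

/-- The coefficients of the orthogonal projection on the span of the vectors `y i`. -/
def projCoeff (y : ι → E) (x : E) : ι → ℝ :=
  (symmPinv (Matrix.of fun i k => ⟪y i, y k⟫)).mulVec fun i => ⟪y i, x⟫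

/-- The normal equations for the projection are always consistent, so the generalized inverse of the
Gram matrix solves them even if the `y i` are dependent. Dependence affects the coefficients, but
not the combination that they form. -/
theorem sum_projCoeff_smul (y : ι → E) (x : E) :
    ∑ i, projCoeff y x i • y i = (regSpan y).starProjection x := by
  set W := regSpan y with hW
  set A : Matrix ι ι ℝ := Matrix.of fun i k => ⟪y i, y k⟫ with hA
  have hsa : IsSelfAdjoint A := by
    ext i k
    simp [hA, real_inner_comm]
  have hy : ∀ i, y i ∈ W := mem_regSpan y
  have hAc : ∀ c : ι → ℝ, ∀ i, A.mulVec c i = ⟪y i, ∑ k, c k • y k⟫ := fun c i => by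
    simp only [hA, Matrix.mulVec, dotProduct, Matrix.of_apply, inner_sum, inner_smul_right]
    exact Finset.sum_congr rfl fun k _ => mul_comm _ _
  have hinner : ∀ i, ⟪y i, x⟫ = ⟪y i, W.starProjection x⟫ := fun i => by
    have := Submodule.starProjection_inner_eq_zero (K := W) x (y i) (hy i)
    rw [inner_sub_left, real_inner_comm, real_inner_comm (y i)] at this
    linarith
  obtain ⟨d, hd⟩ : ∃ d : ι → ℝ, ∑ k, d k • y k = W.starProjection x :=
    (Submodule.mem_span_range_iff_exists_fun ℝ).1 (Submodule.starProjection_apply_mem W x)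
  -- The right-hand side is in the range of `A`, since `x` can be replaced by its projection, which
  -- is a combination of the `y k`.
  have hb : (fun i => ⟪y i, x⟫) = A.mulVec d := by
    ext i
    rw [hinner, hAc, hd]
  have hAc' : A.mulVec (projCoeff y x) = A.mulVec d := by
    rw [projCoeff, ← hA, hb, Matrix.mulVec_mulVec, Matrix.mulVec_mulVec, 
      mul_symmPinv_mul hsa]
  have hmem : ∑ i, projCoeff y x i • y i - W.starProjection x ∈ W :=
    W.sub_mem (W.sum_mem fun i _ => W.smul_mem _ (hy i)) (Submodule.starProjection_apply_mem W x)
  have horth : ∑ i, projCoeff y x i • y i - W.starProjection x ∈ Wᗮ := by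
    refine (Submodule.mem_orthogonal' _ _).2 fun u hu => ?_
    have hu' : u ∈ Submodule.span ℝ (Set.range y) := hu
    clear hu
    induction hu' using Submodule.span_induction with
    | mem u hu =>
      obtain ⟨i, rfl⟩ := hu
      rw [real_inner_comm, inner_sub_right, ← hAc, hAc', hAc, hd, sub_self]
    | zero => simp
    | add u v _ _ h1 h2 => rw [inner_add_right, h1, h2, add_zero]
    | smul a u _ h => rw [inner_smul_right, h, mul_zero]
  have := (Submodule.mem_bot ℝ).1 (W.inf_orthogonal_eq_bot ▸ Submodule.mem_inf.2 ⟨hmem, horth⟩)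
  exact sub_eq_zero.1 this

/-- If the values conditioned upon are the inner products with some `g`, the conditional mean of `x`
is its inner product with the projection of `g`. This makes explicit regression coefficients
unnecessary. -/
theorem projCoeff_dotProduct (y : ι → E) (x g : E) :
    projCoeff y x ⬝ᵥ (fun i => ⟪y i, g⟫)
      = ⟪(regSpan y).starProjection g, x⟫ := by
  have : projCoeff y x ⬝ᵥ (fun i => ⟪y i, g⟫) = ⟪∑ i, projCoeff y x i • y i, g⟫ := by
    simp [dotProduct, sum_inner, inner_smul_left]
  rw [this, sum_projCoeff_smul, Submodule.inner_starProjection_left_eq_right, real_inner_comm]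

end Regression

/-! ### Square integrable random variables -/

section L2

variable {Ω : Type u} [MeasurableSpace Ω] {P : Measure Ω}

open scoped Classical in
/-- The class in `L²` of a square integrable random variable. -/
def l2Class (P : Measure Ω) (X : Ω → ℝ) : Lp ℝ 2 P :=
  if h : MemLp X 2 P then h.toLp X else 0

theorem coeFn_l2Class {X : Ω → ℝ} (hX : MemLp X 2 P) : l2Class P X =ᵐ[P] X := by
  rw [l2Class, dif_pos hX]
  exact hX.coeFn_toLp

theorem l2Class_eq_iff {X : Ω → ℝ} (hX : MemLp X 2 P) {g : Lp ℝ 2 P} :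
    l2Class P X = g ↔ X =ᵐ[P] g := by
  rw [Lp.ext_iff]
  exact ⟨fun h => (coeFn_l2Class hX).symm.trans h, fun h => (coeFn_l2Class hX).trans h⟩

theorem memLp_of_ae_eq {X : Ω → ℝ} {g : Lp ℝ 2 P} (h : X =ᵐ[P] g) : MemLp X 2 P :=
  (memLp_congr_ae h).2 (Lp.memLp g)

theorem l2Class_eq_of_ae_eq {X : Ω → ℝ} {g : Lp ℝ 2 P} (h : X =ᵐ[P] g) : l2Class P X = g :=
  (l2Class_eq_iff (memLp_of_ae_eq h)).2 h

theorem inner_eq_integral (f g : Lp ℝ 2 P) : ⟪f, g⟫ = ∫ ω, f ω * g ω ∂P := by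
  rw [L2.inner_def]
  simp [mul_comm]

theorem inner_l2Class {X Y : Ω → ℝ} (hX : MemLp X 2 P) (hY : MemLp Y 2 P) :
    ⟪l2Class P X, l2Class P Y⟫ = ∫ ω, X ω * Y ω ∂P := by
  rw [inner_eq_integral]
  refine integral_congr_ae ?_
  filter_upwards [coeFn_l2Class hX, coeFn_l2Class hY] with ω h1 h2
  rw [h1, h2]

theorem coeFn_finset_sum_smul {ι : Type*} (s : Finset ι) (c : ι → ℝ) (g : ι → Lp ℝ 2 P) :
    (∑ i ∈ s, c i • g i : Lp ℝ 2 P) =ᵐ[P] fun ω => ∑ i ∈ s, c i * g i ω := by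
  classical
  induction s using Finset.induction_on with
  | empty =>
    simp only [Finset.sum_empty]
    exact Lp.coeFn_zero ℝ 2 P
  | insert i s hi ih =>
    rw [Finset.sum_insert hi]
    filter_upwards [Lp.coeFn_add (c i • g i) (∑ i ∈ s, c i • g i), Lp.coeFn_smul (c i) (g i), ih]
      with ω h1 h2 h3
    rw [h1, Pi.add_apply, h2, h3, Finset.sum_insert hi]
    rfl

/-- Serves to identify the almost sure sum of a series in the disorder with its sum in `L²`. -/
theorem tendsto_ae_unique_l2 [IsFiniteMeasure P] {f : ℕ → Lp ℝ 2 P} {g : Lp ℝ 2 P} {X : Ω → ℝ}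
    (h : Tendsto f atTop (𝓝 g)) (hX : ∀ᵐ ω ∂P, Tendsto (fun n => f n ω) atTop (𝓝 (X ω))) :
    X =ᵐ[P] g := by
  have h1 := tendstoInMeasure_of_tendsto_Lp h
  obtain ⟨ns, hns, h2⟩ := h1.exists_seq_tendsto_ae
  filter_upwards [h2, hX] with ω h2 h3
  exact tendsto_nhds_unique (h3.comp hns.tendsto_atTop) h2

/-- The moment generating function is at most the one of a centered Gaussian of the same variance. -/
def GaussianTail (g : Lp ℝ 2 P) : Prop :=
  ∀ t : ℝ, ∫⁻ ω, ENNReal.ofReal (Real.exp (t * g ω)) ∂P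
    ≤ ENNReal.ofReal (Real.exp (t ^ 2 * ‖g‖ ^ 2 / 2))

/-- Fatou's lemma along a subsequence that converges almost everywhere. The Lebesgue integral in
`GaussianTail` allows this without prior integrability of the exponentials. -/
theorem isClosed_gaussianTail [IsFiniteMeasure P] : IsClosed {g : Lp ℝ 2 P | GaussianTail g} := by
  refine IsSeqClosed.isClosed fun f g hf hfg t => ?_
  obtain ⟨ns, hns, h2⟩ := (tendstoInMeasure_of_tendsto_Lp hfg).exists_seq_tendsto_ae
  have hlim : ∀ᵐ ω ∂P, Tendsto (fun n => ENNReal.ofReal (Real.exp (t * f (ns n) ω))) atTop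
      (𝓝 (ENNReal.ofReal (Real.exp (t * g ω)))) := by
    filter_upwards [h2] with ω h
    exact ENNReal.tendsto_ofReal ((Real.continuous_exp.tendsto _).comp (h.const_mul t))
  have hlim2 : Tendsto (fun n => ENNReal.ofReal (Real.exp (t ^ 2 * ‖f (ns n)‖ ^ 2 / 2))) atTop
      (𝓝 (ENNReal.ofReal (Real.exp (t ^ 2 * ‖g‖ ^ 2 / 2)))) := by
    have h3 : Tendsto (fun n => ‖f (ns n)‖) atTop (𝓝 ‖g‖) :=
      (hfg.comp hns.tendsto_atTop).norm
    exact ENNReal.tendsto_ofReal ((Real.continuous_exp.tendsto _).comp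
      (((h3.pow 2).const_mul _).div_const _))
  calc ∫⁻ ω, ENNReal.ofReal (Real.exp (t * g ω)) ∂P
      = ∫⁻ ω, liminf (fun n => ENNReal.ofReal (Real.exp (t * f (ns n) ω))) atTop ∂P := by
        refine lintegral_congr_ae ?_
        filter_upwards [hlim] with ω h
        exact h.liminf_eq.symm
    _ ≤ liminf (fun n => ∫⁻ ω, ENNReal.ofReal (Real.exp (t * f (ns n) ω)) ∂P) atTop := by
        refine lintegral_liminf_le' fun n => ?_
        exact ((Lp.aestronglyMeasurable (f (ns n))).aemeasurable.const_mul t).exp.ennreal_ofReal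
    _ ≤ liminf (fun n => ENNReal.ofReal (Real.exp (t ^ 2 * ‖f (ns n)‖ ^ 2 / 2))) atTop :=
        liminf_le_liminf (Eventually.of_forall fun n => hf (ns n) t)
    _ = _ := hlim2.liminf_eq

theorem GaussianTail.hasSubgaussianMGF {g : Lp ℝ 2 P} (hg : GaussianTail g) :
    HasSubgaussianMGF g (‖g‖₊ ^ 2) P := by
  have hm : AEStronglyMeasurable (fun ω => g ω) P := Lp.aestronglyMeasurable g
  have hint : ∀ t : ℝ, Integrable (fun ω => Real.exp (t * g ω)) P := fun t => by
    refine ⟨(Real.continuous_exp.comp_aestronglyMeasurable (hm.const_mul t)), ?_⟩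
    rw [hasFiniteIntegral_iff_ofReal (Eventually.of_forall fun _ => (Real.exp_pos _).le)]
    exact (hg t).trans_lt ENNReal.ofReal_lt_top
  refine ⟨hint, fun t => ?_⟩
  rw [← ENNReal.ofReal_le_ofReal_iff (Real.exp_pos _).le, mgf,
    ofReal_integral_eq_lintegral_ofReal (hint t)
      (Eventually.of_forall fun _ => (Real.exp_pos _).le)]
  refine (hg t).trans (ENNReal.ofReal_le_ofReal (Real.exp_le_exp.2 (le_of_eq ?_)))
  push_cast
  ring

theorem GaussianTail.of_hasSubgaussianMGF {X : Ω → ℝ} {g : Lp ℝ 2 P} (h : X =ᵐ[P] g) {c : ℝ≥0}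
    (hX : HasSubgaussianMGF X c P) (hc : (c : ℝ) = ‖g‖ ^ 2) : GaussianTail g := fun t => by
  have hX' := hX.congr h
  rw [← ofReal_integral_eq_lintegral_ofReal (hX'.integrable_exp_mul t)
    (Eventually.of_forall fun _ => (Real.exp_pos _).le)]
  refine ENNReal.ofReal_le_ofReal ((hX'.mgf_le t).trans (le_of_eq ?_))
  rw [hc]; ring_nf

end L2

/-! ### The Gaussian Hilbert space of the disorder -/

/-- The variance `N^{-(p-1)}` of a coupling constant. -/
def couplingVar {N : ℕ} (a : DisorderIdx N) : ℝ≥0 := ((N : ℝ≥0) ^ (a.1 - 1))⁻¹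

section Disorder

variable {N : ℕ} {Ω : Type u} [MeasurableSpace Ω] {P : Measure Ω} [IsProbabilityMeasure P]
  {J : DisorderIdx N → Ω → ℝ}

theorem IsDisorder.memLp (hJ : IsDisorder P J) (a : DisorderIdx N) : MemLp (J a) 2 P :=
  (hJ.law a).hasGaussianLaw.memLp_two

theorem IsDisorder.integral_eq_zero (hJ : IsDisorder P J) (a : DisorderIdx N) :
    ∫ ω, J a ω ∂P = 0 := by
  rw [(hJ.law a).integral_eq]
  exact integral_id_gaussianReal

theorem IsDisorder.integral_mul (hJ : IsDisorder P J) (a c : DisorderIdx N) :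
    ∫ ω, J a ω * J c ω ∂P = if a = c then (couplingVar a : ℝ) else 0 := by
  have hm : ∀ a, AEStronglyMeasurable (J a) P := fun a => (hJ.memLp a).1
  split_ifs with h
  · subst h
    have h1 := (hJ.law a).variance_eq
    rw [variance_id_gaussianReal, variance_of_integral_eq_zero (hJ.law a).aemeasurable
      (hJ.integral_eq_zero a)] at h1
    rw [couplingVar, ← h1]
    simp [sq]
  · have := (hJ.indep.indepFun h).integral_mul_eq_mul_integral (hm a) (hm c)
    simp only [Pi.mul_apply] at this
    rw [this, hJ.integral_eq_zero, zero_mul]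

theorem IsDisorder.hasSubgaussianMGF (hJ : IsDisorder P J) (a : DisorderIdx N) :
    HasSubgaussianMGF (J a) (couplingVar a) P := by
  have h : ∀ t, mgf (J a) P t = Real.exp (couplingVar a * t ^ 2 / 2) := fun t => by
    rw [mgf_gaussianReal (hJ.law a).map_eq t]
    simp [couplingVar]
  refine ⟨fun t => ?_, fun t => (h t).le⟩
  rw [← mgf_pos_iff, h]
  exact Real.exp_pos _

/-- The class in `L²` of a coupling constant. -/
def coupling (P : Measure Ω) (J : DisorderIdx N → Ω → ℝ) (a : DisorderIdx N) : Lp ℝ 2 P :=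
  l2Class P (J a)

theorem IsDisorder.inner_coupling (hJ : IsDisorder P J) (a c : DisorderIdx N) :
    ⟪coupling P J a, coupling P J c⟫ = if a = c then (couplingVar a : ℝ) else 0 := by
  rw [coupling, coupling, inner_l2Class (hJ.memLp a) (hJ.memLp c), hJ.integral_mul]

/-- The closed span of the coupling constants. -/
def gaussianSpace (P : Measure Ω) (J : DisorderIdx N → Ω → ℝ) : Submodule ℝ (Lp ℝ 2 P) :=
  (Submodule.span ℝ (Set.range (coupling P J))).topologicalClosure

theorem coupling_mem (P : Measure Ω) (J : DisorderIdx N → Ω → ℝ) (a : DisorderIdx N) :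
    coupling P J a ∈ gaussianSpace P J :=
  Submodule.le_topologicalClosure _ (Submodule.subset_span ⟨a, rfl⟩)

theorem isClosed_gaussianSpace (P : Measure Ω) (J : DisorderIdx N → Ω → ℝ) :
    IsClosed (gaussianSpace P J : Set (Lp ℝ 2 P)) :=
  Submodule.isClosed_topologicalClosure _

theorem IsDisorder.gaussianSpace_induction {p : Lp ℝ 2 P → Prop}
    (hp : IsClosed {g | p g})
    (h : ∀ (s : Finset (DisorderIdx N)) (c : DisorderIdx N → ℝ), p (∑ a ∈ s, c a • coupling P J a))
    {g : Lp ℝ 2 P} (hg : g ∈ gaussianSpace P J) : p g := by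
  have : (gaussianSpace P J : Set (Lp ℝ 2 P)) ⊆ {g | p g} := by
    rw [gaussianSpace, Submodule.topologicalClosure_coe]
    refine closure_minimal (fun g hg => ?_) hp
    obtain ⟨c, rfl⟩ := Finsupp.mem_span_range_iff_exists_finsupp.1 hg
    exact h c.support c
  exact this hg

theorem IsDisorder.norm_sq_sum (hJ : IsDisorder P J) (s : Finset (DisorderIdx N))
    (c : DisorderIdx N → ℝ) :
    ‖∑ a ∈ s, c a • coupling P J a‖ ^ 2 = ∑ a ∈ s, c a ^ 2 * couplingVar a := by
  classical
  rw [← real_inner_self_eq_norm_sq, sum_inner]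
  refine Finset.sum_congr rfl fun a ha => ?_
  simp [inner_sum, inner_smul_left, inner_smul_right, hJ.inner_coupling, ha]
  ring

theorem IsDisorder.coeFn_sum (hJ : IsDisorder P J) {ι : Type*} (s : Finset ι)
    (f : ι → DisorderIdx N) (c : ι → ℝ) :
    (∑ i ∈ s, c i • coupling P J (f i) : Lp ℝ 2 P) =ᵐ[P] fun ω => ∑ i ∈ s, c i * J (f i) ω := by
  have h1 : ∀ᵐ ω ∂P, ∀ a, coupling P J a ω = J a ω :=
    ae_all_iff.2 fun a => coeFn_l2Class (hJ.memLp a)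
  filter_upwards [coeFn_finset_sum_smul s c (fun i => coupling P J (f i)), h1] with ω h2 h1
  rw [h2]
  exact Finset.sum_congr rfl fun i _ => by rw [h1]

/-- For finite combinations of the couplings this is independence; the bound then passes to the
closure. An upper bound on the moment generating function is all that the tail estimates require, so
Gaussianity of limits is not discussed. -/
theorem IsDisorder.gaussianTail (hJ : IsDisorder P J) {g : Lp ℝ 2 P}
    (hg : g ∈ gaussianSpace P J) : GaussianTail g := by
  refine gaussianSpace_induction (J := J) isClosed_gaussianTail (fun s c => ?_) hg
  have hind : iIndepFun (fun a ω => c a * J a ω) P :=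
    hJ.indep.comp (fun a x => c a * x) fun a => measurable_const_mul (c a)
  have := HasSubgaussianMGF.sum_of_iIndepFun hind (s := s)
    (c := fun a => ⟨c a ^ 2, sq_nonneg _⟩ * couplingVar a)
    fun a _ => (hJ.hasSubgaussianMGF a).const_mul (c a)
  refine GaussianTail.of_hasSubgaussianMGF (hJ.coeFn_sum s id c).symm this ?_
  rw [NNReal.coe_sum]
  exact (hJ.norm_sq_sum s c).symm

/-- The expectation is the inner product with the constant one, hence continuous, and it vanishes on
the couplings. -/
theorem IsDisorder.integral_gaussianSpace (hJ : IsDisorder P J) {g : Lp ℝ 2 P}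
    (hg : g ∈ gaussianSpace P J) : ∫ ω, g ω ∂P = 0 := by
  have key : ∀ g : Lp ℝ 2 P, ∫ ω, g ω ∂P = ⟪l2Class P (fun _ => (1 : ℝ)), g⟫ := fun g => by
    rw [inner_eq_integral]
    refine integral_congr_ae ?_
    filter_upwards [coeFn_l2Class (P := P) (memLp_const (1 : ℝ))] with ω h
    rw [h, one_mul]
  rw [key]
  refine gaussianSpace_induction (J := J) (p := fun g => ⟪l2Class P (fun _ => (1 : ℝ)), g⟫ = 0)
    ?_ (fun s c => ?_) hg
  · exact isClosed_eq (continuous_const.inner continuous_id) continuous_const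
  · rw [inner_sum]
    refine Finset.sum_eq_zero fun a _ => ?_
    rw [inner_smul_right, ← key, coupling, integral_congr_ae (coeFn_l2Class (hJ.memLp a)),
      hJ.integral_eq_zero, mul_zero]

/-- The `L²`-element `∑ ℓ_{i₁…i_p} J_{i₁…i_p}` of degree `p`. -/
def degreeSum (P : Measure Ω) (J : DisorderIdx N → Ω → ℝ) (ℓ : DisorderIdx N → ℝ) (p : ℕ) :
    Lp ℝ 2 P :=
  ∑ i : Fin p → Fin N, ℓ ⟨p, i⟩ • coupling P J ⟨p, i⟩

theorem degreeSum_mem (P : Measure Ω) (J : DisorderIdx N → Ω → ℝ) (ℓ : DisorderIdx N → ℝ) (p : ℕ) :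
    degreeSum P J ℓ p ∈ gaussianSpace P J :=
  Submodule.sum_mem _ fun _ _ => Submodule.smul_mem _ _ (coupling_mem P J _)

/-- A random variable given by an almost surely convergent series in the disorder, which converges
absolutely in `L²`, is in the Gaussian Hilbert space. -/
theorem IsDisorder.hasSum_l2Class (hJ : IsDisorder P J) {ℓ : DisorderIdx N → ℝ}
    (hℓ : Summable fun p => ‖degreeSum P J ℓ p‖) {X : Ω → ℝ}
    (hX : ∀ᵐ ω ∂P, HasSum (fun p => ∑ i : Fin p → Fin N, ℓ ⟨p, i⟩ * J ⟨p, i⟩ ω) (X ω)) :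
    MemLp X 2 P ∧ l2Class P X ∈ gaussianSpace P J ∧
      HasSum (fun p => degreeSum P J ℓ p) (l2Class P X) := by
  have h1 := hℓ.of_norm.hasSum
  set g := ∑' p, degreeSum P J ℓ p
  have h2 := h1.tendsto_sum_nat
  have h3 : ∀ᵐ ω ∂P, ∀ p, degreeSum P J ℓ p ω = ∑ i : Fin p → Fin N, ℓ ⟨p, i⟩ * J ⟨p, i⟩ ω :=
    ae_all_iff.2 fun p => hJ.coeFn_sum Finset.univ (fun i => ⟨p, i⟩) (fun i => ℓ ⟨p, i⟩)
  have h4 : ∀ᵐ ω ∂P, ∀ n, (∑ p ∈ Finset.range n, degreeSum P J ℓ p : Lp ℝ 2 P) ω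
      = ∑ p ∈ Finset.range n, degreeSum P J ℓ p ω :=
    ae_all_iff.2 fun n => by
      have := coeFn_finset_sum_smul (Finset.range n) (fun _ => (1 : ℝ)) (degreeSum P J ℓ)
      simp only [one_smul, one_mul] at this
      exact this
  have h5 : X =ᵐ[P] g := by
    refine tendsto_ae_unique_l2 h2 ?_
    filter_upwards [h3, h4, hX] with ω h3 h4 hX
    simp only [h4, h3]
    exact hX.tendsto_sum_nat
  rw [l2Class_eq_of_ae_eq h5]
  refine ⟨memLp_of_ae_eq h5, ?_, h1⟩
  exact (isClosed_gaussianSpace P J).mem_of_tendsto h2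
    (Eventually.of_forall fun n => Submodule.sum_mem _ fun p _ => degreeSum_mem P J ℓ p)

end Disorder

/-! ### Nets of the unit ball -/

open Module Metric in
open scoped Function in
-- Comparison of volumes: the balls of radius `δ / 2` around the points are disjoint and lie in the
-- ball of radius `1 + δ / 2`.
theorem card_le_of_separated_unitBall {E : Type*} [NormedAddCommGroup E] [NormedSpace ℝ E]
    [FiniteDimensional ℝ E] {δ : ℝ} (hδ : 0 < δ) (s : Finset E) (hs : ∀ c ∈ s, ‖c‖ ≤ 1)
    (h : ∀ c ∈ s, ∀ d ∈ s, c ≠ d → δ ≤ ‖c - d‖) : (s.card : ℝ) ≤ (1 + 2 / δ) ^ finrank ℝ E := by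
  borelize E
  let μ : Measure E := Measure.addHaar
  have hδ2 : 0 < δ / 2 := by positivity
  have ρpos : 0 < 1 + δ / 2 := by positivity
  set A := ⋃ c ∈ s, ball (c : E) (δ / 2) with hA
  have D : Set.Pairwise (s : Set E) (Disjoint on fun c => ball (c : E) (δ / 2)) := by
    rintro c hc d hd hcd
    apply ball_disjoint_ball
    rw [dist_eq_norm]
    linarith [h c hc d hd hcd]
  have A_subset : A ⊆ ball (0 : E) (1 + δ / 2) := by
    refine Set.iUnion₂_subset fun x hx => ball_subset_ball' ?_
    rw [dist_zero_right]
    linarith [hs x hx]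
  have I : (s.card : ℝ≥0∞) * ENNReal.ofReal ((δ / 2) ^ finrank ℝ E) * μ (ball 0 1) ≤
      ENNReal.ofReal ((1 + δ / 2) ^ finrank ℝ E) * μ (ball 0 1) :=
    calc
      _ = μ A := by
        rw [hA, measure_biUnion_finset D fun c _ => measurableSet_ball]
        simp only [μ.addHaar_ball_of_pos _ hδ2, Finset.sum_const, nsmul_eq_mul, mul_assoc]
      _ ≤ μ (ball (0 : E) (1 + δ / 2)) := measure_mono A_subset
      _ = _ := by simp only [μ.addHaar_ball_of_pos _ ρpos]
  have J := (ENNReal.mul_le_mul_iff_left (measure_ball_pos μ (0 : E) zero_lt_one).ne'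
    measure_ball_lt_top.ne).1 I
  have K := ENNReal.toReal_le_of_le_ofReal (pow_nonneg ρpos.le _) J
  rw [ENNReal.toReal_mul, ENNReal.toReal_natCast, ENNReal.toReal_ofReal (by positivity),
    ← le_div_iff₀ (by positivity), ← div_pow] at K
  refine K.trans_eq ?_
  congr 1
  field_simp
  ring

open Module in
theorem exists_net_unitBall {E : Type*} [NormedAddCommGroup E] [NormedSpace ℝ E]
    [FiniteDimensional ℝ E] {δ : ℝ} (hδ : 0 < δ) :
    ∃ s : Finset E, (∀ c ∈ s, ‖c‖ ≤ 1) ∧ (s.card : ℝ) ≤ (1 + 2 / δ) ^ finrank ℝ E ∧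
      ∀ x : E, ‖x‖ ≤ 1 → ∃ c ∈ s, ‖x - c‖ ≤ δ := by
  classical
  let Q : Finset E → Prop := fun s => (∀ c ∈ s, ‖c‖ ≤ 1) ∧ ∀ c ∈ s, ∀ d ∈ s, c ≠ d → δ ≤ ‖c - d‖
  have hQ : ∀ s, Q s → (s.card : ℝ) ≤ (1 + 2 / δ) ^ finrank ℝ E := fun s hs =>
    card_le_of_separated_unitBall hδ s hs.1 hs.2
  let S : Set ℕ := {n | ∃ s, Q s ∧ s.card = n}
  have hS : S.Nonempty := ⟨0, ∅, ⟨by simp, by simp⟩, rfl⟩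
  have hB : BddAbove S := by
    refine ⟨⌊(1 + 2 / δ) ^ finrank ℝ E⌋₊, ?_⟩
    rintro n ⟨s, hs, rfl⟩
    exact Nat.le_floor (hQ s hs)
  -- A separated set of maximal cardinality is a net, since a point farther than `δ` from all of its
  -- points could be added to it.
  obtain ⟨s, hs, hsc⟩ := Nat.sSup_mem hS hB
  refine ⟨s, hs.1, hQ s hs, fun x hx => ?_⟩
  by_contra! hcon
  have hxs : x ∉ s := fun h => by
    have := hcon x h
    simp only [sub_self, norm_zero] at this
    linarith
  have h1 : Q (insert x s) := by
    refine ⟨fun c hc => ?_, fun c hc d hd hcd => ?_⟩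
    · rcases Finset.mem_insert.1 hc with rfl | hc
      · exact hx
      · exact hs.1 c hc
    · rcases Finset.mem_insert.1 hc with hc' | hc' <;>
        rcases Finset.mem_insert.1 hd with hd' | hd'
      · exact absurd (hc'.trans hd'.symm) hcd
      · rw [hc']; exact (hcon d hd').le
      · rw [hd', norm_sub_rev]; exact (hcon c hc').le
      · exact hs.2 c hc' d hd' hcd
  have h2 : (insert x s).card ≤ sSup S := le_csSup hB ⟨_, h1, rfl⟩
  rw [Finset.card_insert_of_notMem hxs, hsc] at h2
  omega

theorem ContinuousMultilinearMap.opNorm_le_of_unitBall {E : Type*} [NormedAddCommGroup E]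
    [NormedSpace ℝ E] {p : ℕ} (f : ContinuousMultilinearMap ℝ (fun _ : Fin p => E) ℝ) {M : ℝ}
    (hM : 0 ≤ M) (h : ∀ u : Fin p → E, (∀ k, ‖u k‖ ≤ 1) → |f u| ≤ M) : ‖f‖ ≤ M := by
  refine f.opNorm_le_bound hM fun m => ?_
  by_cases h0 : ∃ k, m k = 0
  · obtain ⟨k, hk⟩ := h0
    rw [f.map_coord_zero k hk, norm_zero]
    positivity
  push Not at h0
  have h1 : m = fun k => ‖m k‖ • (‖m k‖⁻¹ • m k) := by
    ext1 k
    rw [smul_smul, mul_inv_cancel₀ (norm_ne_zero_iff.2 (h0 k)), one_smul]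
  have h2 : f m = (∏ k, ‖m k‖) • f fun k => ‖m k‖⁻¹ • m k := by
    conv_lhs => rw [h1]
    exact f.map_smul_univ _ _
  rw [h2, norm_smul, Real.norm_of_nonneg (by positivity), mul_comm, Real.norm_eq_abs]
  gcongr
  refine h _ fun k => ?_
  rw [norm_smul, norm_inv, norm_norm, inv_mul_cancel₀ (norm_ne_zero_iff.2 (h0 k))]

/-- Moving all `p` arguments by at most `1 / (2 p)` changes the value by at most `‖f‖ / 2`, which is
absorbed on the left-hand side. Hence the mesh `1 / (2 p)` and the factor 2. -/
theorem ContinuousMultilinearMap.opNorm_le_of_net {E : Type*} [NormedAddCommGroup E]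
    [NormedSpace ℝ E] {p : ℕ} (hp : 1 ≤ p)
    (f : ContinuousMultilinearMap ℝ (fun _ : Fin p => E) ℝ) {s : Finset E}
    (hs : ∀ c ∈ s, ‖c‖ ≤ 1) (hnet : ∀ x : E, ‖x‖ ≤ 1 → ∃ c ∈ s, ‖x - c‖ ≤ 1 / (2 * p))
    {ε : ℝ} (hε : 0 ≤ ε) (h : ∀ t : Fin p → E, (∀ k, t k ∈ s) → |f t| ≤ ε) : ‖f‖ ≤ 2 * ε := by
  have hp' : (0 : ℝ) < p := by exact_mod_cast hp
  have key : ‖f‖ ≤ ε + ‖f‖ / 2 := by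
    refine f.opNorm_le_of_unitBall (by positivity) fun u hu => ?_
    choose t ht1 ht2 using fun k => hnet (u k) (hu k)
    have hu1 : ‖u‖ ≤ 1 := (pi_norm_le_iff_of_nonneg zero_le_one).2 hu
    have ht : ‖t‖ ≤ 1 := (pi_norm_le_iff_of_nonneg zero_le_one).2 fun k => hs _ (ht1 k)
    have hut : ‖u - t‖ ≤ 1 / (2 * p) :=
      (pi_norm_le_iff_of_nonneg (by positivity)).2 fun k => ht2 k
    have h1 := f.norm_image_sub_le u t
    rw [Fintype.card_fin] at h1
    have h2 : ‖f u - f t‖ ≤ ‖f‖ / 2 := by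
      calc ‖f u - f t‖ ≤ ‖f‖ * p * max ‖u‖ ‖t‖ ^ (p - 1) * ‖u - t‖ := h1
        _ ≤ ‖f‖ * p * 1 * (1 / (2 * p)) := by
          gcongr
          exact pow_le_one₀ (by positivity) (max_le hu1 ht)
        _ = ‖f‖ / 2 := by field_simp
    rw [Real.norm_eq_abs] at h2
    have := abs_sub_abs_le_abs_sub (f u) (f t)
    linarith [h t ht1]
  linarith

/-! ### Random tensors -/

section Tail

variable {N : ℕ} {Ω : Type u} [MeasurableSpace Ω] {P : Measure Ω}

theorem measure_abs_ge_le {X : Ω → ℝ} {c : ℝ≥0} [IsFiniteMeasure P] (hX : HasSubgaussianMGF X c P)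
    {v : ℝ} (hcv : (c : ℝ) ≤ v) {ε : ℝ} (hε : 0 < ε) :
    P {ω | ε ≤ |X ω|} ≤ ENNReal.ofReal (2 * Real.exp (-ε ^ 2 / (2 * v))) := by
  have one_side : ∀ Y : Ω → ℝ, HasSubgaussianMGF Y c P →
      P {ω | ε ≤ Y ω} ≤ ENNReal.ofReal (Real.exp (-ε ^ 2 / (2 * v))) := fun Y hY => by
    rw [← ofReal_measureReal]
    refine ENNReal.ofReal_le_ofReal ?_
    -- For `c = 0` the Chernoff exponent divides by zero and becomes trivial; the variable then
    -- vanishes almost surely.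
    rcases eq_or_ne c 0 with rfl | hc
    · have h0 : P {ω | ε ≤ Y ω} = 0 := by
        refine measure_mono_null (fun ω hω => ?_) hY.ae_eq_zero_of_hasSubgaussianMGF_zero
        simp only [Set.mem_ofPred_eq] at hω
        simp only [Set.mem_compl_iff, Set.mem_ofPred_eq, Pi.zero_apply]
        intro h; change Y ω = 0 at h; linarith
      simp only [Measure.real, h0]
      simp [Real.exp_nonneg]
    · refine (hY.measure_ge_le hε.le).trans (Real.exp_le_exp.2 ?_)
      have hc' : (0 : ℝ) < c := by exact_mod_cast pos_iff_ne_zero.2 hc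
      rw [neg_div, neg_div, neg_le_neg_iff]
      gcongr
  calc P {ω | ε ≤ |X ω|} ≤ P ({ω | ε ≤ X ω} ∪ {ω | ε ≤ (-X) ω}) := by
        refine measure_mono fun ω hω => ?_
        simpa [le_abs] using hω
    _ ≤ _ := measure_union_le _ _
    _ ≤ _ := add_le_add (one_side _ hX) (one_side _ hX.neg)
    _ = _ := by rw [← ENNReal.ofReal_add (by positivity) (by positivity)]; ring_nf

/-- The evaluations of the tensors at unit vectors are sub-Gaussian, with variances at most those
of the disorder. -/
def SubgaussianArray (P : Measure Ω) (K : DisorderIdx N → Ω → ℝ) : Prop :=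
  ∀ p, 2 ≤ p → ∀ u : Fin p → Eu N, (∀ k, ‖u k‖ ≤ 1) →
    ∃ c : ℝ≥0, (c : ℝ) ≤ ((N : ℝ) ^ (p - 1))⁻¹ ∧
      HasSubgaussianMGF (fun ω => tensor (fun a => K a ω) p u) c P

/-- Union bound over `p`-tuples from a net of mesh `1 / (2 p)`. The net has at most `(1 + 4 p) ^ N ≤
exp (4 p N)` points, so there are at most `exp (4 p² N)` tuples, each with a tail of at most `2 exp
(-(49 / 8) p² N)`. The constant 7 is large enough that `49 / 8 - 4 > 1`. -/
theorem measure_tensorSize_gt_le [IsFiniteMeasure P] (hN : 1 ≤ N) {K : DisorderIdx N → Ω → ℝ}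
    (hK : SubgaussianArray P K) {p : ℕ} (hp : 2 ≤ p) :
    P {ω | 7 * (p : ℝ) < tensorSize (fun a => K a ω) p}
      ≤ ENNReal.ofReal (2 * Real.exp (-(p * N))) := by
  classical
  have hN' : (0 : ℝ) < N := by exact_mod_cast hN
  have hN1 : (1 : ℝ) ≤ N := by exact_mod_cast hN
  have hp' : (2 : ℝ) ≤ p := by exact_mod_cast hp
  have hs : 0 < √(N : ℝ) := Real.sqrt_pos.2 hN'
  obtain ⟨s, hs1, hcard, hnet⟩ := exists_net_unitBall (E := Eu N)
    (δ := 1 / (2 * (p : ℝ))) (by positivity)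
  rw [finrank_euclideanSpace_fin] at hcard
  -- The threshold `7 p` for `tensorSize`, rescaled to the norm of the tensor and halved to make up
  -- for the factor 2 in `opNorm_le_of_net`.
  set ε : ℝ := 7 * p * N / √N ^ p / 2 with hε
  have hεpos : 0 < ε := by positivity
  have hsub : {ω | 7 * (p : ℝ) < tensorSize (fun a => K a ω) p}
      ⊆ ⋃ t ∈ Fintype.piFinset (fun _ : Fin p => s),
        {ω | ε ≤ |tensor (fun a => K a ω) p t|} := by
    intro ω hω
    simp only [Set.mem_ofPred_eq] at hω
    by_contra hcon
    simp only [Set.mem_iUnion, Set.mem_ofPred_eq, not_exists, not_le, Fintype.mem_piFinset] at hcon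
    have := (tensor (fun a => K a ω) p).opNorm_le_of_net (by omega) hs1 hnet hεpos.le
      fun t ht => (hcon t ht).le
    rw [tensorSize, lt_div_iff₀ hN'] at hω
    have h2 : √(N : ℝ) ^ p * ‖tensor (fun a => K a ω) p‖ ≤ √(N : ℝ) ^ p * (2 * ε) := by gcongr
    have h3 : √(N : ℝ) ^ p * (2 * ε) = 7 * p * N := by
      rw [hε]; field_simp
    linarith
  have hexp : -ε ^ 2 / (2 * ((N : ℝ) ^ (p - 1))⁻¹) = -(49 / 8 * p ^ 2 * N) := by
    have e1 : (√(N : ℝ) ^ p) ^ 2 = N ^ p := by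
      rw [← pow_mul, mul_comm, pow_mul, Real.sq_sqrt hN'.le]
    have e2 : (N : ℝ) ^ p = N ^ (p - 1) * N := by
      rw [← pow_succ]; congr 1; omega
    have e3 : ε ^ 2 = 49 / 4 * p ^ 2 * N ^ 2 / (N ^ (p - 1) * N) := by
      rw [hε, div_pow, div_pow, e1, e2]; ring
    rw [e3]
    field_simp
    ring
  have hone : ∀ t ∈ Fintype.piFinset (fun _ : Fin p => s),
      P {ω | ε ≤ |tensor (fun a => K a ω) p t|}
        ≤ ENNReal.ofReal (2 * Real.exp (-(49 / 8 * p ^ 2 * N))) := fun t ht => by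
    obtain ⟨c, hc, hX⟩ := hK p hp t fun k => hs1 _ (Fintype.mem_piFinset.1 ht k)
    rw [← hexp]
    exact measure_abs_ge_le hX hc hεpos
  have hcard2 : ((Fintype.piFinset (fun _ : Fin p => s)).card : ℝ) ≤ Real.exp (4 * p ^ 2 * N) := by
    rw [Fintype.card_piFinset_const]
    push_cast
    calc (s.card : ℝ) ^ p ≤ ((1 + 2 / (1 / (2 * (p : ℝ)))) ^ N) ^ p := by gcongr
      _ ≤ (Real.exp (4 * p) ^ N) ^ p := by
        gcongr
        have := Real.add_one_le_exp (4 * (p : ℝ))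
        have e : 2 / (1 / (2 * (p : ℝ))) = 4 * p := by field_simp; ring
        rw [e]; linarith
      _ = _ := by
        rw [← Real.exp_nat_mul, ← Real.exp_nat_mul]
        congr 1; ring
  calc P {ω | 7 * (p : ℝ) < tensorSize (fun a => K a ω) p}
      ≤ ∑ t ∈ Fintype.piFinset (fun _ : Fin p => s),
          P {ω | ε ≤ |tensor (fun a => K a ω) p t|} :=
        (measure_mono hsub).trans (measure_biUnion_finset_le _ _)
    _ ≤ ∑ t ∈ Fintype.piFinset (fun _ : Fin p => s),
          ENNReal.ofReal (2 * Real.exp (-(49 / 8 * p ^ 2 * N))) := Finset.sum_le_sum hone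
    _ = ENNReal.ofReal ((Fintype.piFinset (fun _ : Fin p => s)).card
          * (2 * Real.exp (-(49 / 8 * p ^ 2 * N)))) := by
        rw [Finset.sum_const, nsmul_eq_mul, ENNReal.ofReal_mul (Nat.cast_nonneg _),
          ENNReal.ofReal_natCast]
    _ ≤ ENNReal.ofReal (2 * Real.exp (-(p * N))) := by
        refine ENNReal.ofReal_le_ofReal ?_
        calc _ ≤ Real.exp (4 * p ^ 2 * N) * (2 * Real.exp (-(49 / 8 * p ^ 2 * N))) := by gcongr
          _ = 2 * Real.exp (4 * p ^ 2 * N + -(49 / 8 * p ^ 2 * N)) := by rw [Real.exp_add]; ring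
          _ ≤ _ := by
            gcongr
            have : (p : ℝ) * N ≤ p ^ 2 * N := by
              gcongr
              nlinarith
            have : (0 : ℝ) ≤ p ^ 2 * N := by positivity
            linarith

theorem summable_exp_neg_nat : Summable fun p : ℕ => Real.exp (-(p : ℝ)) :=
  Real.summable_exp_neg_nat

/-- The constant in the exponential bound on the probability of large tensors. -/
def tailConst : ℝ := ∑' p : ℕ, 2 * Real.exp 1 * Real.exp (-(p : ℝ))

theorem tail_term_le (hN : 1 ≤ N) {p : ℕ} (hp : 2 ≤ p) :
    2 * Real.exp (-((p : ℝ) * N)) ≤ Real.exp (-(N : ℝ)) * (2 * Real.exp 1 * Real.exp (-(p : ℝ))) := by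
  have hN1 : (1 : ℝ) ≤ N := by exact_mod_cast hN
  have hp' : (2 : ℝ) ≤ p := by exact_mod_cast hp
  have : Real.exp (-((p : ℝ) * N)) ≤ Real.exp (-(N : ℝ)) * (Real.exp 1 * Real.exp (-(p : ℝ))) := by
    rw [← Real.exp_add, ← Real.exp_add]
    refine Real.exp_le_exp.2 ?_
    -- The inequality of the exponents is `(p - 1) * (N - 1) ≥ 0`.
    nlinarith
  linarith

theorem measure_exists_tensorSize_gt_le [IsFiniteMeasure P] (hN : 1 ≤ N)
    {K : DisorderIdx N → Ω → ℝ} (hK : SubgaussianArray P K) :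
    P {ω | ∃ p : ℕ, 2 ≤ p ∧ 7 * (p : ℝ) < tensorSize (fun a => K a ω) p}
      ≤ ENNReal.ofReal (tailConst * Real.exp (-(N : ℝ))) := by
  have hsum : Summable fun p : ℕ => 2 * Real.exp 1 * Real.exp (-(p : ℝ)) :=
    summable_exp_neg_nat.mul_left _
  have h1 : {ω | ∃ p : ℕ, 2 ≤ p ∧ 7 * (p : ℝ) < tensorSize (fun a => K a ω) p}
      ⊆ ⋃ p : ℕ, {ω | 2 ≤ p ∧ 7 * (p : ℝ) < tensorSize (fun a => K a ω) p} := fun ω ⟨p, h⟩ =>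
    Set.mem_iUnion.2 ⟨p, h⟩
  calc _ ≤ ∑' p : ℕ, P {ω | 2 ≤ p ∧ 7 * (p : ℝ) < tensorSize (fun a => K a ω) p} :=
        (measure_mono h1).trans (measure_iUnion_le _)
    _ ≤ ∑' p : ℕ, ENNReal.ofReal
          (Real.exp (-(N : ℝ)) * (2 * Real.exp 1 * Real.exp (-(p : ℝ)))) := by
        refine ENNReal.tsum_le_tsum fun p => ?_
        by_cases hp : 2 ≤ p
        · simp only [hp, true_and]
          exact (measure_tensorSize_gt_le hN hK hp).trans
            (ENNReal.ofReal_le_ofReal (tail_term_le hN hp))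
        · simp [hp]
    _ = _ := by
        rw [← ENNReal.ofReal_tsum_of_nonneg (fun p => by positivity) (hsum.mul_left _),
          tsum_mul_left, mul_comm, tailConst]

theorem TameArray.of_eventually {j : DisorderIdx N → ℝ}
    (h : ∀ᶠ p : ℕ in atTop, tensorSize j p ≤ 7 * (p : ℝ)) : TameArray j := by
  obtain ⟨n, hn⟩ := eventually_atTop.1 h
  have hS : ∀ p < n, tensorSize j p ≤ ∑ k ∈ Finset.range n, tensorSize j k := fun p hp =>
    Finset.single_le_sum (fun k _ => tensorSize_nonneg j k) (Finset.mem_range.2 hp)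
  have hS0 : 0 ≤ ∑ k ∈ Finset.range n, tensorSize j k :=
    Finset.sum_nonneg fun k _ => tensorSize_nonneg j k
  refine ⟨7 + ∑ k ∈ Finset.range n, tensorSize j k, fun p _ => ?_⟩
  have hp : (0 : ℝ) ≤ p := p.cast_nonneg
  rcases lt_or_ge p n with hpn | hpn
  · nlinarith [hS p hpn]
  · nlinarith [hn p hpn]

/-- Borel–Cantelli over the degrees at fixed `N`; the finitely many exceptional degrees only enlarge
the random constant. This puts the pathwise identities below on an event of full probability. -/
theorem SubgaussianArray.ae_tameArray [IsFiniteMeasure P] (hN : 1 ≤ N) {K : DisorderIdx N → Ω → ℝ}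
    (hK : SubgaussianArray P K) : ∀ᵐ ω ∂P, TameArray fun a => K a ω := by
  have hsum : Summable fun p : ℕ => Real.exp (-(N : ℝ)) * (2 * Real.exp 1 * Real.exp (-(p : ℝ))) :=
    (summable_exp_neg_nat.mul_left _).mul_left _
  have h1 : ∑' p : ℕ, P {ω | 2 ≤ p ∧ 7 * (p : ℝ) < tensorSize (fun a => K a ω) p} ≠ ∞ := by
    refine ne_top_of_le_ne_top (b := ∑' p : ℕ, ENNReal.ofReal
          (Real.exp (-(N : ℝ)) * (2 * Real.exp 1 * Real.exp (-(p : ℝ))))) ?_ ?_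
    · rw [← ENNReal.ofReal_tsum_of_nonneg (fun p => by positivity) hsum]
      exact ENNReal.ofReal_ne_top
    · refine ENNReal.tsum_le_tsum fun p => ?_
      by_cases hp : 2 ≤ p
      · simp only [hp, true_and]
        exact (measure_tensorSize_gt_le hN hK hp).trans
          (ENNReal.ofReal_le_ofReal (tail_term_le hN hp))
      · simp [hp]
  filter_upwards [ae_eventually_notMem h1] with ω hω
  refine TameArray.of_eventually ?_
  filter_upwards [hω, eventually_ge_atTop 2] with p h2 h3
  simp only [not_and, not_lt] at h2
  exact h2 h3

end Tail

/-! ### Sub-Gaussian arrays obtained from the disorder by contractions -/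

section GaussianArray

variable {N : ℕ} {Ω : Type u} [MeasurableSpace Ω] {P : Measure Ω} [IsProbabilityMeasure P]
  {J : DisorderIdx N → Ω → ℝ}

theorem sum_prod_sq_le_one {p : ℕ} {u : Fin p → Eu N} (hu : ∀ k, ‖u k‖ ≤ 1) :
    ∑ i : Fin p → Fin N, (∏ k, u k (i k)) ^ 2 ≤ 1 := by
  have h : ∑ i : Fin p → Fin N, (∏ k, u k (i k)) ^ 2 = ∏ k, ‖u k‖ ^ 2 := by
    simp only [← Finset.prod_pow, EuclideanSpace.real_norm_sq_eq]
    rw [Finset.prod_univ_sum]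
    simp
  rw [h]
  exact Finset.prod_le_one (fun k _ => by positivity) fun k _ => pow_le_one₀ (norm_nonneg _) (hu k)

theorem IsDisorder.norm_sq_sum_prod_le (hJ : IsDisorder P J) {p : ℕ} {u : Fin p → Eu N}
    (hu : ∀ k, ‖u k‖ ≤ 1) :
    ‖∑ i : Fin p → Fin N, (∏ k, u k (i k)) • coupling P J ⟨p, i⟩‖ ^ 2
      ≤ ((N : ℝ) ^ (p - 1))⁻¹ := by
  classical
  rw [← real_inner_self_eq_norm_sq, sum_inner]
  have e : ∀ i : Fin p → Fin N, ⟪(∏ k, u k (i k)) • coupling P J ⟨p, i⟩,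
      ∑ i : Fin p → Fin N, (∏ k, u k (i k)) • coupling P J ⟨p, i⟩⟫
      = (∏ k, u k (i k)) ^ 2 * ((N : ℝ) ^ (p - 1))⁻¹ := fun i => by
    simp [inner_sum, inner_smul_left, inner_smul_right, hJ.inner_coupling, couplingVar]
    ring
  rw [Finset.sum_congr rfl fun i _ => e i, ← Finset.sum_mul]
  exact mul_le_of_le_one_left (by positivity) (sum_prod_sq_le_one hu)

/-- The images of the couplings under a contraction that preserves the Gaussian space. -/
theorem IsDisorder.subgaussianArray (hJ : IsDisorder P J) (A : Lp ℝ 2 P →L[ℝ] Lp ℝ 2 P)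
    (hA : ∀ g, ‖A g‖ ≤ ‖g‖) (hAG : ∀ g ∈ gaussianSpace P J, A g ∈ gaussianSpace P J)
    {K : DisorderIdx N → Ω → ℝ} (hK : ∀ a, K a =ᵐ[P] A (coupling P J a)) :
    SubgaussianArray P K := by
  intro p hp u hu
  set ℓ : (Fin p → Fin N) → ℝ := fun i => ∏ k, u k (i k)
  set g : Lp ℝ 2 P := ∑ i : Fin p → Fin N, ℓ i • coupling P J ⟨p, i⟩ with hg
  have hgG : g ∈ gaussianSpace P J :=
    Submodule.sum_mem _ fun _ _ => Submodule.smul_mem _ _ (coupling_mem P J _)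
  refine ⟨‖A g‖₊ ^ 2, ?_, (hJ.gaussianTail (hAG g hgG)).hasSubgaussianMGF.congr ?_⟩
  · push_cast
    refine le_trans ?_ (hJ.norm_sq_sum_prod_le hu)
    gcongr
    exact hA g
  · have h1 : ∀ᵐ ω ∂P, ∀ a, K a ω = A (coupling P J a) ω := ae_all_iff.2 hK
    have h2 : A g = ∑ i : Fin p → Fin N, ℓ i • A (coupling P J ⟨p, i⟩) := by
      simp [hg]
    rw [h2]
    filter_upwards [h1, coeFn_finset_sum_smul Finset.univ ℓ fun i => A (coupling P J ⟨p, i⟩)]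
      with ω h1 h3
    rw [h3, tensor_apply]
    exact Finset.sum_congr rfl fun i _ => by rw [h1, mul_comm]

theorem IsDisorder.ae_tameArray (hJ : IsDisorder P J) (hN : 1 ≤ N) :
    ∀ᵐ ω ∂P, TameArray fun a => J a ω :=
  (hJ.subgaussianArray (ContinuousLinearMap.id ℝ _) (fun _ => le_rfl) (fun _ h => h)
    fun a => (coeFn_l2Class (hJ.memLp a)).symm).ae_tameArray hN

end GaussianArray

/-! ### The Hamiltonian and its gradient as elements of the Gaussian space -/

section Pairing

variable {N : ℕ} {Ω : Type u} [MeasurableSpace Ω] {P : Measure Ω} [IsProbabilityMeasure P]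
  {J : DisorderIdx N → Ω → ℝ} {b : ℕ → ℝ} {r : ℝ} {x y : Eu N}

/-- The array of the covariances of a random variable with the disorder. -/
def covArray (P : Measure Ω) (J : DisorderIdx N → Ω → ℝ) (g : Lp ℝ 2 P) : DisorderIdx N → ℝ :=
  fun a => ⟪g, coupling P J a⟫

/-- The value of the Hamiltonian at a point, as an element of `L²`. -/
def valueClass (P : Measure Ω) (J : DisorderIdx N → Ω → ℝ) (b : ℕ → ℝ) (x : Eu N) : Lp ℝ 2 P :=
  l2Class P fun ω => hamiltonian b (fun a => J a ω) x

/-- The derivative of the Hamiltonian at a point, as an element of `L²`. -/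
def derivClass (P : Measure Ω) (J : DisorderIdx N → Ω → ℝ) (b : ℕ → ℝ) (x u : Eu N) : Lp ℝ 2 P :=
  l2Class P fun ω => fderiv ℝ (hamiltonian b fun a => J a ω) x u

/-- Evaluated at unit vectors, the tensor of covariances is the inner product of `g` with a linear
form in the disorder of variance at most `N ^ (-(p - 1))`; Cauchy–Schwarz concludes. -/
theorem IsDisorder.norm_tensor_covArray_le (hJ : IsDisorder P J) (g : Lp ℝ 2 P) (p : ℕ) :
    ‖tensor (covArray P J g) p‖ ≤ ‖g‖ * (√N ^ (p - 1))⁻¹ := by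
  refine ContinuousMultilinearMap.opNorm_le_of_unitBall _ (by positivity) fun u hu => ?_
  have h1 : tensor (covArray P J g) p u
      = ⟪g, ∑ i : Fin p → Fin N, (∏ k, u k (i k)) • coupling P J ⟨p, i⟩⟫ := by
    rw [tensor_apply, inner_sum]
    exact Finset.sum_congr rfl fun i _ => by rw [inner_smul_right, covArray, mul_comm]
  rw [h1]
  refine (abs_real_inner_le_norm _ _).trans ?_
  gcongr
  refine abs_le_of_sq_le_sq' ?_ (by positivity) |>.2
  refine (hJ.norm_sq_sum_prod_le hu).trans_eq ?_
  rw [inv_pow, ← pow_mul, mul_comm, pow_mul, Real.sq_sqrt (Nat.cast_nonneg N)]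

theorem IsDisorder.tensorSize_covArray_le (hJ : IsDisorder P J) (hN : 1 ≤ N) (g : Lp ℝ 2 P) {p : ℕ}
    (hp : 2 ≤ p) : tensorSize (covArray P J g) p ≤ ‖g‖ / √N * (p + 1) := by
  have hN' : (0 : ℝ) < N := by exact_mod_cast hN
  have hs : 0 < √(N : ℝ) := Real.sqrt_pos.2 hN'
  have h1 : tensorSize (covArray P J g) p ≤ ‖g‖ / √N := by
    calc tensorSize (covArray P J g) p ≤ √N ^ p * (‖g‖ * (√N ^ (p - 1))⁻¹) / N := by
          unfold tensorSize
          gcongr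
          exact hJ.norm_tensor_covArray_le g p
      _ = ‖g‖ / √N := by
          obtain ⟨k, rfl⟩ : ∃ k, p = k + 1 := ⟨p - 1, by omega⟩
          rw [Nat.add_sub_cancel, pow_succ]
          nth_rw 4 [← Real.sq_sqrt hN'.le]
          field_simp
  refine h1.trans (le_mul_of_one_le_right (by positivity) ?_)
  have : (0 : ℝ) ≤ p := p.cast_nonneg
  linarith

theorem IsDisorder.tameArray_covArray (hJ : IsDisorder P J) (hN : 1 ≤ N) (g : Lp ℝ 2 P) :
    TameArray (covArray P J g) := ⟨_, fun _ hp => hJ.tensorSize_covArray_le hN g hp⟩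

/-- A random variable given by a series in the disorder whose terms are bounded by duality. -/
theorem IsDisorder.l2Class_of_dual_bound (hJ : IsDisorder P J) {ℓ : DisorderIdx N → ℝ}
    {w : ℕ → ℝ} (hw : Summable w)
    (hℓ : ∀ (g : Lp ℝ 2 P) (p : ℕ),
      |∑ i : Fin p → Fin N, ℓ ⟨p, i⟩ * covArray P J g ⟨p, i⟩| ≤ ‖g‖ * w p) {X : Ω → ℝ}
    (hX : ∀ᵐ ω ∂P, HasSum (fun p => ∑ i : Fin p → Fin N, ℓ ⟨p, i⟩ * J ⟨p, i⟩ ω) (X ω)) :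
    MemLp X 2 P ∧ l2Class P X ∈ gaussianSpace P J ∧
      ∀ g, HasSum (fun p => ∑ i : Fin p → Fin N, ℓ ⟨p, i⟩ * covArray P J g ⟨p, i⟩)
        ⟪g, l2Class P X⟫ := by
  have hin : ∀ (g : Lp ℝ 2 P) (p : ℕ), ⟪g, degreeSum P J ℓ p⟫
      = ∑ i : Fin p → Fin N, ℓ ⟨p, i⟩ * covArray P J g ⟨p, i⟩ := fun g p => by
    rw [degreeSum, inner_sum]
    exact Finset.sum_congr rfl fun i _ => by rw [inner_smul_right, covArray]
  -- The dual bound, tested against the element itself. Where that element vanishes one still needs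
  -- `0 ≤ w p`, which follows by testing against the constant one.
  have hnorm : ∀ p, ‖degreeSum P J ℓ p‖ ≤ w p := fun p => by
    have h1 := hℓ (degreeSum P J ℓ p) p
    rw [← hin, real_inner_self_eq_norm_sq, abs_of_nonneg (sq_nonneg _), sq] at h1
    rcases (norm_nonneg (degreeSum P J ℓ p)).eq_or_lt with h | h
    · have h2 := hℓ (l2Class P fun _ => 1) p
      rw [← h]
      by_contra hneg
      push Not at hneg
      have h3 : ‖l2Class P (fun _ => (1 : ℝ))‖ ^ 2 = 1 := by
        rw [← real_inner_self_eq_norm_sq, inner_l2Class (memLp_const _) (memLp_const _)]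
        simp
      have h4 : 0 < ‖l2Class P (fun _ => (1 : ℝ))‖ := by
        rcases (norm_nonneg (l2Class P (fun _ => (1 : ℝ)))).eq_or_lt with h | h
        · rw [← h] at h3; norm_num at h3
        · exact h
      have := (abs_nonneg _).trans h2
      nlinarith
    · exact le_of_mul_le_mul_left h1 h
  obtain ⟨h1, h2, h3⟩ := hJ.hasSum_l2Class
    (hw.of_nonneg_of_le (fun p => norm_nonneg _) hnorm) hX
  refine ⟨h1, h2, fun g => ?_⟩
  simpa only [innerSL_apply_apply, hin] using h3.mapL (innerSL ℝ g)

/-- A reproducing property: pairing `H(x)` with `g` replaces each coupling in the series by its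
covariance with `g`. It turns `L²` elements into smooth deterministic functions of `x`, and all
covariances and conditional means are read off from it. -/
theorem IsDisorder.valueClass_spec (hJ : IsDisorder P J) (hN : 1 ≤ N) (hr : 1 ≤ r)
    (hb : SmoothCoeff b r) (hx : x ∈ Metric.ball (0 : Eu N) (r * √N)) :
    MemLp (fun ω => hamiltonian b (fun a => J a ω) x) 2 P ∧
      valueClass P J b x ∈ gaussianSpace P J ∧
      ∀ g, ⟪g, valueClass P J b x⟫ = hamiltonian b (covArray P J g) x := by
  have hser : ∀ (j : DisorderIdx N → ℝ) p, ∑ i : Fin p → Fin N, b p * monomialFun i x * j ⟨p, i⟩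
      = b p * pSpin j p x := fun j p => by
    rw [pSpin_eq_sum, Finset.mul_sum]
    exact Finset.sum_congr rfl fun i _ => by ring
  obtain ⟨h1, h2, h3⟩ := hJ.l2Class_of_dual_bound
    (ℓ := fun a => b a.1 * monomialFun a.2 x)
    (w := fun p => (√(N : ℝ))⁻¹ * N / √N ^ 0 * (|b p| * ((p : ℝ) + 1) ^ 3 * r ^ p))
    (hb.summable.mul_left _)
    (fun g p => by
      rw [hser, abs_mul]
      have := term_bound hN hb (fun p hp => hJ.tensorSize_covArray_le hN g hp) p 0 (by norm_num) hr
      rw [mem_ball_zero_iff] at hx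
      calc |b p| * |pSpin (covArray P J g) p x|
          ≤ |b p| * (p.descFactorial 0 * ‖tensor (covArray P J g) p‖ * (r * √N) ^ (p - 0)) := by
            gcongr
            refine (abs_pSpin_le _ _ _).trans ?_
            simp only [Nat.descFactorial_zero, Nat.cast_one, one_mul, Nat.sub_zero]
            gcongr
        _ ≤ _ := this
        _ = _ := by ring)
    (X := fun ω => hamiltonian b (fun a => J a ω) x)
    (by
      filter_upwards [hJ.ae_tameArray hN] with ω hω
      simpa only [hser fun a => J a ω] using hasSum_hamiltonian hN hr hb hω hx)
  refine ⟨h1, h2, fun g => ?_⟩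
  have h4 := h3 g
  simp only [hser] at h4
  exact h4.unique (hasSum_hamiltonian hN hr hb (hJ.tameArray_covArray hN g) hx)

theorem IsDisorder.derivClass_spec (hJ : IsDisorder P J) (hN : 1 ≤ N) (hr : 1 ≤ r)
    (hb : SmoothCoeff b r) (hx : x ∈ Metric.ball (0 : Eu N) (r * √N)) (u : Eu N) :
    MemLp (fun ω => fderiv ℝ (hamiltonian b (fun a => J a ω)) x u) 2 P ∧
      derivClass P J b x u ∈ gaussianSpace P J ∧
      ∀ g, ⟪g, derivClass P J b x u⟫ = fderiv ℝ (hamiltonian b (covArray P J g)) x u := by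
  have hser : ∀ (j : DisorderIdx N → ℝ) p,
      ∑ i : Fin p → Fin N, b p * fderiv ℝ (monomialFun i) x u * j ⟨p, i⟩
        = b p * fderiv ℝ (pSpin j p) x u := fun j p => by
    rw [fderiv_pSpin_apply, Finset.mul_sum]
    exact Finset.sum_congr rfl fun i _ => by ring
  obtain ⟨h1, h2, h3⟩ := hJ.l2Class_of_dual_bound
    (ℓ := fun a => b a.1 * fderiv ℝ (monomialFun a.2) x u)
    (w := fun p => ‖u‖ * ((√(N : ℝ))⁻¹ * N / √N ^ 1 * (|b p| * ((p : ℝ) + 1) ^ 3 * r ^ p)))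
    ((hb.summable.mul_left _).mul_left _)
    (fun g p => by
      rw [hser, abs_mul]
      have := term_bound hN hb (fun p hp => hJ.tensorSize_covArray_le hN g hp) p 1 (by norm_num) hr
      rw [mem_ball_zero_iff] at hx
      calc |b p| * |fderiv ℝ (pSpin (covArray P J g) p) x u|
          ≤ |b p| * ((p.descFactorial 1 * ‖tensor (covArray P J g) p‖ * (r * √N) ^ (p - 1))
              * ‖u‖) := by
            gcongr
            have h := (fderiv ℝ (pSpin (covArray P J g) p) x).le_opNorm u
            rw [Real.norm_eq_abs] at h
            refine h.trans ?_
            gcongr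
            refine (norm_fderiv_pSpin_le _ _ _).trans ?_
            simp only [Nat.descFactorial_one]
            gcongr
        _ = |b p| * (p.descFactorial 1 * ‖tensor (covArray P J g) p‖ * (r * √N) ^ (p - 1))
              * ‖u‖ := by ring
        _ ≤ _ := mul_le_mul_of_nonneg_right this (norm_nonneg u)
        _ = _ := by ring)
    (X := fun ω => fderiv ℝ (hamiltonian b (fun a => J a ω)) x u)
    (by
      filter_upwards [hJ.ae_tameArray hN] with ω hω
      simpa only [hser fun a => J a ω] using hasSum_fderiv_hamiltonian hN hr hb hω hx u)
  refine ⟨h1, h2, fun g => ?_⟩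
  have h4 := h3 g
  simp only [hser] at h4
  exact h4.unique (hasSum_fderiv_hamiltonian hN hr hb (hJ.tameArray_covArray hN g) hx u)

/-! ### Covariances of the Hamiltonian and of its gradient -/

theorem sum_prod_mul_prod (p : ℕ) (x y : Eu N) :
    ∑ i : Fin p → Fin N, monomialFun i x * monomialFun i y = ⟪x, y⟫ ^ p := by
  have h : ⟪x, y⟫ = ∑ k, x k * y k := by
    simp [PiLp.inner_apply, mul_comm]
  rw [h, Finset.sum_pow' ]
  simp [monomialFun, Finset.prod_mul_distrib]

/-- The reproducing property with `g` a single coupling: by orthogonality one monomial remains. -/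
theorem IsDisorder.covArray_valueClass (hJ : IsDisorder P J) (hN : 1 ≤ N) (hr : 1 ≤ r)
    (hb : SmoothCoeff b r) (hx : x ∈ Metric.ball (0 : Eu N) (r * √N)) (p : ℕ) (i : Fin p → Fin N) :
    covArray P J (valueClass P J b x) ⟨p, i⟩
      = b p * monomialFun i x * ((N : ℝ) ^ (p - 1))⁻¹ := by
  classical
  rw [covArray, real_inner_comm, (hJ.valueClass_spec hN hr hb hx).2.2, hamiltonian,
    tsum_eq_single p]
  · rw [pSpin_eq_sum]
    simp only [covArray, hJ.inner_coupling, couplingVar]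
    rw [Finset.sum_eq_single i]
    · simp; ring
    · intro i' _ h
      simp [h.symm]
    · simp
  · intro p' hp'
    rw [pSpin_eq_sum]
    have : ∀ i' : Fin p' → Fin N, covArray P J (coupling P J ⟨p, i⟩) ⟨p', i'⟩ = 0 := fun i' => by
      rw [covArray, hJ.inner_coupling, if_neg]
      intro h
      exact hp' (congrArg Sigma.fst h).symm
    simp [this]

/-- The covariance function of the Hamiltonian. -/
theorem IsDisorder.hamiltonian_covArray_valueClass (hJ : IsDisorder P J) (hN : 1 ≤ N) (hr : 1 ≤ r)
    (hb : SmoothCoeff b r) (hx : x ∈ Metric.ball (0 : Eu N) (r * √N)) (y : Eu N) :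
    hamiltonian b (covArray P J (valueClass P J b x)) y = N * mixture b (⟪x, y⟫ / N) := by
  have hN' : (N : ℝ) ≠ 0 := by
    have : (0 : ℝ) < N := by exact_mod_cast hN
    exact this.ne'
  rw [hamiltonian, mixture, ← tsum_mul_left]
  refine tsum_congr fun p => ?_
  rcases p.eq_zero_or_pos with rfl | hp
  · simp [hb.zero]
  have e : (N : ℝ) ^ p = N ^ (p - 1) * N := by
    rw [← pow_succ, Nat.sub_add_cancel hp]
  calc b p * pSpin (covArray P J (valueClass P J b x)) p y
      = b p * (b p * ((N : ℝ) ^ (p - 1))⁻¹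
          * ∑ i : Fin p → Fin N, monomialFun i x * monomialFun i y) := by
        simp only [pSpin_eq_sum, Finset.mul_sum]
        refine Finset.sum_congr rfl fun i _ => ?_
        rw [hJ.covArray_valueClass hN hr hb hx]
        ring
    _ = _ := by
        rw [sum_prod_mul_prod, div_pow, e]
        field_simp

theorem hasFDerivAt_mixture_inner (hr : 1 < r) (hb : SmoothCoeff b r) (hN : 1 ≤ N)
    (h : |⟪x, y⟫ / N| < r) (u : Eu N) :
    fderiv ℝ (fun y => (N : ℝ) * mixture b (⟪x, y⟫ / N)) y u = mixture' b (⟪x, y⟫ / N) * ⟪x, u⟫ := by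
  have hN' : (N : ℝ) ≠ 0 := by
    have : (0 : ℝ) < N := by exact_mod_cast hN
    exact this.ne'
  have h1 : HasFDerivAt (fun y : Eu N => ⟪x, y⟫ / N) ((N : ℝ)⁻¹ • innerSL ℝ x) y := by
    have := ((innerSL ℝ x).hasFDerivAt (x := y)).const_smul (N : ℝ)⁻¹
    refine this.congr_of_eventuallyEq (Eventually.of_forall fun z => ?_)
    simp [div_eq_inv_mul]
  have h2 := ((hasDerivAt_mixture hr hb h).comp_hasFDerivAt y h1).const_mul (N : ℝ)
  have h3 := h2.fderiv
  simp only [Function.comp_def] at h3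
  rw [h3]
  simp
  field_simp

theorem fderiv_mixture'_inner (hr : 1 < r) (hb : SmoothCoeff b r)
    (h : |⟪x, y⟫ / N| < r) (u w : Eu N) :
    fderiv ℝ (fun y => mixture' b (⟪x, y⟫ / N) * ⟪y, u⟫) y w
      = mixture'' b (⟪x, y⟫ / N) * (⟪x, w⟫ * ⟪y, u⟫ / N) + mixture' b (⟪x, y⟫ / N) * ⟪w, u⟫ := by
  have h1 : HasFDerivAt (fun y : Eu N => ⟪x, y⟫ / N) ((N : ℝ)⁻¹ • innerSL ℝ x) y := by
    have := ((innerSL ℝ x).hasFDerivAt (x := y)).const_smul (N : ℝ)⁻¹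
    refine this.congr_of_eventuallyEq (Eventually.of_forall fun z => ?_)
    simp [div_eq_inv_mul]
  have h2 := (hasDerivAt_mixture' hr hb h).comp_hasFDerivAt y h1
  have h3 : HasFDerivAt (fun y : Eu N => ⟪y, u⟫) (innerSL ℝ u) y := by
    refine ((innerSL ℝ u).hasFDerivAt (x := y)).congr_of_eventuallyEq
      (Eventually.of_forall fun z => ?_)
    simp [real_inner_comm]
  have h4 := (h2.mul h3).fderiv
  simp only [Function.comp_def] at h4
  have h5 : (fun y => mixture' b (⟪x, y⟫ / N) * ⟪y, u⟫)
    = (fun y : Eu N => mixture' b (⟪x, y⟫ / N)) * fun y => ⟪y, u⟫ := rfl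
  rw [h5, h4]
  simp [real_inner_comm u w]
  ring

theorem ball_inner_nhds (hx : |⟪x, y⟫ / N| < r) : ∀ᶠ z in 𝓝 y, |⟪x, z⟫ / N| < r := by
  have : ContinuousAt (fun z : Eu N => |⟪x, z⟫ / N|) y := by fun_prop
  exact this.eventually_lt continuousAt_const hx

theorem IsDisorder.inner_valueClass_valueClass (hJ : IsDisorder P J) (hN : 1 ≤ N) (hr : 1 ≤ r)
    (hb : SmoothCoeff b r) (hx : x ∈ Metric.ball (0 : Eu N) (r * √N))
    (hy : y ∈ Metric.ball (0 : Eu N) (r * √N)) :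
    ⟪valueClass P J b x, valueClass P J b y⟫ = N * mixture b (⟪x, y⟫ / N) := by
  rw [(hJ.valueClass_spec hN hr hb hy).2.2, hJ.hamiltonian_covArray_valueClass hN hr hb hx]

/-- By the reproducing property for derivatives, differentiating the covariance function replaces
any exchange of derivative and expectation. -/
theorem IsDisorder.inner_valueClass_derivClass (hJ : IsDisorder P J) (hN : 1 ≤ N) (hr : 1 < r)
    (hb : SmoothCoeff b r) (hx : x ∈ Metric.ball (0 : Eu N) (r * √N))
    (hy : y ∈ Metric.ball (0 : Eu N) (r * √N)) (hxy : |⟪x, y⟫ / N| < r) (u : Eu N) :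
    ⟪valueClass P J b x, derivClass P J b y u⟫ = mixture' b (⟪x, y⟫ / N) * ⟪x, u⟫ := by
  rw [(hJ.derivClass_spec hN hr.le hb hy u).2.2, ← hasFDerivAt_mixture_inner hr hb hN hxy u]
  congr 2
  ext z
  exact hJ.hamiltonian_covArray_valueClass hN hr.le hb hx z

theorem IsDisorder.hamiltonian_covArray_derivClass (hJ : IsDisorder P J) (hN : 1 ≤ N) (hr : 1 < r)
    (hb : SmoothCoeff b r) (hx : x ∈ Metric.ball (0 : Eu N) (r * √N))
    (hy : y ∈ Metric.ball (0 : Eu N) (r * √N)) (hxy : |⟪x, y⟫ / N| < r) (u : Eu N) :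
    hamiltonian b (covArray P J (derivClass P J b x u)) y
      = mixture' b (⟪x, y⟫ / N) * ⟪y, u⟫ := by
  rw [← (hJ.valueClass_spec hN hr.le hb hy).2.2, real_inner_comm,
    hJ.inner_valueClass_derivClass hN hr hb hy hx (by rwa [real_inner_comm]), real_inner_comm x y]

theorem IsDisorder.inner_derivClass_derivClass (hJ : IsDisorder P J) (hN : 1 ≤ N) (hr : 1 < r)
    (hb : SmoothCoeff b r) (hx : x ∈ Metric.ball (0 : Eu N) (r * √N))
    (hy : y ∈ Metric.ball (0 : Eu N) (r * √N)) (hxy : |⟪x, y⟫ / N| < r) (u w : Eu N) :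
    ⟪derivClass P J b x u, derivClass P J b y w⟫
      = mixture'' b (⟪x, y⟫ / N) * (⟪x, w⟫ * ⟪y, u⟫ / N) + mixture' b (⟪x, y⟫ / N) * ⟪w, u⟫ := by
  rw [(hJ.derivClass_spec hN hr.le hb hy w).2.2, ← fderiv_mixture'_inner hr hb hxy u w]
  congr 1
  -- The covariance formula is available only at points of the ball with bounded overlap, which form
  -- a neighbourhood of `y`.
  refine Filter.EventuallyEq.fderiv_eq ?_
  filter_upwards [ball_inner_nhds hxy, Metric.isOpen_ball.mem_nhds hy] with z hz hz'
  exact hJ.hamiltonian_covArray_derivClass hN hr hb hx hz' hz u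

/-- Linearity in the direction is checked by pairing with all `g`, where it is linearity of an
ordinary derivative. -/
theorem IsDisorder.derivClass_add (hJ : IsDisorder P J) (hN : 1 ≤ N) (hr : 1 ≤ r)
    (hb : SmoothCoeff b r) (hx : x ∈ Metric.ball (0 : Eu N) (r * √N)) (u w : Eu N) :
    derivClass P J b x (u + w) = derivClass P J b x u + derivClass P J b x w := by
  refine ext_inner_left ℝ fun g => ?_
  rw [inner_add_right]
  simp only [(hJ.derivClass_spec hN hr hb hx _).2.2, map_add]

theorem IsDisorder.derivClass_smul (hJ : IsDisorder P J) (hN : 1 ≤ N) (hr : 1 ≤ r)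
    (hb : SmoothCoeff b r) (hx : x ∈ Metric.ball (0 : Eu N) (r * √N)) (c : ℝ) (u : Eu N) :
    derivClass P J b x (c • u) = c • derivClass P J b x u := by
  refine ext_inner_left ℝ fun g => ?_
  rw [inner_smul_right]
  simp only [(hJ.derivClass_spec hN hr hb hx _).2.2, map_smul, smul_eq_mul]

theorem IsDisorder.derivClass_sub (hJ : IsDisorder P J) (hN : 1 ≤ N) (hr : 1 ≤ r)
    (hb : SmoothCoeff b r) (hx : x ∈ Metric.ball (0 : Eu N) (r * √N)) (u w : Eu N) :
    derivClass P J b x (u - w) = derivClass P J b x u - derivClass P J b x w := by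
  refine ext_inner_left ℝ fun g => ?_
  rw [inner_sub_right]
  simp only [(hJ.derivClass_spec hN hr hb hx _).2.2, map_sub]

end Pairing

/-! ### Conditioning on finitely many variables of the Gaussian space -/

section Conditioning

variable {N : ℕ} {Ω : Type u} [MeasurableSpace Ω] {P : Measure Ω} [IsProbabilityMeasure P]
  {J : DisorderIdx N → Ω → ℝ} {b : ℕ → ℝ} {r : ℝ} {x : Eu N}

/-- The random variable belongs to the Gaussian Hilbert space of the disorder. -/
def InGaussianSpace (P : Measure Ω) (J : DisorderIdx N → Ω → ℝ) (X : Ω → ℝ) : Prop :=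
  MemLp X 2 P ∧ l2Class P X ∈ gaussianSpace P J

theorem l2Class_const_mul {X : Ω → ℝ} (hX : MemLp X 2 P) (c : ℝ) :
    l2Class P (fun ω => c * X ω) = c • l2Class P X := by
  refine l2Class_eq_of_ae_eq ?_
  filter_upwards [coeFn_l2Class hX, Lp.coeFn_smul c (l2Class P X)] with ω h1 h2
  rw [h2, Pi.smul_apply, h1, smul_eq_mul]

theorem InGaussianSpace.const_mul {X : Ω → ℝ} (hX : InGaussianSpace P J X) (c : ℝ) :
    InGaussianSpace P J fun ω => c * X ω :=
  ⟨hX.1.const_mul c, by rw [l2Class_const_mul hX.1]; exact Submodule.smul_mem _ _ hX.2⟩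

theorem IsDisorder.covariance_eq_inner (hJ : IsDisorder P J) {X Y : Ω → ℝ}
    (hX : InGaussianSpace P J X) (hY : InGaussianSpace P J Y) :
    cov[X, Y; P] = ⟪l2Class P X, l2Class P Y⟫ := by
  rw [covariance_eq_sub hX.1 hY.1, inner_l2Class hX.1 hY.1,
    ← integral_congr_ae (coeFn_l2Class hX.1), hJ.integral_gaussianSpace hX.2, zero_mul, sub_zero]
  rfl

variable {ι : Type} [Fintype ι] [DecidableEq ι] {Y : ι → Ω → ℝ}

theorem IsDisorder.regCoeff_eq_projCoeff (hJ : IsDisorder P J)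
    (hY : ∀ i, InGaussianSpace P J (Y i)) {X : Ω → ℝ} (hX : InGaussianSpace P J X) :
    regCoeff P Y X = projCoeff (fun i => l2Class P (Y i)) (l2Class P X) := by
  unfold regCoeff projCoeff
  simp only [hJ.covariance_eq_inner (hY _) (hY _), hJ.covariance_eq_inner (hY _) hX]

/-- The regression coefficients of the disorder on the variables `Y i`. -/
def regArray (P : Measure Ω) (J : DisorderIdx N → Ω → ℝ) (Y : ι → Ω → ℝ) (i : ι) :
    DisorderIdx N → ℝ :=
  fun a => projCoeff (fun i => l2Class P (Y i)) (coupling P J a) i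

/-- The centered part of the disorder given the variables `Y i`. -/
def residualArray (P : Measure Ω) (J : DisorderIdx N → Ω → ℝ) (Y : ι → Ω → ℝ) :
    DisorderIdx N → Ω → ℝ :=
  fun a ω => J a ω - ∑ i, Y i ω * regArray P J Y i a

theorem regArray_eq (i : ι) : regArray P J Y i = fun a =>
    ∑ k, symmPinv (Matrix.of fun i k => ⟪l2Class P (Y i), l2Class P (Y k)⟫) i k
      * covArray P J (l2Class P (Y k)) a := rfl

theorem IsDisorder.tameArray_regArray (hJ : IsDisorder P J) (hN : 1 ≤ N) (i : ι) :
    TameArray (regArray P J Y i) := by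
  rw [regArray_eq]
  exact TameArray.sum _ fun k _ => (hJ.tameArray_covArray hN _).smul _

theorem IsDisorder.inGaussianSpace_hamiltonian (hJ : IsDisorder P J) (hN : 1 ≤ N) (hr : 1 ≤ r)
    (hb : SmoothCoeff b r) (hx : x ∈ Metric.ball (0 : Eu N) (r * √N)) :
    InGaussianSpace P J fun ω => hamiltonian b (fun a => J a ω) x :=
  let h := hJ.valueClass_spec hN hr hb hx
  ⟨h.1, h.2.1⟩

/-- Regression commutes with the linear map from arrays to Hamiltonians. The coefficients `b` here
are free of those that define the conditioned variables `Y`, as the truncated fields require. -/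
theorem IsDisorder.regCoeff_hamiltonian (hJ : IsDisorder P J) (hN : 1 ≤ N) (hr : 1 ≤ r)
    (hb : SmoothCoeff b r) (hx : x ∈ Metric.ball (0 : Eu N) (r * √N))
    (hY : ∀ i, InGaussianSpace P J (Y i)) (i : ι) :
    regCoeff P Y (fun ω => hamiltonian b (fun a => J a ω) x) i
      = hamiltonian b (regArray P J Y i) x := by
  rw [hJ.regCoeff_eq_projCoeff hY (hJ.inGaussianSpace_hamiltonian hN hr hb hx), regArray_eq,
    hamiltonian_array_sum _ hN hr hb (fun k => (hJ.tameArray_covArray hN _).smul _) hx]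
  simp only [projCoeff, Matrix.mulVec, dotProduct, hamiltonian_array_smul]
  refine Finset.sum_congr rfl fun k _ => ?_
  rw [← (hJ.valueClass_spec hN hr hb hx).2.2]
  rfl

theorem IsDisorder.tameArray_residual (hJ : IsDisorder P J) (hN : 1 ≤ N) {ω : Ω}
    (hω : TameArray fun a => J a ω) : TameArray fun a => residualArray P J Y a ω :=
  hω.sub (TameArray.sum _ fun i _ => (hJ.tameArray_regArray hN i).smul _)

theorem IsDisorder.condCentered_hamiltonian (hJ : IsDisorder P J) (hN : 1 ≤ N) (hr : 1 ≤ r)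
    (hb : SmoothCoeff b r) (hx : x ∈ Metric.ball (0 : Eu N) (r * √N))
    (hY : ∀ i, InGaussianSpace P J (Y i)) {ω : Ω} (hω : TameArray fun a => J a ω) :
    condCentered P Y (fun ω => hamiltonian b (fun a => J a ω) x) ω
      = hamiltonian b (fun a => residualArray P J Y a ω) x := by
  unfold residualArray
  rw [hamiltonian_array_sub hN hr hb hω
    (TameArray.sum _ fun i _ => (hJ.tameArray_regArray hN i).smul _) hx,
    hamiltonian_array_sum _ hN hr hb (fun i => (hJ.tameArray_regArray hN i).smul _) hx]
  simp only [condCentered, condMean, dotProduct, hJ.regCoeff_hamiltonian hN hr hb hx hY,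
    hamiltonian_array_smul, mul_comm]

/-- The linear span in `L²` of the variables `Y i`. -/
def condSpan (P : Measure Ω) (Y : ι → Ω → ℝ) : Submodule ℝ (Lp ℝ 2 P) :=
  regSpan fun i => l2Class P (Y i)

instance (P : Measure Ω) (Y : ι → Ω → ℝ) : FiniteDimensional ℝ (condSpan P Y) :=
  inferInstanceAs (FiniteDimensional ℝ (regSpan _))

theorem condSpan_le (hY : ∀ i, InGaussianSpace P J (Y i)) : condSpan P Y ≤ gaussianSpace P J := by
  refine Submodule.span_le.2 ?_
  rintro _ ⟨i, rfl⟩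
  exact (hY i).2

theorem IsDisorder.residual_ae_eq (hJ : IsDisorder P J) (hY : ∀ i, InGaussianSpace P J (Y i))
    (a : DisorderIdx N) : residualArray P J Y a
      =ᵐ[P] (coupling P J a - (condSpan P Y).starProjection (coupling P J a) : Lp ℝ 2 P) := by
  have h1 : (condSpan P Y).starProjection (coupling P J a)
      = ∑ i, regArray P J Y i a • l2Class P (Y i) := (sum_projCoeff_smul _ _).symm
  have h2 : ∀ᵐ ω ∂P, ∀ i, l2Class P (Y i) ω = Y i ω :=
    ae_all_iff.2 fun i => coeFn_l2Class (hY i).1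
  rw [h1]
  filter_upwards [h2, coeFn_l2Class (hJ.memLp a),
    Lp.coeFn_sub (coupling P J a) (∑ i, regArray P J Y i a • l2Class P (Y i)),
    coeFn_finset_sum_smul Finset.univ (fun i => regArray P J Y i a) fun i => l2Class P (Y i)]
    with ω h2 h3 h4 h5
  rw [h4, Pi.sub_apply, h5, coupling, h3, residualArray]
  simp only [h2, mul_comm]

/-- The residual array is the image of the couplings under the projection orthogonal to the
conditioned variables. This is a contraction, and it preserves the Gaussian space because these
variables lie in it. -/
theorem IsDisorder.subgaussianArray_residual (hJ : IsDisorder P J)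
    (hY : ∀ i, InGaussianSpace P J (Y i)) : SubgaussianArray P (residualArray P J Y) := by
  refine hJ.subgaussianArray (condSpan P Y)ᗮ.starProjection
    (fun g => ((condSpan P Y)ᗮ.starProjection.le_opNorm g).trans
      (mul_le_of_le_one_left (norm_nonneg g) (Submodule.starProjection_norm_le _))) (fun g hg => ?_) fun a => ?_
  · rw [Submodule.starProjection_orthogonal_val]
    exact Submodule.sub_mem _ hg (condSpan_le hY (Submodule.starProjection_apply_mem _ g))
  · rw [Submodule.starProjection_orthogonal_val]
    exact hJ.residual_ae_eq hY a

/-- The conditional mean of the Hamiltonian, given values that are the covariances with `g`. -/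
theorem IsDisorder.condMean_hamiltonian (hJ : IsDisorder P J) (hN : 1 ≤ N) (hr : 1 ≤ r)
    (hb : SmoothCoeff b r) (hx : x ∈ Metric.ball (0 : Eu N) (r * √N))
    (hY : ∀ i, InGaussianSpace P J (Y i)) {v : ι → ℝ} {g : Lp ℝ 2 P}
    (hg : ∀ i, ⟪l2Class P (Y i), g⟫ = v i) (hgW : g ∈ condSpan P Y) :
    condMean P Y v (fun ω => hamiltonian b (fun a => J a ω) x)
      = hamiltonian b (covArray P J g) x := by
  rw [condMean, hJ.regCoeff_eq_projCoeff hY (hJ.inGaussianSpace_hamiltonian hN hr hb hx),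
    ← funext hg, projCoeff_dotProduct]
  have : (regSpan fun i => l2Class P (Y i)).starProjection g = g :=
    Submodule.starProjection_eq_self_iff.2 hgW
  rw [this]
  exact (hJ.valueClass_spec hN hr hb hx).2.2 g

/-- The Hessian of a centered part of the Hamiltonian is bounded up to an exponentially small
probability. -/
theorem IsDisorder.measure_hessSup_residual_le (hJ : IsDisorder P J) (hN : 1 ≤ N) (hr : 1 ≤ r)
    (hb : SmoothCoeff b r) (hY : ∀ i, InGaussianSpace P J (Y i)) {f : Eu N → Ω → ℝ}
    (hf : ∀ ω, (TameArray fun a => J a ω) → ∀ x ∈ Metric.ball (0 : Eu N) (r * √N),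
      f x ω = hamiltonian b (fun a => residualArray P J Y a ω) x)
    {κ : ℝ≥0} (hκ : 7 * coeffSum b r < κ) :
    P {ω | (κ : ℝ≥0∞) ≤ hessSup r fun x => f x ω}
      ≤ ENNReal.ofReal (tailConst * Real.exp (-(N : ℝ))) := by
  refine le_trans (measure_mono_ae ?_)
    (measure_exists_tensorSize_gt_le hN (hJ.subgaussianArray_residual hY))
  filter_upwards [hJ.ae_tameArray hN] with ω hω hκω
  change ∃ p : ℕ, 2 ≤ p ∧ _
  by_contra! hcon
  -- Off the exceptional event the sizes are at most `7 p`, hence at most `7 (p + 1)`, which is the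
  -- form of the smoothness criterion.
  have h1 := hessSup_le_of_eqOn_hamiltonian (C := 7) hN hr hb
    (j := fun a => residualArray P J Y a ω)
    (fun p hp => (hcon p hp).trans (by linarith)) (hf ω hω)
  have h2 : (κ : ℝ≥0∞) ≤ ENNReal.ofReal (7 * coeffSum b r) := le_trans hκω h1
  rw [← ENNReal.ofReal_coe_nnreal, ENNReal.ofReal_le_ofReal_iff
    (mul_nonneg (by norm_num) (coeffSum_nonneg b (by linarith)))] at h2
  linarith

end Conditioning

/-! ### The variables conditioned upon -/

section Config

variable {N : ℕ} {Ω : Type u} [MeasurableSpace Ω] {P : Measure Ω} [IsProbabilityMeasure P]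
  {J : DisorderIdx N → Ω → ℝ} {b : ℕ → ℝ} {r q : ℝ}

theorem Config.x0_mem (c : Config N q) (hN : 1 ≤ N) (hr : 1 < r) :
    c.x0 ∈ Metric.ball (0 : Eu N) (r * √N) := by
  have hs : 0 < √(N : ℝ) := Real.sqrt_pos.2 (by exact_mod_cast hN)
  rw [mem_ball_zero_iff, c.norm_x0]
  nlinarith

theorem Config.xs_mem (c : Config N q) (hN : 1 ≤ N) (hr : 1 < r) (hq1 : q ≤ 1) :
    c.xs ∈ Metric.ball (0 : Eu N) (r * √N) := by
  have hs : 0 < √(N : ℝ) := Real.sqrt_pos.2 (by exact_mod_cast hN)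
  rw [mem_ball_zero_iff, c.norm_xs]
  nlinarith

theorem gradient_apply (f : Eu N → ℝ) (x : Eu N) (i : Fin N) :
    gradient f x i = fderiv ℝ f x (EuclideanSpace.single i 1) := by
  have h : gradient f x i = ⟪gradient f x, EuclideanSpace.single i 1⟫ := by
    rw [EuclideanSpace.inner_single_right]; simp
  rw [h, gradient, InnerProductSpace.toDual_symm_apply]

theorem starProjection_gradient_apply (K : Submodule ℝ (Eu N)) (f : Eu N → ℝ) (x : Eu N)
    (i : Fin N) : K.starProjection (gradient f x) i
      = fderiv ℝ f x (K.starProjection (EuclideanSpace.single i 1)) := by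
  have h : K.starProjection (gradient f x) i
      = ⟪K.starProjection (gradient f x), EuclideanSpace.single i 1⟫ := by
    rw [EuclideanSpace.inner_single_right]; simp
  rw [h, Submodule.inner_starProjection_left_eq_right, gradient,
    InnerProductSpace.toDual_symm_apply]

theorem IsDisorder.inGaussianSpace_deriv (hJ : IsDisorder P J) (hN : 1 ≤ N) (hr : 1 ≤ r)
    (hb : SmoothCoeff b r) {x : Eu N} (hx : x ∈ Metric.ball (0 : Eu N) (r * √N)) (u : Eu N) :
    InGaussianSpace P J fun ω => fderiv ℝ (hamiltonian b fun a => J a ω) x u :=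
  let h := hJ.derivClass_spec hN hr hb hx u
  ⟨h.1, h.2.1⟩

theorem IsDisorder.condVec_spec (hJ : IsDisorder P J) (hN : 1 ≤ N) (hr : 1 < r)
    (hb : SmoothCoeff b r) (hq1 : q ≤ 1) (c : Config N q) :
    (∀ i, InGaussianSpace P J (condVec b J c i)) ∧
    l2Class P (condVec b J c (.inl 0)) = (-(N : ℝ)⁻¹) • valueClass P J b c.x0 ∧
    l2Class P (condVec b J c (.inl 1)) = (-(N : ℝ)⁻¹) • valueClass P J b c.xs ∧
    ∀ i : Fin N, l2Class P (condVec b J c (.inr i))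
      = (-1 : ℝ) • derivClass P J b c.xs (EuclideanSpace.single i 1) := by
  have hx0 := c.x0_mem hN hr
  have hxs := c.xs_mem hN hr hq1
  have e0 : condVec b J c (.inl 0)
      = fun ω => (-(N : ℝ)⁻¹) * hamiltonian b (fun a => J a ω) c.x0 := by
    ext ω; simp only [condVec]; ring
  have e1 : condVec b J c (.inl 1)
      = fun ω => (-(N : ℝ)⁻¹) * hamiltonian b (fun a => J a ω) c.xs := by
    ext ω; simp only [condVec]; ring
  have e2 : ∀ i, condVec b J c (.inr i) = fun ω =>
      (-1 : ℝ) * fderiv ℝ (hamiltonian b fun a => J a ω) c.xs (EuclideanSpace.single i 1) :=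
    fun i => by ext ω; simp only [condVec, gradient_apply]; ring
  have i0 := hJ.inGaussianSpace_hamiltonian hN hr.le hb hx0
  have i1 := hJ.inGaussianSpace_hamiltonian hN hr.le hb hxs
  have i2 := hJ.inGaussianSpace_deriv hN hr.le hb hxs
  refine ⟨?_, ?_, ?_, fun i => ?_⟩
  · rintro (i | i)
    · fin_cases i
      · exact e0 ▸ i0.const_mul _
      · exact e1 ▸ i1.const_mul _
    · exact e2 i ▸ (i2 _).const_mul _
  · rw [e0]; exact l2Class_const_mul i0.1 _
  · rw [e1]; exact l2Class_const_mul i1.1 _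
  · rw [e2]; exact l2Class_const_mul (i2 _).1 _

theorem IsDisorder.sphGradVec_spec (hJ : IsDisorder P J) (hN : 1 ≤ N) (hr : 1 < r)
    (hb : SmoothCoeff b r) (hq1 : q ≤ 1) (c : Config N q) (i : Fin N) :
    InGaussianSpace P J (sphGradVec b J c i) ∧
    l2Class P (sphGradVec b J c i) = derivClass P J b c.xs
      ((Submodule.span ℝ {c.xs})ᗮ.starProjection (EuclideanSpace.single i 1)) := by
  have e : sphGradVec b J c i = fun ω => fderiv ℝ (hamiltonian b fun a => J a ω) c.xs
      ((Submodule.span ℝ {c.xs})ᗮ.starProjection (EuclideanSpace.single i 1)) := by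
    ext ω; exact starProjection_gradient_apply _ _ _ _
  rw [e]
  exact ⟨hJ.inGaussianSpace_deriv hN hr.le hb (c.xs_mem hN hr hq1) _, rfl⟩

theorem eu_eq_sum (u : Eu N) : u = ∑ i, u i • (EuclideanSpace.single i 1 : Eu N) := by
  ext k
  simp [Finset.sum_apply, Pi.single_apply]

theorem IsDisorder.derivClass_eq_sum (hJ : IsDisorder P J) (hN : 1 ≤ N) (hr : 1 ≤ r)
    (hb : SmoothCoeff b r) {x : Eu N} (hx : x ∈ Metric.ball (0 : Eu N) (r * √N)) (u : Eu N) :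
    derivClass P J b x u = ∑ i, u i • derivClass P J b x (EuclideanSpace.single i 1) := by
  refine ext_inner_left ℝ fun g => ?_
  rw [inner_sum]
  simp only [inner_smul_right, (hJ.derivClass_spec hN hr hb hx _).2.2]
  conv_lhs => rw [eu_eq_sum u]
  simp

theorem IsDisorder.mem_condSpan (hJ : IsDisorder P J) (hN : 1 ≤ N) (hr : 1 < r)
    (hb : SmoothCoeff b r) (hq1 : q ≤ 1) (c : Config N q) :
    valueClass P J b c.x0 ∈ condSpan P (condVec b J c) ∧
    valueClass P J b c.xs ∈ condSpan P (condVec b J c) ∧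
    ∀ u, derivClass P J b c.xs u ∈ condSpan P (condVec b J c) := by
  have hN' : (-(N : ℝ)⁻¹) ≠ 0 := by
    have : (0 : ℝ) < N := by exact_mod_cast hN
    exact neg_ne_zero.2 (inv_ne_zero this.ne')
  obtain ⟨-, h0, h1, h2⟩ := hJ.condVec_spec hN hr hb hq1 c
  have hm : ∀ i, l2Class P (condVec b J c i) ∈ condSpan P (condVec b J c) := fun i =>
    mem_regSpan (fun i => l2Class P (condVec b J c i)) i
  refine ⟨?_, ?_, fun u => ?_⟩
  · have := hm (.inl 0)
    rw [h0] at this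
    exact (Submodule.smul_mem_iff _ hN').1 this
  · have := hm (.inl 1)
    rw [h1] at this
    exact (Submodule.smul_mem_iff _ hN').1 this
  · rw [hJ.derivClass_eq_sum hN hr.le hb (c.xs_mem hN hr hq1)]
    refine Submodule.sum_mem _ fun i _ => Submodule.smul_mem _ _ ?_
    have := hm (.inr i)
    rw [h2] at this
    exact (Submodule.smul_mem_iff _ (by norm_num)).1 this

end Config

/-! ### The effect of finitely many additional conditionings -/

section Difference

variable {E : Type*} [NormedAddCommGroup E] [InnerProductSpace ℝ E]

/-- Projecting orthogonally to `W₀` kills the `W₀` part of a decomposition and fixes `W₀ᗮ`, so the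
subspace lies in the image of `S`. -/
theorem finrank_inf_orthogonal_le (W W₀ S : Submodule ℝ E) [FiniteDimensional ℝ W₀]
    [FiniteDimensional ℝ S] (h : W ≤ W₀ ⊔ S) :
    Module.finrank ℝ (W ⊓ W₀ᗮ : Submodule ℝ E) ≤ Module.finrank ℝ S := by
  have h1 : W ⊓ W₀ᗮ ≤ S.map (W₀ᗮ.starProjection : E →ₗ[ℝ] E) := by
    rintro z ⟨hz, hz0⟩
    obtain ⟨w, hw, s, hs, rfl⟩ := Submodule.mem_sup.1 (h hz)
    refine ⟨s, hs, ?_⟩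
    have h2 : W₀ᗮ.starProjection (w + s) = w + s := Submodule.starProjection_eq_self_iff.2 hz0
    rw [map_add] at h2
    have h3 : W₀ᗮ.starProjection w = 0 := by
      rw [Submodule.starProjection_orthogonal_val, Submodule.starProjection_eq_self_iff.2 hw,
        sub_self]
    rw [h3, zero_add] at h2
    exact h2
  exact (Submodule.finrank_mono h1).trans (Submodule.finrank_map_le _ _)

/-- The difference of the projections on nested subspaces is the projection on `W ⊓ W₀ᗮ`, expanded
here in an orthonormal basis. -/
theorem exists_orthonormal_starProjection_sub (W W₀ S : Submodule ℝ E) [FiniteDimensional ℝ W]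
    [FiniteDimensional ℝ W₀] [FiniteDimensional ℝ S] (h0 : W₀ ≤ W) (h : W ≤ W₀ ⊔ S) :
    ∃ (d : ℕ) (e : Fin d → E), d ≤ Module.finrank ℝ S ∧ (∀ k, e k ∈ W) ∧ (∀ k, ‖e k‖ = 1) ∧
      ∀ x, W.starProjection x - W₀.starProjection x = ∑ k, ⟪e k, x⟫ • e k := by
  set U : Submodule ℝ E := W ⊓ W₀ᗮ
  have : FiniteDimensional ℝ U := Submodule.finiteDimensional_inf_left W W₀ᗮ
  have B := stdOrthonormalBasis ℝ U
  refine ⟨_, fun k => (B k : E), finrank_inf_orthogonal_le W W₀ S h, fun k => (B k).2.1,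
    fun k => B.orthonormal.1 k, fun x => ?_⟩
  set z := W.starProjection x - W₀.starProjection x with hz
  have hzU : z ∈ U := by
    refine ⟨W.sub_mem (Submodule.starProjection_apply_mem W x)
      (h0 (Submodule.starProjection_apply_mem W₀ x)), ?_⟩
    refine (Submodule.mem_orthogonal _ _).2 fun w hw => ?_
    rw [hz, inner_sub_right, ← Submodule.inner_starProjection_left_eq_right,
      ← Submodule.inner_starProjection_left_eq_right, Submodule.starProjection_eq_self_iff.2 hw,
      Submodule.starProjection_eq_self_iff.2 (h0 hw), sub_self]
  have h1 := B.sum_repr' ⟨z, hzU⟩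
  have h2 := congrArg (Subtype.val : U → E) h1
  simp only [Submodule.coe_sum, Submodule.coe_smul, Submodule.coe_inner] at h2
  rw [← h2]
  refine Finset.sum_congr rfl fun k _ => ?_
  congr 1
  have h3 : ⟪(B k : E), W₀.starProjection x⟫ = 0 := by
    rw [real_inner_comm]
    exact (Submodule.mem_orthogonal _ _).1 (B k).2.2 _ (Submodule.starProjection_apply_mem W₀ x)
  rw [hz, inner_sub_right, h3, sub_zero, ← Submodule.inner_starProjection_left_eq_right,
    Submodule.starProjection_eq_self_iff.2 (B k).2.1]

end Difference

/-! ### Comparison of the two centered fields -/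

section Coupling

variable {N : ℕ} {Ω : Type u} [MeasurableSpace Ω] {P : Measure Ω} [IsProbabilityMeasure P]
  {J : DisorderIdx N → Ω → ℝ} {b : ℕ → ℝ} {r q : ℝ}

theorem IsDisorder.condSpan_sphGradVec_le (hJ : IsDisorder P J) (hN : 1 ≤ N) (hr : 1 < r)
    (hb : SmoothCoeff b r) (hq1 : q ≤ 1) (c : Config N q) :
    condSpan P (sphGradVec b J c) ≤ condSpan P (condVec b J c) := by
  refine Submodule.span_le.2 ?_
  rintro _ ⟨i, rfl⟩
  simp only [(hJ.sphGradVec_spec hN hr hb hq1 c i).2]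
  exact (hJ.mem_condSpan hN hr hb hq1 c).2.2 _

/-- Beyond the spherical gradient, only the two values and the radial derivative are conditioned
upon, hence three extra dimensions. -/
theorem IsDisorder.condSpan_condVec_le (hJ : IsDisorder P J) (hN : 1 ≤ N) (hr : 1 < r)
    (hb : SmoothCoeff b r) (hq1 : q ≤ 1) (c : Config N q) :
    condSpan P (condVec b J c) ≤ condSpan P (sphGradVec b J c) ⊔
      regSpan ![valueClass P J b c.x0, valueClass P J b c.xs, derivClass P J b c.xs c.xs] := by
  set S := regSpan ![valueClass P J b c.x0, valueClass P J b c.xs, derivClass P J b c.xs c.xs]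
  have hxs := c.xs_mem hN hr hq1
  have hS : ∀ k, ![valueClass P J b c.x0, valueClass P J b c.xs, derivClass P J b c.xs c.xs] k ∈ S :=
    fun k => mem_regSpan _ k
  obtain ⟨-, h0, h1, h2⟩ := hJ.condVec_spec hN hr hb hq1 c
  refine Submodule.span_le.2 ?_
  rintro _ ⟨i, rfl⟩
  rcases i with i | i
  · fin_cases i
    · change l2Class P (condVec b J c (.inl 0)) ∈ _
      rw [h0]
      exact Submodule.mem_sup_right (Submodule.smul_mem _ _ (hS 0))
    · change l2Class P (condVec b J c (.inl 1)) ∈ _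
      rw [h1]
      exact Submodule.mem_sup_right (Submodule.smul_mem _ _ (hS 1))
  · change l2Class P (condVec b J c (.inr i)) ∈ _
    rw [h2]
    refine Submodule.smul_mem _ _ ?_
    set L := Submodule.span ℝ {c.xs}
    obtain ⟨t, ht⟩ := Submodule.mem_span_singleton.1
      (Submodule.starProjection_apply_mem L (EuclideanSpace.single i (1 : ℝ)))
    have hsplit : (EuclideanSpace.single i 1 : Eu N)
        = Lᗮ.starProjection (EuclideanSpace.single i 1) + t • c.xs := by
      rw [ht, Submodule.starProjection_orthogonal_val, sub_add_cancel]
    rw [hsplit, hJ.derivClass_add hN hr.le hb hxs, hJ.derivClass_smul hN hr.le hb hxs]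
    refine Submodule.add_mem_sup ?_ (Submodule.smul_mem _ _ (hS 2))
    rw [← (hJ.sphGradVec_spec hN hr hb hq1 c i).2]
    exact mem_regSpan (fun i => l2Class P (sphGradVec b J c i)) i

/-- The residual arrays differ by a combination of covariance arrays of at most three orthonormal `e
k`, with random coefficients `-e k ω`. The dimension count is the only geometric input, so the bound
holds at every overlap. -/
theorem IsDisorder.measure_hessSup_fieldZero_sub_fieldO_le (hJ : IsDisorder P J) (hN : 1 ≤ N)
    (hr : 1 < r) (hb : SmoothCoeff b r) (hq1 : q ≤ 1) (c : Config N q) {δ : ℝ} (hδ : 0 < δ) :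
    P {ω | ENNReal.ofReal (2 * δ) ≤
        hessSup r fun x => fieldZero P J b b c x ω - fieldO P J b c x ω}
      ≤ ENNReal.ofReal (6 * Real.exp (-(2 * δ ^ 2 / (9 * (coeffSum b r + 1) ^ 2)) * N)) := by
  have hN' : (0 : ℝ) < N := by exact_mod_cast hN
  have hs : 0 < √(N : ℝ) := Real.sqrt_pos.2 hN'
  have hS : 0 ≤ coeffSum b r := coeffSum_nonneg b (by linarith)
  obtain ⟨d, e, hd, heW, he1, he⟩ := exists_orthonormal_starProjection_sub
    (condSpan P (condVec b J c)) (condSpan P (sphGradVec b J c)) _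
    (hJ.condSpan_sphGradVec_le hN hr hb hq1 c) (hJ.condSpan_condVec_le hN hr hb hq1 c)
  have hd3 : d ≤ 3 := hd.trans ((finrank_range_le_card _).trans (by simp))
  have hY := (hJ.condVec_spec hN hr hb hq1 c).1
  have hY' := fun i => (hJ.sphGradVec_spec hN hr hb hq1 c i).1
  -- Three terms of size `ε`, divided by `√N` and multiplied by `coeffSum b r + 1`, make exactly `2
  -- * δ`. The `+ 1` makes the final contradiction strict and keeps the denominator positive.
  set ε : ℝ := 2 * δ * √N / (3 * (coeffSum b r + 1)) with hε
  have hεpos : 0 < ε := by positivity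
  have hdiff : ∀ᵐ ω ∂P, ∀ a, residualArray P J (condVec b J c) a ω
      - residualArray P J (sphGradVec b J c) a ω = ∑ k, (-e k ω) * covArray P J (e k) a := by
    refine ae_all_iff.2 fun a => ?_
    have h1 := he (coupling P J a)
    filter_upwards [hJ.residual_ae_eq hY a, hJ.residual_ae_eq hY' a,
      Lp.coeFn_sub (coupling P J a) ((condSpan P (condVec b J c)).starProjection (coupling P J a)),
      Lp.coeFn_sub (coupling P J a)
        ((condSpan P (sphGradVec b J c)).starProjection (coupling P J a)),
      Lp.coeFn_sub ((condSpan P (condVec b J c)).starProjection (coupling P J a))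
        ((condSpan P (sphGradVec b J c)).starProjection (coupling P J a)),
      coeFn_finset_sum_smul Finset.univ (fun k => ⟪e k, coupling P J a⟫) e]
      with ω h2 h3 h4 h5 h6 h7
    rw [h1] at h6
    rw [h7] at h6
    rw [h2, h3, h4, h5]
    simp only [Pi.sub_apply] at h6 ⊢
    have h8 : ∑ k, (-e k ω) * covArray P J (e k) a = -∑ k, ⟪e k, coupling P J a⟫ * e k ω := by
      rw [← Finset.sum_neg_distrib]
      exact Finset.sum_congr rfl fun k _ => by rw [covArray]; ring
    rw [h8, h6]
    ring
  have hsub : P {ω | ENNReal.ofReal (2 * δ) ≤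
        hessSup r fun x => fieldZero P J b b c x ω - fieldO P J b c x ω}
      ≤ P (⋃ k ∈ (Finset.univ : Finset (Fin d)), {ω | ε ≤ |e k ω|}) := by
    refine measure_mono_ae ?_
    filter_upwards [hdiff, hJ.ae_tameArray hN] with ω h1 h2 h3
    change ω ∈ ⋃ k ∈ (Finset.univ : Finset (Fin d)), {ω | ε ≤ |e k ω|}
    by_contra hcon
    simp only [Finset.mem_univ, Set.iUnion_true, Set.mem_iUnion, not_exists] at hcon
    have hcon' : ∀ k, |e k ω| ≤ ε := fun k => by
      have := hcon k
      simp only [Set.mem_ofPred_eq, not_le] at this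
      exact this.le
    have hcon'' : ∀ k, |e k ω| < ε := fun k => by
      have := hcon k
      simpa only [Set.mem_ofPred_eq, not_le] using this
    -- At a fixed `ω` the difference is the deterministic covariance array of this element, so the
    -- Cauchy–Schwarz bound on its tensors applies.
    set g : Lp ℝ 2 P := ∑ k, (-e k ω) • e k with hg
    have hgn : ‖g‖ ≤ 3 * ε := by
      calc ‖g‖ ≤ ∑ k, ‖(-e k ω) • e k‖ := norm_sum_le _ _
        _ ≤ ∑ _k : Fin d, ε := Finset.sum_le_sum fun k _ => by
            rw [norm_smul, he1, mul_one, norm_neg]; exact hcon' k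
        _ = d * ε := by simp
        _ ≤ 3 * ε := by gcongr; exact_mod_cast hd3
    have harr : (fun a => residualArray P J (condVec b J c) a ω
        - residualArray P J (sphGradVec b J c) a ω) = covArray P J g := by
      ext a
      rw [h1, hg, covArray, sum_inner]
      exact Finset.sum_congr rfl fun k _ => by rw [inner_smul_left]; rfl
    have hf : ∀ x ∈ Metric.ball (0 : Eu N) (r * √N),
        fieldZero P J b b c x ω - fieldO P J b c x ω = hamiltonian b (covArray P J g) x :=
      fun x hx => by
        rw [← harr, hamiltonian_array_sub hN hr.le hb (hJ.tameArray_residual hN h2)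
          (hJ.tameArray_residual hN h2) hx, ← hJ.condCentered_hamiltonian hN hr.le hb hx hY h2,
          ← hJ.condCentered_hamiltonian hN hr.le hb hx hY' h2]
        rfl
    have h4 := hessSup_le_of_eqOn_hamiltonian hN hr.le hb
      (fun p hp => hJ.tensorSize_covArray_le hN g hp) hf
    have h5 : ENNReal.ofReal (2 * δ) ≤ ENNReal.ofReal (‖g‖ / √N * coeffSum b r) := le_trans h3 h4
    rw [ENNReal.ofReal_le_ofReal_iff (by positivity)] at h5
    have h6 : ‖g‖ / √N * coeffSum b r ≤ 3 * ε / √N * coeffSum b r := by gcongr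
    have h7 : 3 * ε / √N * (coeffSum b r + 1) = 2 * δ := by
      rw [hε]; field_simp
    have h8 : 0 < 3 * ε / √(N : ℝ) := by positivity
    nlinarith
  have hone : ∀ k ∈ (Finset.univ : Finset (Fin d)), P {ω | ε ≤ |e k ω|}
      ≤ ENNReal.ofReal (2 * Real.exp (-ε ^ 2 / (2 * 1))) := fun k _ =>
    measure_abs_ge_le (hJ.gaussianTail (condSpan_le hY (heW k))).hasSubgaussianMGF
      (by simp [he1]) hεpos
  refine hsub.trans ((measure_biUnion_finset_le _ _).trans ((Finset.sum_le_sum hone).trans ?_))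
  rw [Finset.sum_const, nsmul_eq_mul, Finset.card_univ, Fintype.card_fin,
    ← ENNReal.ofReal_natCast, ← ENNReal.ofReal_mul (Nat.cast_nonneg _)]
  refine ENNReal.ofReal_le_ofReal ?_
  have hexp : -ε ^ 2 / (2 * 1) = -(2 * δ ^ 2 / (9 * (coeffSum b r + 1) ^ 2)) * N := by
    rw [hε, div_pow, mul_pow, Real.sq_sqrt hN'.le]
    field_simp
    ring
  rw [hexp]
  have : (d : ℝ) ≤ 3 := by exact_mod_cast hd3
  have := Real.exp_pos (-(2 * δ ^ 2 / (9 * (coeffSum b r + 1) ^ 2)) * N)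
  nlinarith

end Coupling

/-! ### The covariance matrix of the conditioned variables in the plane of `x₀` and `x⋆` -/

/-- The coordinate of `x₀ / √N` orthogonal to `x⋆`, at overlap `s`. -/
def sinCoord (q s : ℝ) : ℝ := √(1 - (s / q) ^ 2)

/-- The covariances, divided by `N`, of `H(x₀)`, `H(x⋆)`, the derivative of `H` at `x⋆` along `x⋆`
and `√N` times its derivative along the second axis. -/
def covMatrix (b : ℕ → ℝ) (q s : ℝ) : Matrix (Fin 4) (Fin 4) ℝ :=
  !![mixture b 1, mixture b s, s * mixture' b s, sinCoord q s * mixture' b s;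
     mixture b s, mixture b (q ^ 2), q ^ 2 * mixture' b (q ^ 2), 0;
     s * mixture' b s, q ^ 2 * mixture' b (q ^ 2),
       q ^ 4 * mixture'' b (q ^ 2) + q ^ 2 * mixture' b (q ^ 2), 0;
     sinCoord q s * mixture' b s, 0, 0, mixture' b (q ^ 2)]

/-- The left-hand side decreases in `k`, and equality holds at `k = 0`. It is used with `u = (s / q)
^ 2`, where `1 - u` is the square of `sinCoord q s`. -/
theorem pow_add_mul_pow_le {u : ℝ} (h0 : 0 ≤ u) (k : ℕ) :
    u ^ (k + 2) + (k + 2) * u ^ (k + 1) * (1 - u) ≤ 1 - (1 - u) ^ 2 := by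
  induction k with
  | zero => simp; nlinarith
  | succ k ih =>
    refine le_trans ?_ ih
    have e : u ^ (k + 2) + (k + 2) * u ^ (k + 1) * (1 - u)
        - (u ^ (k + 1 + 2) + ((k + 1 : ℕ) + 2) * u ^ (k + 1 + 1) * (1 - u))
        = (k + 2) * (1 - u) ^ 2 * u ^ (k + 1) := by
      push_cast; ring
    have : 0 ≤ ((k : ℝ) + 2) * (1 - u) ^ 2 * u ^ (k + 1) := by positivity
    linarith

section Invertible

variable {b : ℕ → ℝ} {r q s : ℝ}

/-- The term of degree `p` of the quadratic form of the covariance matrix. -/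
def covTerm (q s : ℝ) (v : Fin 4 → ℝ) (p : ℕ) : ℝ :=
  v 0 ^ 2 * 1 ^ p + 2 * v 0 * v 1 * s ^ p + 2 * v 0 * v 2 * s * (p * s ^ (p - 1))
    + 2 * v 0 * v 3 * sinCoord q s * (p * s ^ (p - 1)) + v 1 ^ 2 * (q ^ 2) ^ p
    + 2 * v 1 * v 2 * q ^ 2 * (p * (q ^ 2) ^ (p - 1))
    + v 2 ^ 2 * q ^ 4 * (p * ((p - 1 : ℕ) * (q ^ 2) ^ (p - 1 - 1)))
    + (v 2 ^ 2 * q ^ 2 + v 3 ^ 2) * (p * (q ^ 2) ^ (p - 1))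

theorem hasSum_covTerm (hr : 1 < r) (hb : SmoothCoeff b r) (hq0 : 0 < q) (hq1 : q ≤ 1)
    (hs : |s| ≤ q) (v : Fin 4 → ℝ) :
    HasSum (fun p => b p ^ 2 * covTerm q s v p) (v ⬝ᵥ (covMatrix b q s).mulVec v) := by
  have h1 : |(1 : ℝ)| ≤ r := by simp [hr.le]
  have hs' : |s| ≤ r := by linarith
  have hq' : |q ^ 2| ≤ r := by
    rw [abs_of_nonneg (sq_nonneg q)]; nlinarith
  have key := ((((((((hasSum_mixture hr hb h1).mul_left (v 0 ^ 2)).add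
    ((hasSum_mixture hr hb hs').mul_left (2 * v 0 * v 1))).add
    ((hasSum_mixture' hr hb hs').mul_left (2 * v 0 * v 2 * s))).add
    ((hasSum_mixture' hr hb hs').mul_left (2 * v 0 * v 3 * sinCoord q s))).add
    ((hasSum_mixture hr hb hq').mul_left (v 1 ^ 2))).add
    ((hasSum_mixture' hr hb hq').mul_left (2 * v 1 * v 2 * q ^ 2))).add
    ((hasSum_mixture'' hr hb hq').mul_left (v 2 ^ 2 * q ^ 4))).add
    ((hasSum_mixture' hr hb hq').mul_left (v 2 ^ 2 * q ^ 2 + v 3 ^ 2))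
  have e1 : v ⬝ᵥ (covMatrix b q s).mulVec v = v 0 ^ 2 * mixture b 1 + 2 * v 0 * v 1 * mixture b s
      + 2 * v 0 * v 2 * s * mixture' b s + 2 * v 0 * v 3 * sinCoord q s * mixture' b s
      + v 1 ^ 2 * mixture b (q ^ 2) + 2 * v 1 * v 2 * q ^ 2 * mixture' b (q ^ 2)
      + v 2 ^ 2 * q ^ 4 * mixture'' b (q ^ 2)
      + (v 2 ^ 2 * q ^ 2 + v 3 ^ 2) * mixture' b (q ^ 2) := by
    simp [covMatrix, Matrix.mulVec, dotProduct, Fin.sum_univ_four]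
    ring
  rw [e1]
  refine (congrArg (HasSum · _) (funext fun p => ?_)).mpr key
  simp only [covTerm]
  ring

/-- Completing squares in degree `p` leaves `v 0 ^ 2 * (1 - u ^ p - p * u ^ (p - 1) * (1 - u))` with
`u = (s / q) ^ 2`. By `pow_add_mul_pow_le` this is at least `v 0 ^ 2 * (1 - u) ^ 2`, a bound that is
uniform in the degree. -/
theorem covTerm_ge (hq0 : 0 < q) (hs : |s| ≤ q) (v : Fin 4 → ℝ) {p : ℕ} (hp : 2 ≤ p) :
    v 0 ^ 2 * sinCoord q s ^ 4 + (v 0 * (s / q) ^ p + v 1 * q ^ p + v 2 * (p * q ^ p)) ^ 2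
      + p * (v 0 * (s / q) ^ (p - 1) * sinCoord q s + v 3 * q ^ (p - 1)) ^ 2 ≤ covTerm q s v p := by
  obtain ⟨k, rfl⟩ : ∃ k, p = k + 2 := ⟨p - 2, by omega⟩
  set c := s / q with hc
  have hsc : s = c * q := by rw [hc]; field_simp
  have hc1 : c ^ 2 ≤ 1 := by
    rw [hc, div_pow, div_le_one (by positivity)]
    exact sq_le_sq' (by linarith [neg_abs_le s]) ((le_abs_self s).trans hs)
  set t := sinCoord q s with ht
  have ht2 : t ^ 2 = 1 - c ^ 2 := by
    rw [ht, sinCoord, Real.sq_sqrt (by linarith)]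
  have h1 := pow_add_mul_pow_le (sq_nonneg c) k
  rw [← ht2] at h1
  have h2 : v 0 ^ 2 * ((c ^ 2) ^ (k + 2) + (k + 2) * (c ^ 2) ^ (k + 1) * t ^ 2)
      ≤ v 0 ^ 2 * (1 - (t ^ 2) ^ 2) := mul_le_mul_of_nonneg_left h1 (sq_nonneg _)
  have e : covTerm q s v (k + 2)
      = v 0 ^ 2 - v 0 ^ 2 * ((c ^ 2) ^ (k + 2) + (k + 2) * (c ^ 2) ^ (k + 1) * t ^ 2)
        + (v 0 * c ^ (k + 2) + v 1 * q ^ (k + 2) + v 2 * ((k + 2 : ℕ) * q ^ (k + 2))) ^ 2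
        + (k + 2 : ℕ) * (v 0 * c ^ (k + 1) * t + v 3 * q ^ (k + 1)) ^ 2 := by
    have e1 : k + 2 - 1 = k + 1 := rfl
    have e2 : k + 2 - 1 - 1 = k := rfl
    rw [covTerm, e2, e1, ← ht, hsc]
    push_cast
    ring
  rw [e, show k + 2 - 1 = k + 1 from rfl]
  nlinarith

/-- At a null vector the quadratic form, a sum of non-negative terms over the degrees, vanishes
termwise, and so does each of the three squares in `covTerm_ge`. Off the collinear case the first
gives `v 0 = 0`, and two distinct degrees then give `v 1 = v 2 = 0`; in the collinear case this is
the linear independence in `Regular`. The last square gives `v 3 = 0`. -/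
theorem det_covMatrix_ne_zero (hr : 1 < r) (hb : SmoothCoeff b r) (hpure : NotPure b) (hq0 : 0 < q)
    (hq1 : q ≤ 1) (hs : |s| ≤ q) (hreg : Regular b q s) : (covMatrix b q s).det ≠ 0 := by
  intro hdet
  obtain ⟨v, hv0, hv⟩ := Matrix.exists_mulVec_eq_zero_iff.2 hdet
  apply hv0
  have hsum := hasSum_covTerm hr hb hq0 hq1 hs v
  rw [hv, dotProduct_zero] at hsum
  have two_le : ∀ p, b p ≠ 0 → 2 ≤ p := fun p hp => by
    by_contra! h
    interval_cases p
    · exact hp hb.zero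
    · exact hp hb.one
  have hnn : ∀ p, 0 ≤ b p ^ 2 * covTerm q s v p := fun p => by
    by_cases hp : b p = 0
    · simp [hp]
    · refine mul_nonneg (sq_nonneg _) (le_trans ?_ (covTerm_ge hq0 hs v (two_le p hp)))
      positivity
  have hzero := (hasSum_zero_iff_of_nonneg hnn).1 hsum
  have hz : ∀ p, b p ≠ 0 → v 0 ^ 2 * sinCoord q s ^ 4 = 0 ∧
      v 0 * (s / q) ^ p + v 1 * q ^ p + v 2 * (p * q ^ p) = 0 ∧
      v 0 * (s / q) ^ (p - 1) * sinCoord q s + v 3 * q ^ (p - 1) = 0 := fun p hp => by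
    have h1 : covTerm q s v p = 0 := by
      have := congrFun hzero p
      simpa [hp] using this
    have h2 := covTerm_ge hq0 hs v (two_le p hp)
    rw [h1] at h2
    have hp0 : (0 : ℝ) < p := by exact_mod_cast (by linarith [two_le p hp] : 0 < p)
    have n1 : 0 ≤ v 0 ^ 2 * sinCoord q s ^ 4 := by positivity
    have n2 := sq_nonneg (v 0 * (s / q) ^ p + v 1 * q ^ p + v 2 * (p * q ^ p))
    have n3 : 0 ≤ p * (v 0 * (s / q) ^ (p - 1) * sinCoord q s + v 3 * q ^ (p - 1)) ^ 2 := by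
      positivity
    refine ⟨by linarith, ?_, ?_⟩
    · exact pow_eq_zero_iff two_ne_zero |>.1 (by linarith)
    · have h3 : p * (v 0 * (s / q) ^ (p - 1) * sinCoord q s + v 3 * q ^ (p - 1)) ^ 2 = 0 := by
        linarith
      exact pow_eq_zero_iff two_ne_zero |>.1 ((mul_eq_zero.1 h3).resolve_left hp0.ne')
  obtain ⟨p, p', hpp', hp, hp'⟩ := hpure
  have h012 : v 0 = 0 ∧ v 1 = 0 ∧ v 2 = 0 := by
    by_cases ht : sinCoord q s = 0
    · have hsq : |s| = q := by
        have h1 : 1 - (s / q) ^ 2 ≤ 0 := Real.sqrt_eq_zero'.1 ht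
        have h2 : q ^ 2 ≤ s ^ 2 := by
          rw [div_pow] at h1
          have : 1 ≤ s ^ 2 / q ^ 2 := by linarith
          rwa [le_div_iff₀ (by positivity), one_mul] at this
        refine le_antisymm hs ?_
        rw [← abs_of_pos hq0]
        exact sq_le_sq.1 h2
      exact hreg.2 hq0 hsq _ _ _ fun p hp => (hz p hp).2.1
    · have h0 : v 0 = 0 := by
        have := (hz p hp).1
        simpa [ht] using this
      have key : ∀ p, b p ≠ 0 → v 1 + p * v 2 = 0 := fun p hp => by
        have := (hz p hp).2.1
        rw [h0] at this
        have h3 : q ^ p * (v 1 + p * v 2) = 0 := by linarith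
        exact (mul_eq_zero.1 h3).resolve_left (by positivity)
      have h4 := key p hp
      have h5 := key p' hp'
      have h6 : ((p : ℝ) - p') * v 2 = 0 := by linarith
      have h7 : v 2 = 0 := (mul_eq_zero.1 h6).resolve_left
        (sub_ne_zero.2 (by exact_mod_cast hpp'))
      rw [h7] at h4
      exact ⟨h0, by linarith, h7⟩
  obtain ⟨h0, h1, h2⟩ := h012
  have h3 : v 3 = 0 := by
    have := (hz p hp).2.2
    rw [h0] at this
    have h3 : v 3 * q ^ (p - 1) = 0 := by linarith
    exact (mul_eq_zero.1 h3).resolve_right (by positivity)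
  ext i
  fin_cases i <;> assumption

theorem continuousOn_mixture (hr : 1 < r) (hb : SmoothCoeff b r) :
    ContinuousOn (mixture b) (Set.Icc (-1) 1) := fun _ hs =>
  (hasDerivAt_mixture hr hb ((abs_le.2 hs).trans_lt hr)).continuousAt.continuousWithinAt

theorem continuousOn_mixture' (hr : 1 < r) (hb : SmoothCoeff b r) :
    ContinuousOn (mixture' b) (Set.Icc (-1) 1) := fun _ hs =>
  (hasDerivAt_mixture' hr hb ((abs_le.2 hs).trans_lt hr)).continuousAt.continuousWithinAt

theorem continuous_sinCoord (q : ℝ) : Continuous (sinCoord q) := by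
  unfold sinCoord; fun_prop

theorem continuousOn_covMatrix (hr : 1 < r) (hb : SmoothCoeff b r) :
    ContinuousOn (covMatrix b q) (Set.Icc (-1) 1) := by
  have h1 := continuousOn_mixture hr hb
  have h2 := continuousOn_mixture' hr hb
  have h3 : ContinuousOn (fun s => s * mixture' b s) (Set.Icc (-1) 1) := continuousOn_id.mul h2
  have h4 : ContinuousOn (fun s => sinCoord q s * mixture' b s) (Set.Icc (-1) 1) :=
    (continuous_sinCoord q).continuousOn.mul h2
  refine continuousOn_pi.2 fun i => continuousOn_pi.2 fun j => ?_
  fin_cases i <;> fin_cases j <;>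
    first | exact continuousOn_const | exact h1 | exact h3 | exact h4

/-- Cramer's rule: the determinant and the adjugate are polynomials in the entries. -/
theorem continuousOn_covMatrix_inv_mulVec (hr : 1 < r) (hb : SmoothCoeff b r) :
    ContinuousOn (fun x : ℝ × (Fin 4 → ℝ) => (covMatrix b q x.1)⁻¹.mulVec x.2)
      {x | x.1 ∈ Set.Icc (-1) 1 ∧ (covMatrix b q x.1).det ≠ 0} := by
  have hM : ContinuousOn (fun x : ℝ × (Fin 4 → ℝ) => covMatrix b q x.1)
      {x | x.1 ∈ Set.Icc (-1) 1 ∧ (covMatrix b q x.1).det ≠ 0} :=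
    (continuousOn_covMatrix hr hb).comp continuous_fst.continuousOn fun x hx => hx.1
  have hdet := (continuous_id.matrix_det (A := fun M : Matrix (Fin 4) (Fin 4) ℝ => M)).comp_continuousOn hM
  have hadj := (continuous_id.matrix_adjugate
    (A := fun M : Matrix (Fin 4) (Fin 4) ℝ => M)).comp_continuousOn hM
  have hmv : Continuous fun y : Matrix (Fin 4) (Fin 4) ℝ × (Fin 4 → ℝ) => y.1.mulVec y.2 :=
    continuous_fst.matrix_mulVec continuous_snd
  have h1 := (hdet.inv₀ fun x hx => hx.2).smul
    (hmv.comp_continuousOn (hadj.prodMk continuous_snd.continuousOn))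
  refine h1.congr fun x _ => ?_
  rw [Matrix.inv_def, Ring.inverse_eq_inv', Matrix.smul_mulVec]
  rfl

end Invertible

/-! ### Conditional means -/

/-- The vector `x₀` has coordinates `s / q` along `x⋆ / q` and `√(1 - (s / q)²) √N` along `z`. -/
structure IsFrame {N : ℕ} {q : ℝ} (c : Config N q) (z : Eu N) : Prop where
  norm_le : ‖z‖ ≤ 1
  orth : ⟪z, c.xs⟫ = 0
  x0_eq : c.x0 = (c.overlap / q ^ 2) • c.xs + (sinCoord q c.overlap * √N) • z
  inner_eq : ⟪c.x0, z⟫ = sinCoord q c.overlap * √N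

section Frame

variable {N : ℕ} {q : ℝ} {c : Config N q} {z : Eu N}

theorem Config.inner_eq (c : Config N q) (hN : 1 ≤ N) : ⟪c.x0, c.xs⟫ = c.overlap * N := by
  have : (N : ℝ) ≠ 0 := by positivity
  rw [Config.overlap, div_mul_cancel₀ _ this]

theorem Config.inner_x0_self (c : Config N q) : ⟪c.x0, c.x0⟫ = (N : ℝ) := by
  rw [real_inner_self_eq_norm_sq, c.norm_x0, Real.sq_sqrt N.cast_nonneg]

theorem Config.inner_xs_self (c : Config N q) : ⟪c.xs, c.xs⟫ = q ^ 2 * N := by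
  rw [real_inner_self_eq_norm_sq, c.norm_xs, mul_pow, Real.sq_sqrt N.cast_nonneg]

theorem Config.abs_overlap_le (c : Config N q) (hq0 : 0 ≤ q) : |c.overlap| ≤ q := by
  rw [Config.overlap, abs_div, Nat.abs_cast]
  refine div_le_of_le_mul₀ N.cast_nonneg hq0 ((abs_real_inner_le_norm _ _).trans_eq ?_)
  rw [c.norm_x0, c.norm_xs]
  linear_combination q * Real.mul_self_sqrt (N.cast_nonneg (α := ℝ))

theorem Config.overlap_eq_zero (c : Config N 0) : c.overlap = 0 :=
  abs_nonpos_iff.1 (c.abs_overlap_le le_rfl)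

theorem Config.xs_eq_zero (c : Config N 0) : c.xs = 0 := by
  rw [← norm_eq_zero, c.norm_xs, zero_mul]

theorem Config.overlap_div_mul_cancel (c : Config N q) : c.overlap / q ^ 2 * q ^ 2 = c.overlap := by
  rcases eq_or_ne q 0 with rfl | hq
  · simp [c.overlap_eq_zero]
  · field_simp

theorem sinCoord_nonneg (q s : ℝ) : 0 ≤ sinCoord q s := Real.sqrt_nonneg _

theorem sinCoord_sq {q s : ℝ} (hq0 : 0 ≤ q) (hs : |s| ≤ q) : sinCoord q s ^ 2 = 1 - (s / q) ^ 2 := by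
  refine Real.sq_sqrt (sub_nonneg.2 ?_)
  rw [← sq_abs, abs_div, abs_of_nonneg hq0]
  exact pow_le_one₀ (by positivity) (div_le_one_of_le₀ hs hq0)

/-- The component of `x₀` orthogonal to `x⋆`, normalised. If the points are collinear, the
convention `0⁻¹ = 0` makes `z = 0`; this is why `IsFrame` only asks for norm at most one, and it
covers `N = 1`, where there may be no orthogonal unit vector. -/
theorem Config.exists_isFrame (c : Config N q) (hN : 1 ≤ N) (hq0 : 0 ≤ q) : ∃ z, IsFrame c z := by
  have hN0 : (0 : ℝ) < √N := Real.sqrt_pos.2 (by positivity)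
  have hNN : √(N : ℝ) ^ 2 = N := Real.sq_sqrt N.cast_nonneg
  have ht2 := sinCoord_sq hq0 (c.abs_overlap_le hq0)
  have ht0 := sinCoord_nonneg q c.overlap
  have hc := c.overlap_div_mul_cancel
  set t := sinCoord q c.overlap with ht
  set y := c.x0 - (c.overlap / q ^ 2) • c.xs with hy
  have hyxs : ⟪y, c.xs⟫ = 0 := by
    rw [hy, inner_sub_left, real_inner_smul_left, c.inner_eq hN, c.inner_xs_self, ← mul_assoc, hc,
      sub_self]
  have hx0y : ⟪c.x0, y⟫ = t ^ 2 * N := by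
    rw [hy, inner_sub_right, real_inner_smul_right, c.inner_eq hN, c.inner_x0_self, ht2]
    ring
  have hyy : ‖y‖ = t * √N := by
    refine (sq_eq_sq₀ (norm_nonneg _) (by positivity)).1 ?_
    rw [mul_pow, hNN, ← hx0y, ← real_inner_self_eq_norm_sq]
    nth_rw 1 [hy]
    rw [inner_sub_left, real_inner_smul_left, real_inner_comm y c.xs, hyxs]
    ring
  refine ⟨(t * √N)⁻¹ • y, ?_, ?_, ?_, ?_⟩
  · rw [norm_smul, hyy, norm_inv, Real.norm_of_nonneg (by positivity)]
    exact inv_mul_le_one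
  · rw [real_inner_smul_left, hyxs, mul_zero]
  · rw [← ht, smul_smul]
    rcases ht0.eq_or_lt with h | h
    · rw [← h, zero_mul, norm_eq_zero] at hyy
      rw [hyy, smul_zero, add_zero, ← sub_eq_zero, ← hy, hyy]
    · rw [mul_inv_cancel₀ (by positivity), one_smul, hy]
      abel
  · rw [real_inner_smul_right, hx0y, ← ht]
    rcases ht0.eq_or_lt with h | h
    · simp [← h]
    · field_simp
      rw [hNN]

/-- The norm of `x₀` fixes its `z` coordinate up to sign, and the half-plane condition selects the
non-negative root `sinCoord`. -/
theorem IsSecondAxis.isFrame (hz : IsSecondAxis c z) (hN : 1 ≤ N) (hq0 : 0 ≤ q) : IsFrame c z := by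
  have hNN : √(N : ℝ) ^ 2 = N := Real.sq_sqrt N.cast_nonneg
  have hN0 : (0 : ℝ) < √N := Real.sqrt_pos.2 (by positivity)
  have ht2 := sinCoord_sq hq0 (c.abs_overlap_le hq0)
  obtain ⟨k, a, hka⟩ := Submodule.mem_span_pair.1 hz.mem_span
  have hzz : ⟪z, z⟫ = (1 : ℝ) := by rw [real_inner_self_eq_norm_sq, hz.norm, one_pow]
  have h1 : ⟪c.x0, z⟫ = k := by
    rw [← hka, inner_add_left, real_inner_smul_left, real_inner_smul_left, hzz,
      real_inner_comm, hz.orth]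
    ring
  have hk : 0 ≤ k := h1 ▸ hz.nonneg
  have h2 : a * q ^ 2 = c.overlap := by
    have h3 := c.inner_eq hN
    rw [← hka, inner_add_left, real_inner_smul_left, real_inner_smul_left, hz.orth,
      c.inner_xs_self] at h3
    have : (a * q ^ 2 - c.overlap) * N = 0 := by linarith
    have hN' : (N : ℝ) ≠ 0 := by positivity
    linarith [(mul_eq_zero.1 this).resolve_right hN']
  have ha : (c.overlap / q ^ 2) • c.xs = a • c.xs := by
    rcases eq_or_ne q 0 with rfl | hq
    · simp [c.xs_eq_zero]
    · rw [← h2, mul_div_cancel_right₀ _ (by positivity)]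
  have hkt : k = sinCoord q c.overlap * √N := by
    refine (sq_eq_sq₀ hk (mul_nonneg (sinCoord_nonneg _ _) hN0.le)).1 ?_
    have h3 := c.inner_x0_self
    nth_rw 1 [← hka] at h3
    rw [inner_add_left, real_inner_smul_left, real_inner_smul_left, real_inner_comm, h1,
      real_inner_comm, c.inner_eq hN] at h3
    rw [mul_pow, hNN, ht2, ← h2]
    rcases eq_or_ne q 0 with rfl | hq
    · simp only [c.overlap_eq_zero] at h3
      simp
      linarith
    · rw [← h2] at h3
      field_simp
      linarith
  exact ⟨hz.norm.le, hz.orth, by rw [ha, ← hkt, add_comm, hka], h1.trans hkt⟩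

end Frame

/-! ### The element of the Gaussian space that represents the conditional mean -/

section MeanClass

variable {N : ℕ} {Ω : Type u} [MeasurableSpace Ω] {P : Measure Ω} [IsProbabilityMeasure P]
  {J : DisorderIdx N → Ω → ℝ} {b : ℕ → ℝ} {r q : ℝ} {c c' : Config N q} {z : Eu N}

/-- The combination with coefficients `α` of `H(x₀)`, `H(x⋆)` and the derivatives of `H` at `x⋆` along
`x⋆` and `√N z`. -/
def meanClass (P : Measure Ω) (J : DisorderIdx N → Ω → ℝ) (b : ℕ → ℝ) (c : Config N q) (z : Eu N)
    (α : Fin 4 → ℝ) : Lp ℝ 2 P :=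
  α 0 • valueClass P J b c.x0 + α 1 • valueClass P J b c.xs
    + derivClass P J b c.xs (α 2 • c.xs + (α 3 * √N) • z)

theorem mixture_zero (hb : SmoothCoeff b r) : mixture b 0 = 0 := by
  unfold mixture
  rw [tsum_congr fun p => ?_, tsum_zero]
  rcases p with - | p <;> simp [hb.zero]

theorem mixture'_zero (hb : SmoothCoeff b r) : mixture' b 0 = 0 := by
  unfold mixture'
  rw [tsum_congr fun p => ?_, tsum_zero]
  rcases p with - | - | p <;> simp [hb.zero, hb.one]

theorem Config.abs_inner_xs_div_lt (c : Config N q) (hN : 1 ≤ N) (hr : 1 < r) (hq0 : 0 ≤ q)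
    (hq1 : q ≤ 1) : |⟪c.xs, c.xs⟫ / N| < r := by
  have : (N : ℝ) ≠ 0 := by positivity
  rw [c.inner_xs_self, mul_div_cancel_right₀ _ this, abs_of_nonneg (sq_nonneg q)]
  nlinarith

theorem Config.inner_xs_self_div (c : Config N q) (hN : 1 ≤ N) : ⟪c.xs, c.xs⟫ / N = q ^ 2 := by
  have : (N : ℝ) ≠ 0 := by positivity
  rw [c.inner_xs_self, mul_div_cancel_right₀ _ this]

theorem Config.inner_x0_self_div (c : Config N q) (hN : 1 ≤ N) : ⟪c.x0, c.x0⟫ / N = (1 : ℝ) := by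
  have : (N : ℝ) ≠ 0 := by positivity
  rw [c.inner_x0_self, div_self this]

/-- The equations that determine the conditional mean, in coordinates. -/
theorem IsDisorder.inner_condVec_meanClass (hJ : IsDisorder P J) (hN : 1 ≤ N) (hr : 1 < r)
    (hb : SmoothCoeff b r) (hq0 : 0 ≤ q) (hq1 : q ≤ 1) (hpos : 0 < q → mixture' b (q ^ 2) ≠ 0)
    (hz : IsFrame c z) {V : Params}
    {G : ℝ} {w : Eu N} (hwx : ⟪w, c.xs⟫ = 0) (hwz : ⟪w, z⟫ = 0) (hw0 : q = 0 → w = 0)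
    {α : Fin 4 → ℝ}
    (hα : (covMatrix b q c.overlap).mulVec α = ![-V.E, -V.Es, -(q ^ 2 * V.Gs), -(q * G)])
    (i : Fin 2 ⊕ Fin N) :
    ⟪l2Class P (condVec b J c i), meanClass P J b c z α
        + derivClass P J b c.xs ((-(mixture' b (q ^ 2))⁻¹) • w)⟫
      = Sum.elim ![V.E, V.Es] (fun i => (V.Gs • c.xs + ((G * ‖c.xs‖) • z + w)) i) i := by
  have hN0 : (N : ℝ) ≠ 0 := by positivity
  have hNN : √(N : ℝ) * √N = N := Real.mul_self_sqrt N.cast_nonneg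
  obtain ⟨-, h0, h1, h2⟩ := hJ.condVec_spec hN hr hb hq1 c
  have hx0 := c.x0_mem hN hr
  have hxs := c.xs_mem hN hr hq1
  have hss := c.inner_xs_self_div hN
  have hss' := c.abs_inner_xs_div_lt hN hr hq0 hq1
  have hov : |⟪c.x0, c.xs⟫ / (N : ℝ)| < r :=
    (c.abs_overlap_le hq0).trans_lt (by linarith)
  have hov' : ⟪c.x0, c.xs⟫ / (N : ℝ) = c.overlap := rfl
  have a0 := congrFun hα 0
  have a1 := congrFun hα 1
  have a2 := congrFun hα 2
  have a3 := congrFun hα 3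
  simp [covMatrix, Matrix.mulVec, dotProduct, Fin.sum_univ_four] at a0 a1 a2 a3
  set s := c.overlap with hs
  -- In a direction orthogonal to `x⋆` and `z`, the covariance of the gradient at `x⋆` is `mixture'
  -- b (q ^ 2)` times the identity. This determines the coefficient of `w`, and the sign is that of
  -- `-∇H`.
  set β := -(mixture' b (q ^ 2))⁻¹ with hβ
  have hxz : ⟪c.xs, z⟫ = 0 := by rw [real_inner_comm, hz.orth]
  have hxw : ⟪c.xs, w⟫ = 0 := by rw [real_inner_comm, hwx]
  have hzw : ⟪z, w⟫ = 0 := by rw [real_inner_comm, hwz]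
  have hx0w : ⟪c.x0, w⟫ = 0 := by
    rw [hz.x0_eq, inner_add_left, real_inner_smul_left, real_inner_smul_left, hxw, hzw]
    ring
  rw [meanClass, add_assoc, ← hJ.derivClass_add hN hr.le hb hxs]
  set h := α 2 • c.xs + (α 3 * √N) • z + β • w with hh
  have i0 : ⟪c.x0, h⟫ = N * (α 2 * s + α 3 * sinCoord q s) := by
    rw [hh, inner_add_right, inner_add_right, real_inner_smul_right, real_inner_smul_right,
      real_inner_smul_right, hx0w, hz.inner_eq, c.inner_eq hN, ← hs]
    linear_combination α 3 * sinCoord q s * hNN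
  have i1 : ⟪c.xs, h⟫ = N * (α 2 * q ^ 2) := by
    rw [hh, inner_add_right, inner_add_right, real_inner_smul_right, real_inner_smul_right,
      real_inner_smul_right, hxw, hxz, c.inner_xs_self]
    ring
  rcases i with i | i
  · fin_cases i
    · simp only [Fin.zero_eta, h0, Sum.elim_inl, Matrix.cons_val_zero]
      rw [inner_smul_left, inner_add_right, inner_add_right, inner_smul_right, inner_smul_right,
        hJ.inner_valueClass_valueClass hN hr.le hb hx0 hx0,
        hJ.inner_valueClass_valueClass hN hr.le hb hx0 hxs,
        hJ.inner_valueClass_derivClass hN hr hb hx0 hxs hov, hov', c.inner_x0_self_div hN, i0]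
      simp
      field_simp
      linarith
    · simp only [Fin.mk_one, h1, Sum.elim_inl, Matrix.cons_val_one]
      rw [inner_smul_left, inner_add_right, inner_add_right, inner_smul_right, inner_smul_right,
        real_inner_comm,
        hJ.inner_valueClass_valueClass hN hr.le hb hx0 hxs,
        hJ.inner_valueClass_valueClass hN hr.le hb hxs hxs,
        hJ.inner_valueClass_derivClass hN hr hb hxs hxs hss', hov', hss, i1]
      simp
      field_simp
      linarith
  -- The gradient equation, tested in all directions, splits into coefficients of `x⋆`, `z` and `w`:
  -- the third row of the system divided by `q ^ 2`, the fourth row, and the choice of `β`.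
  · have hu : ∀ u : Eu N, ⟪derivClass P J b c.xs u, α 0 • valueClass P J b c.x0
        + (α 1 • valueClass P J b c.xs + derivClass P J b c.xs h)⟫
        = -⟪V.Gs • c.xs + ((G * ‖c.xs‖) • z + w), u⟫ := fun u => by
      have e1 : α 0 * (mixture' b s * ⟪c.x0, u⟫) + (α 1 * (mixture' b (q ^ 2) * ⟪c.xs, u⟫)
          + (mixture'' b (q ^ 2) * (⟪c.xs, h⟫ * ⟪c.xs, u⟫ / N) + mixture' b (q ^ 2) * ⟪h, u⟫))
          = -⟪V.Gs • c.xs + ((G * ‖c.xs‖) • z + w), u⟫ := by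
        rw [i1, hh, c.norm_xs, hz.x0_eq, ← hs]
        simp only [inner_add_left, real_inner_smul_left]
        rcases hq0.eq_or_lt with hq | hq
        · subst hq
          have hx : c.xs = 0 := c.xs_eq_zero
          have hs0 : s = 0 := c.overlap_eq_zero
          have hw := hw0 rfl
          have hm := mixture'_zero hb
          simp [hx, hw, hs0, hm]
        · have b1 : β * mixture' b (q ^ 2) = -1 := by
            rw [hβ, neg_mul, inv_mul_cancel₀ (hpos hq)]
          have b2 : α 0 * (s / q ^ 2 * mixture' b s) + α 1 * mixture' b (q ^ 2)
              + α 2 * (q ^ 2 * mixture'' b (q ^ 2) + mixture' b (q ^ 2)) = -V.Gs := by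
            field_simp
            have : q ^ 2 * (α 0 * (s * mixture' b s) + q ^ 2 * (α 1 * mixture' b (q ^ 2)
              + α 2 * (q ^ 2 * mixture'' b (q ^ 2) + mixture' b (q ^ 2))) + q ^ 2 * V.Gs) = 0 := by
              linear_combination q ^ 2 * a2
            have := (mul_eq_zero.1 this).resolve_left (by positivity)
            linarith
          have e : α 2 * q ^ 2 * N * ⟪c.xs, u⟫ / N = α 2 * q ^ 2 * ⟪c.xs, u⟫ := by field_simp
          rw [show (N : ℝ) * (α 2 * q ^ 2) * ⟪c.xs, u⟫ / N = α 2 * q ^ 2 * ⟪c.xs, u⟫ by field_simp]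
          linear_combination ⟪c.xs, u⟫ * b2 + √N * ⟪z, u⟫ * a3 + ⟪w, u⟫ * b1
      rw [← e1, inner_add_right, inner_add_right, inner_smul_right, inner_smul_right,
        real_inner_comm, real_inner_comm _ (derivClass P J b c.xs u),
        hJ.inner_valueClass_derivClass hN hr hb hx0 hxs hov,
        hJ.inner_valueClass_derivClass hN hr hb hxs hxs hss',
        hJ.inner_derivClass_derivClass hN hr hb hxs hxs hss', hov', hss]
    rw [h2, inner_smul_left, add_assoc, hu]
    simp [EuclideanSpace.inner_single_right]

theorem IsDisorder.meanClass_mem (hJ : IsDisorder P J) (hN : 1 ≤ N) (hr : 1 < r)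
    (hb : SmoothCoeff b r) (hq1 : q ≤ 1) (α : Fin 4 → ℝ) :
    meanClass P J b c z α ∈ condSpan P (condVec b J c) := by
  obtain ⟨h0, h1, h2⟩ := hJ.mem_condSpan hN hr hb hq1 c
  exact add_mem (add_mem (Submodule.smul_mem _ _ h0) (Submodule.smul_mem _ _ h1)) (h2 _)

theorem IsDisorder.meanClass_sub (hJ : IsDisorder P J) (hN : 1 ≤ N) (hr : 1 < r)
    (hb : SmoothCoeff b r) (hq1 : q ≤ 1) (α α' : Fin 4 → ℝ) :
    meanClass P J b c z (α - α') = meanClass P J b c z α - meanClass P J b c z α' := by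
  have : (α - α') 2 • c.xs + ((α - α') 3 * √N) • z = (α 2 • c.xs + (α 3 * √N) • z)
      - (α' 2 • c.xs + (α' 3 * √N) • z) := by
    simp only [Pi.sub_apply]; module
  rw [meanClass, this, hJ.derivClass_sub hN hr.le hb (c.xs_mem hN hr hq1), meanClass, meanClass]
  simp only [Pi.sub_apply]
  module

theorem IsDisorder.norm_derivClass_le (hJ : IsDisorder P J) (hN : 1 ≤ N) (hr : 1 < r)
    (hb : SmoothCoeff b r) (hq0 : 0 ≤ q) (hq1 : q ≤ 1) (h : Eu N) :
    ‖derivClass P J b c.xs h‖ ≤ √(|mixture'' b (q ^ 2)| + |mixture' b (q ^ 2)|) * ‖h‖ := by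
  have hN0 : (0 : ℝ) < N := by positivity
  have hxs := c.xs_mem hN hr hq1
  rw [← abs_of_nonneg (norm_nonneg (derivClass P J b c.xs h)), ← Real.sqrt_sq (norm_nonneg h),
    ← Real.sqrt_mul (by positivity)]
  refine Real.abs_le_sqrt ?_
  rw [← real_inner_self_eq_norm_sq, hJ.inner_derivClass_derivClass hN hr hb hxs hxs
    (c.abs_inner_xs_div_lt hN hr hq0 hq1), c.inner_xs_self_div hN, real_inner_self_eq_norm_sq,
    add_mul]
  have h1 : ⟪c.xs, h⟫ * ⟪c.xs, h⟫ / N ≤ ‖h‖ ^ 2 := by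
    rw [div_le_iff₀ hN0, ← sq, ← sq_abs]
    calc |⟪c.xs, h⟫| ^ 2 ≤ (‖c.xs‖ * ‖h‖) ^ 2 :=
          pow_le_pow_left₀ (abs_nonneg _) (abs_real_inner_le_norm _ _) 2
      _ = q ^ 2 * (‖h‖ ^ 2 * N) := by
          rw [c.norm_xs, mul_pow, mul_pow, Real.sq_sqrt N.cast_nonneg]; ring
      _ ≤ 1 * (‖h‖ ^ 2 * N) := by gcongr; exact pow_le_one₀ hq0 hq1
      _ = _ := one_mul _
  have h0 : 0 ≤ ⟪c.xs, h⟫ * ⟪c.xs, h⟫ / N := div_nonneg (mul_self_nonneg _) hN0.le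
  have h2 : mixture'' b (q ^ 2) * (⟪c.xs, h⟫ * ⟪c.xs, h⟫ / N)
      ≤ |mixture'' b (q ^ 2)| * ‖h‖ ^ 2 :=
    mul_le_mul (le_abs_self _) h1 h0 (abs_nonneg _)
  have h3 : mixture' b (q ^ 2) * ‖h‖ ^ 2 ≤ |mixture' b (q ^ 2)| * ‖h‖ ^ 2 := by
    gcongr; exact le_abs_self _
  linarith

/-- A constant that bounds the norm of `meanClass` in terms of the coefficients. -/
def meanBound (b : ℕ → ℝ) (q : ℝ) : ℝ :=
  √(mixture b 1) + √(mixture b (q ^ 2)) + 2 * √(|mixture'' b (q ^ 2)| + |mixture' b (q ^ 2)|)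

theorem meanBound_nonneg (b : ℕ → ℝ) (q : ℝ) : 0 ≤ meanBound b q := by
  unfold meanBound; positivity

theorem IsDisorder.norm_valueClass (hJ : IsDisorder P J) (hN : 1 ≤ N) (hr : 1 ≤ r)
    (hb : SmoothCoeff b r) {x : Eu N} (hx : x ∈ Metric.ball (0 : Eu N) (r * √N)) :
    ‖valueClass P J b x‖ = √N * √(mixture b (⟪x, x⟫ / N)) := by
  rw [← Real.sqrt_mul N.cast_nonneg, ← hJ.inner_valueClass_valueClass hN hr hb hx hx,
    real_inner_self_eq_norm_sq, Real.sqrt_sq (norm_nonneg _)]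

theorem IsDisorder.norm_meanClass_le (hJ : IsDisorder P J) (hN : 1 ≤ N) (hr : 1 < r)
    (hb : SmoothCoeff b r) (hq0 : 0 ≤ q) (hq1 : q ≤ 1) (hz : ‖z‖ ≤ 1) (α : Fin 4 → ℝ) :
    ‖meanClass P J b c z α‖ ≤ √N * (meanBound b q * ‖α‖) := by
  have hα : ∀ i, |α i| ≤ ‖α‖ := fun i => norm_le_pi_norm α i
  have h0 : ‖valueClass P J b c.x0‖ = √N * √(mixture b 1) := by
    rw [hJ.norm_valueClass hN hr.le hb (c.x0_mem hN hr), c.inner_x0_self_div hN]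
  have h1 : ‖valueClass P J b c.xs‖ = √N * √(mixture b (q ^ 2)) := by
    rw [hJ.norm_valueClass hN hr.le hb (c.xs_mem hN hr hq1), c.inner_xs_self_div hN]
  have h2 : ‖α 2 • c.xs + (α 3 * √N) • z‖ ≤ 2 * ‖α‖ * √N := by
    refine (norm_add_le _ _).trans ?_
    rw [norm_smul, norm_smul, norm_mul, Real.norm_eq_abs, Real.norm_eq_abs, c.norm_xs,
      Real.norm_of_nonneg (Real.sqrt_nonneg _)]
    calc |α 2| * (q * √N) + |α 3| * √N * ‖z‖ ≤ ‖α‖ * (1 * √N) + ‖α‖ * √N * 1 := by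
          gcongr <;> exact hα _
      _ = _ := by ring
  calc ‖meanClass P J b c z α‖
      ≤ |α 0| * (√N * √(mixture b 1)) + |α 1| * (√N * √(mixture b (q ^ 2)))
        + √(|mixture'' b (q ^ 2)| + |mixture' b (q ^ 2)|) * ‖α 2 • c.xs + (α 3 * √N) • z‖ := by
        refine (norm_add₃_le).trans ?_
        rw [norm_smul, norm_smul, h0, h1]
        gcongr
        · exact le_rfl
        · exact le_rfl
        · exact hJ.norm_derivClass_le hN hr hb hq0 hq1 _
    _ ≤ ‖α‖ * (√N * √(mixture b 1)) + ‖α‖ * (√N * √(mixture b (q ^ 2)))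
        + √(|mixture'' b (q ^ 2)| + |mixture' b (q ^ 2)|) * (2 * ‖α‖ * √N) := by
        gcongr <;> exact hα _
    _ = _ := by rw [meanBound]; ring

theorem IsFrame.inner_x0_x0 (hz : IsFrame c z) (hz' : IsFrame c' z) (hN : 1 ≤ N)
    (hc : c'.xs = c.xs) :
    ⟪c.x0, c'.x0⟫ / N = c.overlap / q * (c'.overlap / q)
      + sinCoord q c.overlap * sinCoord q c'.overlap := by
  have hN0 : (N : ℝ) ≠ 0 := by positivity
  have hNN : √(N : ℝ) * √N = N := Real.mul_self_sqrt N.cast_nonneg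
  rw [hz'.x0_eq, inner_add_right, real_inner_smul_right, real_inner_smul_right, hc, hz.inner_eq,
    c.inner_eq hN, show sinCoord q c'.overlap * √N * (sinCoord q c.overlap * √N)
      = sinCoord q c'.overlap * sinCoord q c.overlap * (√N * √N) by ring, hNN]
  field_simp

theorem IsDisorder.norm_valueClass_sub (hJ : IsDisorder P J) (hN : 1 ≤ N) (hr : 1 < r)
    (hb : SmoothCoeff b r) :
    ‖valueClass P J b c'.x0 - valueClass P J b c.x0‖
      = √N * √(2 * (mixture b 1 - mixture b (⟪c.x0, c'.x0⟫ / N))) := by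
  have hx0 := c.x0_mem hN hr
  have hx0' := c'.x0_mem hN hr
  rw [← Real.sqrt_mul N.cast_nonneg, ← Real.sqrt_sq (norm_nonneg (valueClass P J b c'.x0 - _)),
    norm_sub_sq_real, ← real_inner_self_eq_norm_sq, ← real_inner_self_eq_norm_sq,
    real_inner_comm (valueClass P J b c.x0), hJ.inner_valueClass_valueClass hN hr.le hb hx0 hx0,
    hJ.inner_valueClass_valueClass hN hr.le hb hx0' hx0',
    hJ.inner_valueClass_valueClass hN hr.le hb hx0 hx0', c.inner_x0_self_div hN,
    c'.inner_x0_self_div hN]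
  congr 1
  ring

/-- The Hamiltonian with coefficients `b'`, conditioned on the event that the Hamiltonian with
coefficients `b` takes given values, has the mean that the class `g` represents. -/
theorem IsDisorder.fieldMean_eq (hJ : IsDisorder P J) (hN : 1 ≤ N) (hr : 1 < r)
    (hb : SmoothCoeff b r) {b' : ℕ → ℝ} (hb' : SmoothCoeff b' r) (hq0 : 0 ≤ q) (hq1 : q ≤ 1)
    (hpos : 0 < q → mixture' b (q ^ 2) ≠ 0) (hz : IsFrame c z) {V : Params}
    {G : ℝ} {w : Eu N} (hwx : ⟪w, c.xs⟫ = 0) (hwz : ⟪w, z⟫ = 0) (hw0 : q = 0 → w = 0)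
    {α : Fin 4 → ℝ}
    (hα : (covMatrix b q c.overlap).mulVec α = ![-V.E, -V.Es, -(q ^ 2 * V.Gs), -(q * G)])
    {x : Eu N} (hx : x ∈ Metric.ball (0 : Eu N) (r * √N)) :
    fieldMean P J b b' c V ((G * ‖c.xs‖) • z + w) x
      = hamiltonian b' (covArray P J (meanClass P J b c z α
        + derivClass P J b c.xs ((-(mixture' b (q ^ 2))⁻¹) • w))) x :=
  hJ.condMean_hamiltonian hN hr.le hb' hx (hJ.condVec_spec hN hr hb hq1 c).1
    (hJ.inner_condVec_meanClass hN hr hb hq0 hq1 hpos hz hwx hwz hw0 hα)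
    (add_mem (hJ.meanClass_mem hN hr hb hq1 α) ((hJ.mem_condSpan hN hr hb hq1 c).2.2 _))

/-- The norm `√N * C` is the natural scale: tensors of covariances have size at most `‖g‖ / √N`, so
the dependence on `N` cancels. -/
theorem IsDisorder.hessSup_le_of_covArray (hJ : IsDisorder P J) (hN : 1 ≤ N) (hr : 1 ≤ r)
    (hb : SmoothCoeff b r) {g : Lp ℝ 2 P} {C : ℝ} (hg : ‖g‖ ≤ √N * C) {f : Eu N → ℝ}
    (hf : ∀ x ∈ Metric.ball (0 : Eu N) (r * √N), f x = hamiltonian b (covArray P J g) x) :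
    hessSup r f ≤ ENNReal.ofReal (C * coeffSum b r) := by
  refine hessSup_le_of_eqOn_hamiltonian hN hr hb (fun p hp => ?_) hf
  refine (hJ.tensorSize_covArray_le hN g hp).trans ?_
  have hN0 : 0 < √(N : ℝ) := Real.sqrt_pos.2 (by positivity)
  gcongr
  rw [div_le_iff₀ hN0]
  linarith

end MeanClass

/-! ### The coefficients of the conditional mean -/

section MeanCoeff

variable {b : ℕ → ℝ} {r q s : ℝ}

/-- The solution of the linear system whose matrix is the covariance matrix, with the convention that
for `q = 0` only the first equation is retained. -/
def meanCoeff (b : ℕ → ℝ) (q s : ℝ) (v : Fin 4 → ℝ) : Fin 4 → ℝ :=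
  if q = 0 then ![v 0 / mixture b 1, 0, 0, 0] else (covMatrix b q s)⁻¹.mulVec v

/-- The values of the conditioned variables. -/
def meanData (q : ℝ) (V : Params) (G : ℝ) : Fin 4 → ℝ :=
  ![-V.E, -V.Es, -(q ^ 2 * V.Gs), -(q * G)]

/-- For `q = 0` the matrix is singular, with `mixture b 1` as its only non-zero entry. The system
remains solvable because `HardConstraint` makes the second datum zero and the last two carry a
factor `q`. -/
theorem mulVec_meanCoeff (hr : 1 < r) (hb : SmoothCoeff b r) (hpure : NotPure b) (hq0 : 0 ≤ q)
    (hq1 : q ≤ 1) (hs : |s| ≤ q) (hreg : Regular b q s) {V : Params} (hV : HardConstraint q V)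
    (G : ℝ) : (covMatrix b q s).mulVec (meanCoeff b q s (meanData q V G)) = meanData q V G := by
  rcases hq0.eq_or_lt with hq | hq
  · subst hq
    have hs0 : s = 0 := abs_nonpos_iff.1 hs
    have h1 := (mixture_pos hr hb hpure zero_lt_one hr.le).ne'
    ext i
    fin_cases i <;>
      simp [meanCoeff, meanData, covMatrix, hs0, mixture_zero hb, mixture'_zero hb, (hV rfl).1,
        Matrix.mulVec, dotProduct, Fin.sum_univ_four]
    field_simp
  · have := det_covMatrix_ne_zero hr hb hpure hq hq1 hs hreg
    rw [meanCoeff, if_neg hq.ne', Matrix.mulVec_mulVec, Matrix.mul_nonsing_inv _ (by simpa),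
      Matrix.one_mulVec]

theorem continuousOn_meanCoeff (hr : 1 < r) (hb : SmoothCoeff b r) (hpure : NotPure b)
    (hq0 : 0 ≤ q) (hq1 : q ≤ 1) :
    ContinuousOn (fun x : ℝ × (Fin 4 → ℝ) => meanCoeff b q x.1 x.2)
      {x | |x.1| ≤ q ∧ Regular b q x.1} := by
  rcases hq0.eq_or_lt with hq | hq
  · simp only [meanCoeff, if_pos hq.symm]
    refine Continuous.continuousOn (continuous_pi fun i => ?_)
    fin_cases i <;> simp <;> fun_prop
  · simp only [meanCoeff, if_neg hq.ne']
    refine (continuousOn_covMatrix_inv_mulVec hr hb).mono fun x hx => ⟨?_, ?_⟩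
    · exact abs_le.1 (hx.1.trans hq1)
    · exact det_covMatrix_ne_zero hr hb hpure hq hq1 hx.1 hx.2

theorem Near.dist_meanData_le {V V' : Params} {ε : ℝ} (h : Near q ε V V') (hq0 : 0 ≤ q)
    (hq1 : q ≤ 1) {G : ℝ} (hG : |G| ≤ ε) : dist (meanData q V' G) (meanData q V 0) ≤ ε := by
  have hε : 0 ≤ ε := (abs_nonneg _).trans hG
  refine (dist_pi_le_iff hε).2 fun i => ?_
  have key : ∀ {a x : ℝ}, 0 ≤ a → a ≤ 1 → |x| ≤ ε → |a * x| ≤ ε := fun {a x} h0 h1 hx => by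
    rw [abs_mul, abs_of_nonneg h0]
    exact (mul_le_of_le_one_left (abs_nonneg x) h1).trans hx
  fin_cases i
  · simpa [meanData, Real.dist_eq, abs_sub_comm, neg_add_eq_sub] using h.E.le
  · simpa [meanData, Real.dist_eq, abs_sub_comm, neg_add_eq_sub] using h.Es.le
  · have := key (sq_nonneg q) (pow_le_one₀ hq0 hq1) h.Gs.le
    simpa [meanData, Real.dist_eq, abs_sub_comm, neg_add_eq_sub, mul_sub] using this
  · simpa [meanData, Real.dist_eq] using key hq0 hq1 hG

/-- A continuous function is bounded on the compact set of overlaps and data at distance at most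
`δ`. Regularity is needed up to the closed end of the interval for this reason. -/
theorem exists_norm_meanCoeff_le (hr : 1 < r) (hb : SmoothCoeff b r) (hpure : NotPure b)
    (hq0 : 0 ≤ q) (hq1 : q ≤ 1) {V : Params} {δ : ℝ} (hδ : 0 < δ)
    (hreg : ∀ s : ℝ, |s| ≤ q → |s - V.qo| ≤ δ → Regular b q s) :
    ∃ C : ℝ, 0 ≤ C ∧ ∀ V' : Params, Near q δ V V' → |V'.qo| ≤ q →
      ‖meanCoeff b q V'.qo (meanData q V' 0)‖ ≤ C := by
  have hK : IsCompact ((Set.Icc (-q) q ∩ Metric.closedBall V.qo δ)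
      ×ˢ Metric.closedBall (meanData q V 0) δ) :=
    ((isCompact_Icc).inter_right Metric.isClosed_closedBall).prod (isCompact_closedBall _ _)
  obtain ⟨C, hC⟩ := hK.exists_bound_of_continuousOn
    ((continuousOn_meanCoeff hr hb hpure hq0 hq1).mono fun x hx =>
      ⟨abs_le.2 hx.1.1, hreg _ (abs_le.2 hx.1.1) (by simpa [Real.dist_eq] using hx.1.2)⟩)
  refine ⟨max C 0, le_max_right _ _, fun V' h hs => le_max_of_le_left ?_⟩
  refine hC (V'.qo, meanData q V' 0) ⟨⟨abs_le.1 hs, ?_⟩, ?_⟩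
  · simpa [Real.dist_eq] using h.qo.le
  · exact h.dist_meanData_le hq0 hq1 (by simpa using hδ.le)

/-- Regularity is an open condition on the overlap. -/
theorem Allowed.exists_regular {V : Params} (hV : Allowed b q V) :
    ∃ δ₀ : ℝ, 0 < δ₀ ∧ ∀ s : ℝ, |s| ≤ q → |s - V.qo| ≤ δ₀ → Regular b q s := by
  have h1 := hV.regular.1
  rcases hV.abs_qo_le.lt_or_eq with h | h
  -- The radius keeps `|s|` below one and below `q`, so that the collinear condition is void.
  · refine ⟨min ((1 - |V.qo|) / 2) ((q - |V.qo|) / 2), lt_min (by linarith) (by linarith),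
      fun s _ hs => ?_⟩
    have h2 := hs.trans (min_le_left _ _)
    have h3 := hs.trans (min_le_right _ _)
    have h4 := abs_sub_abs_le_abs_sub s V.qo
    exact ⟨by linarith, fun _ h5 => absurd h5 (by linarith)⟩
  · rcases hV.abs_qo_le.trans' (abs_nonneg _) |>.eq_or_lt with hq | hq
    · exact ⟨1, one_pos, fun s hs _ => ⟨by linarith, fun h => absurd h (by linarith)⟩⟩
    -- Here `|q_o| = q`, so the other collinear overlap `-q_o` is at distance `2 * q` and is
    -- excluded by the radius `q`.
    · refine ⟨q, hq, fun s hs hsq => ⟨by linarith, fun _ h5 => ?_⟩⟩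
      rcases abs_eq_abs.1 (h5.trans h.symm) with h6 | h6
      · exact h6 ▸ hV.regular.2 hq h
      · rw [h6, show -V.qo - V.qo = -(2 * V.qo) by ring, abs_neg, abs_mul, h,
          abs_of_pos (two_pos)] at hsq
        linarith

end MeanCoeff

/-! ### Size and continuity of the conditional means -/

section Means

variable {N : ℕ} {Ω : Type u} [MeasurableSpace Ω] {P : Measure Ω} [IsProbabilityMeasure P]
  {J : DisorderIdx N → Ω → ℝ} {b : ℕ → ℝ} {r q : ℝ} {c c' : Config N q} {z : Eu N}

/-- One element `g` serves all `b'`, because the conditioned variables involve `b` only. Hence the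
mean of a truncation error is represented by the same `g`. -/
theorem IsDisorder.exists_fieldMean_eq (hJ : IsDisorder P J) (hN : 1 ≤ N) (hr : 1 < r)
    (hb : SmoothCoeff b r) (hpure : NotPure b) (hq0 : 0 ≤ q) (hq1 : q ≤ 1)
    (hreg : Regular b q c.overlap) {V : Params} (hV : HardConstraint q V) :
    ∃ g : Lp ℝ 2 P, ‖g‖ ≤ √N * (meanBound b q * ‖meanCoeff b q c.overlap (meanData q V 0)‖) ∧
      ∀ b' : ℕ → ℝ, SmoothCoeff b' r → ∀ x ∈ Metric.ball (0 : Eu N) (r * √N),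
        fieldMean P J b b' c V 0 x = hamiltonian b' (covArray P J g) x := by
  obtain ⟨z, hz⟩ := c.exists_isFrame hN hq0
  set α := meanCoeff b q c.overlap (meanData q V 0)
  refine ⟨_, hJ.norm_meanClass_le (c := c) hN hr hb hq0 hq1 hz.norm_le α, fun b' hb' x hx => ?_⟩
  have hα := mulVec_meanCoeff hr hb hpure hq0 hq1 (c.abs_overlap_le hq0) hreg hV 0
  have hpos : 0 < q → mixture' b (q ^ 2) ≠ 0 := fun hq =>
    (mixture'_pos hr hb hpure (by positivity) (by nlinarith)).ne'
  have hd : derivClass P J b c.xs 0 = 0 := by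
    simpa using hJ.derivClass_smul hN hr.le hb (c.xs_mem hN hr hq1) 0 0
  have h := hJ.fieldMean_eq hN hr hb hb' hq0 hq1 hpos hz (inner_zero_left _) (inner_zero_left _)
    (fun _ => rfl) hα hx
  simpa [hd] using h

/-- How far the mean moves with the configuration and with the values that are conditioned upon. -/
def meanModulus (b : ℕ → ℝ) (q s : ℝ) (v : Fin 4 → ℝ) (x : ℝ × (Fin 4 → ℝ)) : ℝ :=
  meanBound b q * ‖meanCoeff b q x.1 x.2 - meanCoeff b q s v‖
    + |meanCoeff b q s v 0| * √(2 * (mixture b 1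
      - mixture b (s / q * (x.1 / q) + sinCoord q s * sinCoord q x.1)))

theorem IsDisorder.hessSup_fieldMean_sub_le (hJ : IsDisorder P J) (hN : 1 ≤ N) (hr : 1 < r)
    (hb : SmoothCoeff b r) (hpure : NotPure b) (hq0 : 0 ≤ q) (hq1 : q ≤ 1)
    (hreg : Regular b q c.overlap) (hreg' : Regular b q c'.overlap) (hc : c'.xs = c.xs)
    (hz : IsSecondAxis c z) (hz' : IsSecondAxis c' z) {V V' : Params} (hV : HardConstraint q V)
    (hV' : HardConstraint q V') (G : ℝ) {w : Eu N} (hwx : ⟪w, c.xs⟫ = 0) (hwz : ⟪w, z⟫ = 0)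
    (hw0 : q = 0 → w = 0) {ε : ℝ} (hw : ‖w‖ ≤ ε * √N) :
    hessSup r (fun x => fieldMean P J b b c' V' ((G * ‖c'.xs‖) • z + w) x
        - fieldMean P J b b c V 0 x)
      ≤ ENNReal.ofReal ((meanModulus b q c.overlap (meanData q V 0)
          (c'.overlap, meanData q V' G)
        + √(|mixture'' b (q ^ 2)| + |mixture' b (q ^ 2)|) * |(mixture' b (q ^ 2))⁻¹| * ε)
          * coeffSum b r) := by
  have hf := hz.isFrame hN hq0
  have hf' := hz'.isFrame hN hq0
  have h := mulVec_meanCoeff hr hb hpure hq0 hq1 (c.abs_overlap_le hq0) hreg hV 0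
  have h' := mulVec_meanCoeff hr hb hpure hq0 hq1 (c'.abs_overlap_le hq0) hreg' hV' G
  set α := meanCoeff b q c.overlap (meanData q V 0)
  set α' := meanCoeff b q c'.overlap (meanData q V' G)
  have hpos : 0 < q → mixture' b (q ^ 2) ≠ 0 := fun hq =>
    (mixture'_pos hr hb hpure (by positivity) (by nlinarith)).ne'
  have hd : derivClass P J b c.xs 0 = 0 := by
    simpa using hJ.derivClass_smul hN hr.le hb (c.xs_mem hN hr hq1) 0 0
  set D := derivClass P J b c.xs ((-(mixture' b (q ^ 2))⁻¹) • w) with hD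
  -- Three sources of change: the coefficients, the motion of `x₀`, and the gradient component `w`.
  have hsub : meanClass P J b c' z α' + D - meanClass P J b c z α
      = meanClass P J b c' z (α' - α)
        + α 0 • (valueClass P J b c'.x0 - valueClass P J b c.x0) + D := by
    rw [hJ.meanClass_sub hN hr hb hq1]
    simp only [meanClass, hc]
    module
  refine hJ.hessSup_le_of_covArray hN hr.le hb
    (g := meanClass P J b c' z α' + D - meanClass P J b c z α) ?_ fun x hx => ?_
  · have hDle : ‖D‖ ≤ √(|mixture'' b (q ^ 2)| + |mixture' b (q ^ 2)|)
        * (|(mixture' b (q ^ 2))⁻¹| * (ε * √N)) := by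
      refine (hJ.norm_derivClass_le hN hr hb hq0 hq1 _).trans ?_
      rw [norm_smul, norm_neg, Real.norm_eq_abs]
      gcongr
    rw [hsub]
    refine (norm_add₃_le).trans ?_
    rw [norm_smul, hJ.norm_valueClass_sub hN hr hb, hf.inner_x0_x0 hf' hN hc, Real.norm_eq_abs]
    have := hJ.norm_meanClass_le (c := c') hN hr hb hq0 hq1 hf.norm_le (α' - α)
    rw [meanModulus]
    linarith
  · have e1 := hJ.fieldMean_eq hN hr hb hb hq0 hq1 hpos hf' (hc ▸ hwx) hwz hw0 h' hx
    have e2 := hJ.fieldMean_eq hN hr hb hb hq0 hq1 hpos hf (inner_zero_left _) (inner_zero_left _)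
      (fun _ => rfl) h hx
    have e3 : fieldMean P J b b c V 0 x = hamiltonian b (covArray P J (meanClass P J b c z α)) x := by
      simpa [hd] using e2
    rw [e1, e3, hc, ← hamiltonian_array_sub hN hr.le hb (hJ.tameArray_covArray hN _)
      (hJ.tameArray_covArray hN _) hx]
    congr 1
    ext a
    simp only [covArray, inner_sub_left, hD]

/-- The modulus is continuous at the base point and vanishes there: in the common frame the two
points `x₀` have overlap `cos² + sin² = 1`, so the variance of the increment is zero. -/
theorem exists_meanModulus_lt (hr : 1 < r) (hb : SmoothCoeff b r) (hpure : NotPure b)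
    (hq0 : 0 ≤ q) (hq1 : q ≤ 1) {s : ℝ} (hs : |s| ≤ q) (hreg : Regular b q s) (v : Fin 4 → ℝ)
    {η : ℝ} (hη : 0 < η) :
    ∃ ε > 0, ∀ s' v', |s'| ≤ q → Regular b q s' → |s' - s| < ε → dist v' v < ε →
      meanModulus b q s v (s', v') < η := by
  have hs1 : s / q * (s / q) + sinCoord q s * sinCoord q s = 1 := by
    have := sinCoord_sq hq0 hs
    nlinarith
  have hcont : ContinuousWithinAt (meanModulus b q s v) {x | |x.1| ≤ q ∧ Regular b q x.1}
      (s, v) := by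
    have h1 : ContinuousWithinAt (fun x : ℝ × (Fin 4 → ℝ) => meanCoeff b q x.1 x.2)
        {x | |x.1| ≤ q ∧ Regular b q x.1} (s, v) :=
      continuousOn_meanCoeff hr hb hpure hq0 hq1 (s, v) ⟨hs, hreg⟩
    have h2 : ContinuousAt (fun x : ℝ × (Fin 4 → ℝ) =>
        s / q * (x.1 / q) + sinCoord q s * sinCoord q x.1) (s, v) := by
      have := continuous_sinCoord q
      fun_prop
    have h3 : ContinuousAt (mixture b) (s / q * (s / q) + sinCoord q s * sinCoord q s) := by
      rw [hs1]
      exact (hasDerivAt_mixture hr hb (by simpa using hr)).continuousAt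
    have h4 := (ContinuousAt.comp (x := (s, v)) h3 h2).continuousWithinAt
      (s := {x | |x.1| ≤ q ∧ Regular b q x.1})
    exact (continuousWithinAt_const.mul (h1.sub continuousWithinAt_const).norm).add
      (continuousWithinAt_const.mul
        ((continuousWithinAt_const.mul (continuousWithinAt_const.sub h4)).sqrt))
  obtain ⟨ε, hε, h⟩ := Metric.continuousWithinAt_iff.1 hcont η hη
  refine ⟨ε, hε, fun s' v' hs' hreg' hds hdv => ?_⟩
  have h0 : meanModulus b q s v (s, v) = 0 := by simp [meanModulus, hs1]
  have := h (x := (s', v')) ⟨hs', hreg'⟩ (max_lt (by simpa [Real.dist_eq] using hds) hdv)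
  rw [h0, Real.dist_eq, sub_zero] at this
  exact (le_abs_self _).trans_lt this

end Means

/-! ### Exponential rates, the coupling, and the main result -/

/-- Half of the exponent absorbs the constant `C` for large `N`, which leaves a rate of at most `-a
/ 2`, uniformly in the configuration. -/
theorem expRate_neg {q t C a : ℝ} (ha : 0 < a) {f : ∀ N : ℕ, Config N q → ℝ≥0∞}
    (hf : ∀ N : ℕ, 1 ≤ N → ∀ c : Config N q,
      f N c ≤ ENNReal.ofReal (C * Real.exp (-a * (N : ℝ)))) : expRate q t f < 0 := by
  have h1 : ∀ᶠ N : ℕ in atTop, C ≤ Real.exp (a / 2 * N) :=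
    (Real.tendsto_exp_atTop.comp (tendsto_natCast_atTop_atTop.const_mul_atTop
      (by positivity))).eventually_ge_atTop C
  have h2 : expRate q t f ≤ ((-(a / 2) : ℝ) : EReal) := by
    refine limsup_le_of_le (by isBoundedDefault) ?_
    filter_upwards [h1, eventually_ge_atTop 1] with N hC hN
    refine iSup₂_le fun c _ => ?_
    have hN0 : (N : ℝ) ≠ 0 := by positivity
    have h3 : f N c ≤ ENNReal.ofReal (Real.exp (-(a / 2) * N)) := by
      refine (hf N hN c).trans (ENNReal.ofReal_le_ofReal ?_)
      calc C * Real.exp (-a * N) ≤ Real.exp (a / 2 * N) * Real.exp (-a * N) := by gcongr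
        _ = Real.exp (-(a / 2) * N) := by rw [← Real.exp_add]; ring_nf
    have h4 := ENNReal.log_le_log h3
    rw [ENNReal.log_ofReal_of_pos (Real.exp_pos _), Real.log_exp] at h4
    refine (EReal.div_le_div_right_of_nonneg (by positivity) h4).trans_eq ?_
    rw [show (N : EReal) = ((N : ℝ) : EReal) by simp, ← EReal.coe_div, mul_div_cancel_right₀ _ hN0]
  exact h2.trans_lt (by exact_mod_cast (by linarith : -(a / 2) < 0))

section Coupling

variable {N : ℕ} {Ω : Type u} [MeasurableSpace Ω] {P : Measure Ω} [IsProbabilityMeasure P]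
  {J : DisorderIdx N → Ω → ℝ} {b : ℕ → ℝ} {rbar : ℝ≥0∞} {q : ℝ}

/-- The coefficients are summable only for radii strictly below `rbar`, which may be infinite; the
domain is exhausted by such balls. It is empty for `N = 0`. -/
theorem exists_ball_of_mem_domainBall {rs : ℝ} (hrbar : ENNReal.ofReal rs < rbar) {x : Eu N}
    (hx : x ∈ domainBall rbar N) :
    1 ≤ N ∧ ∃ r : ℝ, rs < r ∧ ENNReal.ofReal r < rbar ∧ x ∈ Metric.ball (0 : Eu N) (r * √N) := by
  have hx' : ‖x‖ₑ < rbar * ENNReal.ofReal √N := hx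
  have hN : 1 ≤ N := by
    by_contra! h
    obtain rfl : N = 0 := by omega
    simp at hx'
  have hs : 0 < √(N : ℝ) := Real.sqrt_pos.2 (by positivity)
  have h1 : ENNReal.ofReal (‖x‖ / √N) < rbar := by
    rw [ENNReal.ofReal_div_of_pos hs, ofReal_norm]
    exact ENNReal.div_lt_of_lt_mul hx'
  obtain ⟨m, hm1, hm2⟩ := exists_between (max_lt hrbar h1)
  have hm : m ≠ ∞ := (hm2.trans_le le_top).ne
  refine ⟨hN, m.toReal, ?_, by rwa [ENNReal.ofReal_toReal hm], ?_⟩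
  · have h2 := (le_max_left _ _).trans_lt hm1
    by_contra! h
    exact absurd (ENNReal.ofReal_le_ofReal h) (by rwa [ENNReal.ofReal_toReal hm, not_le])
  · rw [mem_ball_zero_iff, ← div_lt_iff₀ hs]
    exact (ENNReal.ofReal_lt_iff_lt_toReal (by positivity) hm).1 ((le_max_right _ _).trans_lt hm1)

variable {ι : Type} [Fintype ι] [DecidableEq ι] {Y : ι → Ω → ℝ}

theorem IsDisorder.identDistrib_condCentered (hJ : IsDisorder P J) {rs : ℝ} (hrs : 1 < rs)
    (hrbar : ENNReal.ofReal rs < rbar) (hb : IsMixture rbar b)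
    (hY : 1 ≤ N → ∀ i, InGaussianSpace P J (Y i)) (s : Finset (Eu N))
    (hs : (s : Set (Eu N)) ⊆ domainBall rbar N) :
    IdentDistrib (fun ω (x : s) => condCentered P Y (fun ω => hamiltonian b (J · ω) x) ω)
      (fun ω (x : s) => condCentered P Y (fun ω => hamiltonian b (J · ω) x) ω) P P := by
  refine IdentDistrib.refl (aemeasurable_pi_iff.2 fun x => ?_)
  obtain ⟨hN, r, hr, hr', hx⟩ := exists_ball_of_mem_domainBall hrbar (hs x.2)
  have hX := hJ.inGaussianSpace_hamiltonian hN (hrs.trans hr).le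
    (hb.smoothCoeff (by linarith) hr') hx
  refine hX.1.aestronglyMeasurable.aemeasurable.sub ?_
  simp only [condMean, dotProduct]
  exact Finset.aemeasurable_fun_sum _ fun i _ =>
    ((hY hN i).1.aestronglyMeasurable.aemeasurable).const_mul _

theorem IsDisorder.ae_contDiffOn_condCentered (hJ : IsDisorder P J) {rs : ℝ} (hrs : 1 < rs)
    (hrbar : ENNReal.ofReal rs < rbar) (hb : IsMixture rbar b)
    (hY : 1 ≤ N → ∀ i, InGaussianSpace P J (Y i)) :
    ∀ᵐ ω ∂P, ContDiffOn ℝ 2 (fun x => condCentered P Y (fun ω => hamiltonian b (J · ω) x) ω)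
      (domainBall rbar N) := by
  rcases N.eq_zero_or_pos with h0 | hN
  · refine Eventually.of_forall fun ω x hx => ?_
    have := (exists_ball_of_mem_domainBall hrbar hx).1
    omega
  -- The event of full probability does not depend on the radius, so smoothness, being local, holds
  -- on the whole domain at once.
  · filter_upwards [hJ.ae_tameArray hN] with ω hω x hx
    obtain ⟨-, r, hr, hr', hx⟩ := exists_ball_of_mem_domainBall hrbar hx
    have hbr := hb.smoothCoeff (by linarith) hr'
    have h1 := contDiffOn_hamiltonian hN (hrs.trans hr).le hbr
      (hJ.tameArray_residual (Y := Y) hN hω)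
    have h2 := h1.congr fun x hx =>
      hJ.condCentered_hamiltonian hN (hrs.trans hr).le hbr hx (hY hN) hω
    exact (h2.contDiffAt (Metric.isOpen_ball.mem_nhds hx)).contDiffWithinAt

/-- The two fields, on the probability space of the disorder. -/
def IsDisorder.fieldCoupling (hJ : IsDisorder P J) {rs : ℝ} (hrs : 1 < rs)
    (hrbar : ENNReal.ofReal rs < rbar) (hb : IsMixture rbar b) (hq1 : q ≤ 1) (c : Config N q) :
    FieldCoupling (domainBall rbar N) P (fieldZero P J b b c) (fieldO P J b c) :=
  have hbs := hb.smoothCoeff (by linarith) hrbar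
  have h1 : 1 ≤ N → ∀ i, InGaussianSpace P J (condVec b J c i) := fun hN =>
    (hJ.condVec_spec hN hrs hbs hq1 c).1
  have h2 : 1 ≤ N → ∀ i, InGaussianSpace P J (sphGradVec b J c i) := fun hN i =>
    (hJ.sphGradVec_spec hN hrs hbs hq1 c i).1
  { Ω' := Ω
    mΩ' := inferInstance
    P' := P
    isProb := inferInstance
    X' := fieldZero P J b b c
    Y' := fieldO P J b c
    law_X' := hJ.identDistrib_condCentered hrs hrbar hb h1
    law_Y' := hJ.identDistrib_condCentered hrs hrbar hb h2
    smooth_X' := hJ.ae_contDiffOn_condCentered hrs hrbar hb h1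
    smooth_Y' := hJ.ae_contDiffOn_condCentered hrs hrbar hb h2 }

end Coupling

section Bounds

variable {Ω : ℕ → Type u} [∀ N, MeasurableSpace (Ω N)] {P : ∀ N, Measure (Ω N)}
  [∀ N, IsProbabilityMeasure (P N)] {J : ∀ N, DisorderIdx N → Ω N → ℝ} {b b' : ℕ → ℝ} {r q : ℝ}

/-- The Hessians of a family of fields whose randomness enters through the residual disorder are
bounded by a multiple of `coeffSum`, up to exponentially small probabilities. -/
theorem expRate_hessSup_residual_neg (hJ : ∀ N, IsDisorder (P N) (J N)) (hr : 1 < r)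
    (hb : SmoothCoeff b r) (hb' : SmoothCoeff b' r) (hq1 : q ≤ 1) {t : ℝ}
    {f : ∀ N : ℕ, Config N q → Eu N → Ω N → ℝ}
    (hf : ∀ N : ℕ, 1 ≤ N → ∀ (c : Config N q) ω, (TameArray fun a => J N a ω) →
      ∀ x ∈ Metric.ball (0 : Eu N) (r * √N),
        f N c x ω = hamiltonian b' (fun a => residualArray (P N) (J N) (condVec b (J N) c) a ω) x)
    {κ : ℝ≥0} (hκ : 7 * coeffSum b' r < κ) :
    expRate q t (fun N c => P N {ω | (κ : ℝ≥0∞) ≤ hessSup r (fun x => f N c x ω)}) < 0 := by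
  refine expRate_neg (C := tailConst) one_pos fun N hN c => ?_
  have := (hJ N).measure_hessSup_residual_le hN hr.le hb'
    ((hJ N).condVec_spec hN hr hb hq1 c).1 (hf N hN c) hκ
  simpa using this

/-- The conditional means near `V` are represented by uniformly bounded classes. -/
theorem exists_fieldMean_class_bound (hJ : ∀ N, IsDisorder (P N) (J N)) (hr : 1 < r)
    (hb : SmoothCoeff b r) (hpure : NotPure b) (hq0 : 0 ≤ q) (hq1 : q ≤ 1) {V : Params} {δ : ℝ}
    (hδ : 0 < δ) (hreg : ∀ s : ℝ, |s| ≤ q → |s - V.qo| ≤ δ → Regular b q s) :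
    ∃ C : ℝ, 0 ≤ C ∧ ∀ N : ℕ, 1 ≤ N → ∀ (c : Config N q) (V' : Params), Near q δ V V' →
      c.overlap = V'.qo → ∃ g : Lp ℝ 2 (P N), ‖g‖ ≤ √N * C ∧
        ∀ b' : ℕ → ℝ, SmoothCoeff b' r → ∀ x ∈ Metric.ball (0 : Eu N) (r * √N),
          fieldMean (P N) (J N) b b' c V' 0 x = hamiltonian b' (covArray (P N) (J N) g) x := by
  obtain ⟨C, hC, h⟩ := exists_norm_meanCoeff_le hr hb hpure hq0 hq1 hδ hreg
  have hL := meanBound_nonneg b q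
  refine ⟨meanBound b q * C, by positivity, fun N hN c V' hV' hov => ?_⟩
  have hs := c.abs_overlap_le hq0
  obtain ⟨g, hg, hg'⟩ := (hJ N).exists_fieldMean_eq hN hr hb hpure hq0 hq1
    (hreg _ hs (hov ▸ hV'.qo.le)) hV'.hard
  refine ⟨g, hg.trans ?_, hg'⟩
  have := h V' hV' (hov ▸ hs)
  rw [hov]
  gcongr

end Bounds

end

theorem lemma3p5
    (rs : ℝ) (rbar : ℝ≥0∞) (hrs : 1 < rs) (hrbar : ENNReal.ofReal rs < rbar)
    (b : ℕ → ℝ) (hb : IsMixture rbar b) (hpure : NotPure b)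
    {Ω : ℕ → Type u} [∀ N, MeasurableSpace (Ω N)]
    (P : ∀ N, Measure (Ω N)) [∀ N, IsProbabilityMeasure (P N)]
    (J : ∀ N, DisorderIdx N → Ω N → ℝ) (hJ : ∀ N, IsDisorder (P N) (J N))
    (q : ℝ) (hq0 : 0 ≤ q) (hq1 : q ≤ 1)
    (V : Params) (hV : Allowed b q V) :
    -- every small enough `δ` satisfies the requirement on `δ` below
    (∃ δ₀ : ℝ, 0 < δ₀ ∧ ∀ s : ℝ, |s| ≤ q → |s - V.qo| ≤ δ₀ → Regular b q s) ∧
    (∀ δ : ℝ, 0 < δ → (∀ s : ℝ, |s| ≤ q → |s - V.qo| ≤ δ → Regular b q s) →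
      (∃ κ : ℝ≥0,
        expRate q q (fun N c => P N {ω | (κ : ℝ≥0∞) ≤
          hessSup rs (fun x => fieldZero (P N) (J N) b b c x ω)}) < 0 ∧
        ∀ N : ℕ, 1 ≤ N → ∀ (c : Config N q) (V' : Params), Near q δ V V' → c.overlap = V'.qo →
          hessSup rs (fieldMean (P N) (J N) b b c V' 0) ≤ κ) ∧
      (∃ κ : ℕ → ℝ≥0, Tendsto κ atTop (𝓝 0) ∧ ∀ m : ℕ,
        expRate q q (fun N c => P N {ω | (κ m : ℝ≥0∞) ≤
          hessSup rs (fun x => fieldZero (P N) (J N) b b c x ω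
            - fieldZero (P N) (J N) b (truncate m b) c x ω)}) < 0 ∧
        ∀ N : ℕ, 1 ≤ N → ∀ (c : Config N q) (V' : Params), Near q δ V V' → c.overlap = V'.qo →
          hessSup rs (fun x => fieldMean (P N) (J N) b b c V' 0 x
            - fieldMean (P N) (J N) b (truncate m b) c V' 0 x) ≤ κ m)) ∧
    -- `G'` and `w` are the other coordinates of the conditioning value
    (∀ η : ℝ≥0, 0 < η → ∃ ε : ℝ, 0 < ε ∧
      ∀ N : ℕ, 1 ≤ N → ∀ (c c' : Config N q) (z : Eu N), c'.xs = c.xs →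
        IsSecondAxis c z → IsSecondAxis c' z → c.overlap = V.qo →
        ∀ (V' : Params) (G' : ℝ) (w : Eu N), Near q ε V V' → c'.overlap = V'.qo →
          |G'| < ε → ⟪w, c.xs⟫ = 0 → ⟪w, z⟫ = 0 → ‖w‖ < ε * √N → (q = 0 → G' = 0 ∧ w = 0) →
          hessSup rs (fun x =>
            fieldMean (P N) (J N) b b c' V' ((G' * ‖c'.xs‖) • z + w) x
              - fieldMean (P N) (J N) b b c V 0 x) ≤ η) ∧
    (∃ C : ∀ (N : ℕ) (c : Config N q), FieldCoupling (domainBall rbar N) (P N)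
        (fieldZero (P N) (J N) b b c) (fieldO (P N) (J N) b c),
      ∀ δ : ℝ, 0 < δ →
        expRate q (min q (1 - δ)) (fun N c => (C N c).P' {ω | ENNReal.ofReal (2 * δ) ≤
          hessSup rs (fun x => (C N c).X' x ω - (C N c).Y' x ω)}) < 0) := by
  have hr0 : 0 < rs := by linarith
  have hbs := hb.smoothCoeff hr0 hrbar
  have hS := coeffSum_nonneg b hr0.le
  refine ⟨hV.exists_regular, fun δ hδ hreg => ?_, fun η hη => ?_, ?_⟩
  · obtain ⟨C, hC, hmean⟩ := exists_fieldMean_class_bound hJ hrs hbs hpure hq0 hq1 hδ hreg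
    -- The 7 accounts for the random part and `C` for the mean; the `+ 1` makes the threshold strict
    -- for the random part.
    refine ⟨⟨((7 + C) * coeffSum b rs + 1).toNNReal, ?_, fun N hN c V' hV' hov => ?_⟩, ?_⟩
    · refine expRate_hessSup_residual_neg hJ hrs hbs hbs hq1 (fun N hN c ω hω x hx => ?_) ?_
      · exact (hJ N).condCentered_hamiltonian hN hrs.le hbs hx
          ((hJ N).condVec_spec hN hrs hbs hq1 c).1 hω
      · rw [Real.coe_toNNReal _ (by positivity)]
        nlinarith
    · obtain ⟨g, hg, hg'⟩ := hmean N hN c V' hV' hov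
      refine ((hJ N).hessSup_le_of_covArray hN hrs.le hbs hg (hg' b hbs)).trans ?_
      exact ENNReal.ofReal_le_ofReal (by nlinarith)
    · have hbt : ∀ m, SmoothCoeff (truncate m b) rs := fun m =>
        hbs.mono hr0.le (abs_truncate_le m b)
      have hbd : ∀ m, SmoothCoeff (fun p => b p - truncate m b p) rs := fun m =>
        hbs.mono hr0.le (abs_sub_truncate_le m b)
      have hSd : ∀ m, 0 ≤ coeffSum (fun p => b p - truncate m b p) rs := fun m =>
        coeffSum_nonneg _ hr0.le
      have hinv : ∀ m : ℕ, (0 : ℝ) < 1 / ((m : ℝ) + 1) := fun m => by positivity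
      -- The term `1 / (m + 1)` keeps the threshold strict even where the truncation error vanishes,
      -- as for finitely many non-zero coefficients.
      refine ⟨fun m => ((7 + C) * coeffSum (fun p => b p - truncate m b p) rs
        + 1 / ((m : ℝ) + 1)).toNNReal, ?_, fun m => ⟨?_, fun N hN c V' hV' hov => ?_⟩⟩
      · have := tendsto_real_toNNReal
          (((tendsto_coeffSum_sub_truncate hr0.le hbs).const_mul (7 + C)).add
            tendsto_one_div_add_atTop_nhds_zero_nat)
        simpa using this
      · refine expRate_hessSup_residual_neg hJ hrs hbs (hbd m) hq1 (fun N hN c ω hω x hx => ?_) ?_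
        · have hY := ((hJ N).condVec_spec hN hrs hbs hq1 c).1
          rw [hamiltonian_coeff_sub hN hrs.le hbs (hbt m) ((hJ N).tameArray_residual hN hω) hx]
          exact congrArg₂ _ ((hJ N).condCentered_hamiltonian hN hrs.le hbs hx hY hω)
            ((hJ N).condCentered_hamiltonian hN hrs.le (hbt m) hx hY hω)
        · have h1 := hSd m
          have h2 := hinv m
          rw [Real.coe_toNNReal _ (by positivity)]
          nlinarith
      · obtain ⟨g, hg, hg'⟩ := hmean N hN c V' hV' hov
        refine ((hJ N).hessSup_le_of_covArray hN hrs.le (hbd m) hg fun x hx => ?_).trans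
          (ENNReal.ofReal_le_ofReal (by nlinarith [hSd m, hinv m]))
        rw [hamiltonian_coeff_sub hN hrs.le hbs (hbt m) ((hJ N).tameArray_covArray hN g) hx,
          hg' b hbs x hx, hg' _ (hbt m) x hx]
  · have hη' : (0 : ℝ) < η := hη
    obtain ⟨δ₀, hδ₀, hreg⟩ := hV.exists_regular
    set K := √(|mixture'' b (q ^ 2)| + |mixture' b (q ^ 2)|) * |(mixture' b (q ^ 2))⁻¹|
    have hK : 0 ≤ K := by positivity
    obtain ⟨ε, hε, h⟩ := exists_meanModulus_lt hrs hbs hpure hq0 hq1 hV.abs_qo_le hV.regular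
      (meanData q V 0) (η := η / (2 * (coeffSum b rs + 1))) (by positivity)
    -- The first entry puts overlap and data within the range of the modulus, with `ε / 2` for
    -- strictness; the second keeps the new overlap regular; the third limits the contribution of
    -- `w` to `η / 2`, the other half being the modulus.
    set ε' := min (min (ε / 2) δ₀) (η / (2 * ((K + 1) * (coeffSum b rs + 1)))) with hε'
    have hε'0 : 0 < ε' := by positivity
    have h1 : ε' ≤ ε / 2 := (min_le_left _ _).trans (min_le_left _ _)
    have h2 : ε' ≤ δ₀ := (min_le_left _ _).trans (min_le_right _ _)
    have h3 : ε' ≤ η / (2 * ((K + 1) * (coeffSum b rs + 1))) := min_le_right _ _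
    refine ⟨ε', hε'0, fun N hN c c' z hxs hz hz' hov V' G' w hV' hov' hG' hwx hwz hw hw0 => ?_⟩
    have hs' := c'.abs_overlap_le hq0
    have hreg' : Regular b q c'.overlap := hreg _ hs' (hov' ▸ hV'.qo.le.trans h2)
    refine ((hJ N).hessSup_fieldMean_sub_le hN hrs hbs hpure hq0 hq1 (hov ▸ hV.regular) hreg' hxs
      hz hz' hV.hard hV'.hard G' hwx hwz (fun h => (hw0 h).2) hw.le).trans ?_
    refine ENNReal.ofReal_le_of_le_toReal ?_
    rw [ENNReal.coe_toReal, hov]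
    have h4 := h c'.overlap (meanData q V' G') hs' hreg' (by rw [hov']; linarith [hV'.qo])
      ((hV'.dist_meanData_le hq0 hq1 hG'.le).trans_lt (by linarith))
    rw [lt_div_iff₀ (by positivity)] at h4
    rw [le_div_iff₀ (by positivity)] at h3
    have h5 : K * ε' * coeffSum b rs ≤ ε' * ((K + 1) * (coeffSum b rs + 1)) := by
      nlinarith [mul_nonneg hε'0.le hK, mul_nonneg hε'0.le hS]
    have h6 : 0 ≤ meanModulus b q V.qo (meanData q V 0) (c'.overlap, meanData q V' G') := by
      have := meanBound_nonneg b q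
      unfold meanModulus
      positivity
    nlinarith
  -- The coupling is the common disorder. The tail bound is uniform over all configurations, hence
  -- over those with restricted overlap.
  · refine ⟨fun N c => (hJ N).fieldCoupling hrs hrbar hb hq1 c, fun δ hδ => ?_⟩
    refine expRate_neg (C := 6) (a := 2 * δ ^ 2 / (9 * (coeffSum b rs + 1) ^ 2)) (by positivity)
      fun N hN c => ?_
    exact (hJ N).measure_hessSup_fieldZero_sub_fieldO_le hN hrs hbs hq1 c hδ
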